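/- Let $k$ be a field and let $\mathcal{A}$ be a graded directed $k$-linear category with finitely many objects. This means: every $\mathcal{A}(x,y)$ is finite dimensional; there is a fixed partial order $\leqslant$ on the objects such that $\mathcal{A}(x,y)\neq 0$ implies $x\leqslant y$; there is a grading $\mathcal{A}(x,y)=\bigoplus_{i\geqslant 0}\mathcal{A}(x,y)_i$ such that, with $\mathcal{A}_i=\bigoplus_{x,y}\mathcal{A}(x,y)_i$, one has $\mathcal{A}_i\cdot\mathcal{A}_j=\mathcal{A}_{i+j}$ for all $i,j\geqslant 0$ and $\mathcal{A}_0=\bigoplus_x\mathcal{A}(x,x)$. Identify $\mathcal{A}$ with its associated algebra $\bigoplus_{x,y}\mathcal{A}(x,y)$ (composition from right to left); modules are left modules. Suppose that $\mathcal{A}_0$ has the splitting property (S) every exact sequence $0\to P\to Q\to R\to 0$ of finitely generated left (resp. right) $\mathcal{A}_0$-modules with $P$ and $Q$ projective splits. Let $\mathcal{D}\subseteq\mathcal{A}$ be the graded subcategory with the same objects, $\mathcal{D}(x,x)=k\cdot 1_x$, and $\mathcal{D}(x,y)=\mathcal{A}(x,y)$ for $x\neq y$. For $B=\mathcal{A}$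 or $B=\mathcal{D}$, a graded $B$-module $M=\bigoplus_{i\in\mathbb{Z}}M_i$ is generated in degree $s$ if $M=B\cdot M_s$. It is Koszul if it is generated in degree $0$ and has a graded projective resolution $\cdots\to P^1\to P^0\to M\to 0$ with $P^i$ generated in degree $i$ for all $i\geqslant 0$. The category $B$ is Koszul if $B_0=B/\bigoplus_{i\geqslant 1}B_i$ is a Koszul $B$-module, and Koszul in the classical sense if moreover $B_0$ is semisimple. Choose for every object $x$ a complete set of orthogonal primitive idempotents $\{e_\lambda\}_{\lambda\in\Lambda_x}$ of $\mathcal{A}(x,x)$, let $\Lambda=\bigsqcup_x\Lambda_x$, and for $\lambda\in\Lambda_x$, $\mu\in\Lambda_y$ put $\lambda\preceq\mu$ if and only if $x\leqslant y$. Let $P_\lambda=\mathcal{A}e_\lambda$ and $S_\lambda=P_\lambda/\operatorname{rad}P_\lambda$. The category $\mathcal{A}$ is standardly stratified if there are $\mathcal{A}$-modules $\Delta_\lambda$ ($\lambda\in\Lambda$) such that $[\Delta_\lambda:S_\mu]=0$ whenever $\mu\not\preceq\lambda$, and such that for every $\lambda$ there is a short exact sequence $0\to K_\lambda\to P_\lambda\to\Delta_\lambda\to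 0$ in which $K_\lambda$ has a finite filtration whose factors are of the form $\Delta_\mu$ with $\mu\succ\lambda$ (that is, $\lambda\preceq\mu$ and $\mu\not\preceq\lambda$). Then: (1) For every choice of the idempotents, $\mathcal{A}$ is Koszul if and only if $\mathcal{A}$ is standardly stratified and $\mathcal{D}$ is Koszul in the classical sense. (2) If $\mathcal{A}$ is Koszul, then a graded $\mathcal{A}$-module $M$ that is generated in degree $0$ and whose components $M_i$ are all finite dimensional is Koszul if and only if its restriction $M\downarrow^{\mathcal{A}}_{\mathcal{D}}$ is a Koszul $\mathcal{D}$-module and $M$ is a projective $\mathcal{A}_0$-module. -/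

import Mathlib

open CategoryTheory

universe w v u

/-! ## Graded modules and generalized Koszul theory over a positively graded algebra -/

section Koszul

/-- A graded left module `M = ⨁_{i ∈ ℤ} M_i` over a positively graded `k`-algebra
`R = ⨁_{i ≥ 0} R_i`. -/
structure GrMod (k : Type w) [Field k] (R : Type u) [Ring R] [Algebra k R]
    (𝒜 : ℕ → Submodule k R) where
  carrier : Type u
  [addCommGroup : AddCommGroup carrier]
  [moduleBase : Module k carrier]
  [module : Module R carrier]
  [isScalarTower : IsScalarTower k R carrier]
  deg : ℤ → Submodule k carrier
  isInternal : DirectSum.IsInternal deg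
  smul_mem : ∀ {i : ℕ} {j : ℤ} {a : R} {m : carrier},
    a ∈ 𝒜 i → m ∈ deg j → a • m ∈ deg (i + j)

attribute [instance] GrMod.addCommGroup GrMod.moduleBase GrMod.module GrMod.isScalarTower

variable {k : Type w} [Field k] {R : Type u} [Ring R] [Algebra k R] {𝒜 : ℕ → Submodule k R}

/-- `M` is locally finite: every homogeneous component is finite dimensional. -/
def GrMod.LocallyFinite (M : GrMod k R 𝒜) : Prop :=
  ∀ i : ℤ, FiniteDimensional k (M.deg i)

/-- `M` is generated in degree `s`: `M = R · M_s`. -/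
def GrMod.GeneratedInDegree (M : GrMod k R 𝒜) (s : ℤ) : Prop :=
  Submodule.span R (M.deg s : Set M.carrier) = ⊤

/-- An `R`-linear map between graded modules that preserves degrees. -/
def GrMod.IsGradedHom {M N : GrMod k R 𝒜} (f : M.carrier →ₗ[R] N.carrier) : Prop :=
  ∀ (i : ℤ) (m : M.carrier), m ∈ M.deg i → f m ∈ N.deg i

/-- A graded module is Koszul if it is generated in degree `0` and has a graded projective
resolution `… → P 2 → P 1 → P 0 → M → 0` with `P n` generated in degree `n` for all `n`. -/
def GrMod.IsKoszul (M : GrMod k R 𝒜) : Prop :=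
  M.GeneratedInDegree 0 ∧
    ∃ (P : ℕ → GrMod k R 𝒜)
      (d : ∀ n : ℕ, (P (n + 1)).carrier →ₗ[R] (P n).carrier)
      (ε : (P 0).carrier →ₗ[R] M.carrier),
      (∀ n, Module.Projective R (P n).carrier) ∧
      (∀ n : ℕ, (P n).GeneratedInDegree n) ∧
      (∀ n, GrMod.IsGradedHom (d n)) ∧ GrMod.IsGradedHom ε ∧
      (∀ n, Function.Exact (d (n + 1)) (d n)) ∧ Function.Exact (d 0) ε ∧
      Function.Surjective ε

variable (𝒜)

/-- The grading of a vector space `V` concentrated in degree `0`. -/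
def concentratedInZero (k : Type w) [Field k] (V : Type u) [AddCommGroup V] [Module k V] (i : ℤ) :
    Submodule k V :=
  if i = 0 then ⊤ else ⊥

theorem concentratedInZero_zero (V : Type u) [AddCommGroup V] [Module k V] :
    concentratedInZero k V 0 = ⊤ := if_pos rfl

theorem concentratedInZero_ne (V : Type u) [AddCommGroup V] [Module k V] {i : ℤ} (h : i ≠ 0) :
    concentratedInZero k V i = ⊥ := if_neg h

theorem concentratedInZero_isInternal (V : Type u) [AddCommGroup V] [Module k V] :
    DirectSum.IsInternal (concentratedInZero k V) := by
  rw [DirectSum.isInternal_submodule_iff_iSupIndep_and_iSup_eq_top]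
  constructor
  · intro i
    by_cases h : i = 0
    · have h2 : (⨆ j : ℤ, ⨆ (_ : j ≠ i), concentratedInZero k V j) ≤ ⊥ :=
        iSup₂_le fun j hj => (concentratedInZero_ne V (h ▸ hj)).le
      exact disjoint_bot_right.mono_right h2
    · rw [concentratedInZero_ne V h]
      exact disjoint_bot_left
  · rw [eq_top_iff, ← concentratedInZero_zero (k := k) V]
    exact le_iSup (concentratedInZero k V) 0

theorem concentratedInZero_smul_mem [GradedAlgebra 𝒜] {i : ℕ} {j : ℤ} {a : R}
    {m : R ⧸ (HomogeneousIdeal.irrelevant 𝒜).toIdeal} (ha : a ∈ 𝒜 i)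
    (hm : m ∈ concentratedInZero k (R ⧸ (HomogeneousIdeal.irrelevant 𝒜).toIdeal) j) :
    a • m ∈ concentratedInZero k (R ⧸ (HomogeneousIdeal.irrelevant 𝒜).toIdeal) (i + j) := by
  by_cases hj : j = 0
  · subst hj
    by_cases hi : i = 0
    · subst hi
      rw [Nat.cast_zero, zero_add, concentratedInZero_zero]
      exact Submodule.mem_top
    · obtain ⟨r, rfl⟩ := Submodule.Quotient.mk_surjective _ m
      have h0 : a • (Submodule.Quotient.mk r :
          R ⧸ (HomogeneousIdeal.irrelevant 𝒜).toIdeal) = 0 := by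
        rw [← Submodule.Quotient.mk_smul, Submodule.Quotient.mk_eq_zero]
        change a * r ∈ (HomogeneousIdeal.irrelevant 𝒜)
        rw [HomogeneousIdeal.mem_irrelevant_iff, GradedRing.proj_apply,
          DirectSum.coe_decompose_mul_of_left_mem_of_not_le 𝒜 ha (by omega)]
      rw [h0]
      exact Submodule.zero_mem _
  · rw [concentratedInZero_ne _ hj, Submodule.mem_bot] at hm
    rw [hm, smul_zero]
    exact Submodule.zero_mem _

/-- The degree `0` component `R_0`, as a graded left `R`-module concentrated in degree `0`:
the quotient of `R` by `⨁_{i ≥ 1} R_i`. -/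
noncomputable def GrMod.degreeZero [GradedAlgebra 𝒜] : GrMod k R 𝒜 where
  carrier := R ⧸ (HomogeneousIdeal.irrelevant 𝒜).toIdeal
  deg := concentratedInZero k (R ⧸ (HomogeneousIdeal.irrelevant 𝒜).toIdeal)
  isInternal := concentratedInZero_isInternal _
  smul_mem := concentratedInZero_smul_mem 𝒜

/-- `R` is a (generalized) Koszul algebra: `R_0` is a Koszul `R`-module. -/
def IsKoszulAlgebra [GradedAlgebra 𝒜] : Prop :=
  (GrMod.degreeZero 𝒜).IsKoszul

/-- The degree `0` component as a subalgebra of `R`. -/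
abbrev degZeroAlg [GradedAlgebra 𝒜] : Subalgebra k R :=
  SetLike.GradeZero.subalgebra 𝒜

/-- `R` is a Koszul algebra in the classical sense: `R_0` is semisimple and has a linear
projective resolution. -/
def IsClassicalKoszulAlgebra [GradedAlgebra 𝒜] : Prop :=
  IsSemisimpleRing (degZeroAlg 𝒜) ∧ IsKoszulAlgebra 𝒜

/-- Every short exact sequence `0 → P → Q → R → 0` of finitely generated left `B`-modules with
`P` and `Q` projective splits. -/
def SplitsProjectives (B : Type u) [Ring B] : Prop :=
  ∀ (P Q R : Type u) [AddCommGroup P] [AddCommGroup Q] [AddCommGroup R]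
    [Module B P] [Module B Q] [Module B R] [Module.Finite B P] [Module.Finite B Q]
    [Module.Projective B P] [Module.Projective B Q] (f : P →ₗ[B] Q) (g : Q →ₗ[B] R),
    Function.Injective f → Function.Exact f g → Function.Surjective g →
    ∃ s : R →ₗ[B] Q, g ∘ₗ s = LinearMap.id

/-- The splitting condition (S), for left and for right modules. -/
def SplittingConditionS (B : Type u) [Ring B] : Prop :=
  SplitsProjectives B ∧ SplitsProjectives Bᵐᵒᵖ

variable {𝒜}

/-- Restriction of a graded module to a subalgebra with the induced grading. -/
def GrMod.restrict (M : GrMod k R 𝒜) (S : Subalgebra k R) :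
    GrMod k S (fun n => (𝒜 n).comap S.val.toLinearMap) where
  carrier := M.carrier
  deg := M.deg
  isInternal := M.isInternal
  smul_mem := fun ha hm => M.smul_mem ha hm

end Koszul

/-! ## Filtrations and composition factors -/

section Stratification

variable (A : Type u) [Ring A]

/-- The simple module `S` is a composition factor of `M`, i.e. `[M : S] ≠ 0` (for `M` of finite
length): it is isomorphic to a subquotient of `M`. -/
def IsCompositionFactor (S M : Type u) [AddCommGroup S] [AddCommGroup M] [Module A S]
    [Module A M] : Prop :=
  ∃ N' N : Submodule A M, N' ≤ N ∧ Nonempty (S ≃ₗ[A] (N ⧸ N'.submoduleOf N))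

/-- `M` has a finite filtration all of whose factors are isomorphic to some `Δ i` with
`p i`. -/
def HasFiltrationBy {ι : Type*} (Δ : ι → ModuleCat.{u} A) (p : ι → Prop)
    (M : Type u) [AddCommGroup M] [Module A M] : Prop :=
  ∃ (n : ℕ) (F : ℕ → Submodule A M), F 0 = ⊥ ∧ F n = ⊤ ∧
    ∀ i < n, F i ≤ F (i + 1) ∧
      ∃ j, p j ∧ Nonempty ((F (i + 1) ⧸ (F i).submoduleOf (F (i + 1))) ≃ₗ[A] Δ j)

variable {A}

/-- The left module `A e`. -/
abbrev leftIdealOf (e : A) : Submodule A A := Submodule.span A {e}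

/-- A ring `A` with a family of idempotents `e i`, indexed by a set with a relation `pre`
(a preorder), is standardly stratified: there are modules `Δ i` such that, with `P i = A e i`
and `S i = P i / rad (P i)`, `S j` is not a composition factor of `Δ i` unless `j ≼ i`, and
there are exact sequences `0 → K i → P i → Δ i → 0` such that `K i` has a filtration with factors
`Δ j`, `j ≻ i`. -/
def IsStandardlyStratifiedFor {ι : Type*} (pre : ι → ι → Prop) (e : ι → A) : Prop :=
  ∃ Δ : ι → ModuleCat.{u} A,
    (∀ i j, ¬ pre j i →
      ¬ IsCompositionFactor A
        (leftIdealOf (e j) ⧸ Module.jacobson A (leftIdealOf (e j))) (Δ i)) ∧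
    ∀ i, ∃ π : leftIdealOf (e i) →ₗ[A] Δ i, Function.Surjective π ∧
      HasFiltrationBy A Δ (fun j => pre i j ∧ ¬ pre j i) (LinearMap.ker π)

/-- A primitive idempotent: a non-zero idempotent that is not a sum of two non-zero
orthogonal idempotents. -/
def IsPrimitiveIdempotent (e : A) : Prop :=
  IsIdempotentElem e ∧ e ≠ 0 ∧
    ∀ f g : A, IsIdempotentElem f → IsIdempotentElem g → f * g = 0 → g * f = 0 →
      f + g = e → f = 0 ∨ g = 0

end Stratification

/-! ## The associated algebra of a linear category -/

/-- The associated algebra `⨁_{x, y} C(x, y)` of a preadditive category with finitely many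
objects; an element is a family of morphisms. -/
def CatAlg (C : Type u) [Category.{v} C] : Type (max u v) := ∀ x y : C, (x ⟶ y)

namespace CatAlg

variable {C : Type u} [Category.{v} C]

@[ext]
theorem ext {a b : CatAlg C} (h : ∀ x y, a x y = b x y) : a = b :=
  funext fun x => funext fun y => h x y

variable [Preadditive C]

instance : AddCommGroup (CatAlg C) := inferInstanceAs (AddCommGroup (∀ x y : C, (x ⟶ y)))

@[simp] theorem add_apply (a b : CatAlg C) (x y : C) : (a + b) x y = a x y + b x y := rfl

@[simp] theorem zero_apply (x y : C) : (0 : CatAlg C) x y = 0 := rfl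

open Classical in
/-- The morphism `f : x ⟶ y` as an element of the associated algebra. -/
noncomputable def single (x y : C) (f : x ⟶ y) : CatAlg C := fun x' y' =>
  if h : x' = x ∧ y = y' then eqToHom h.1 ≫ f ≫ eqToHom h.2 else 0

open Classical in
noncomputable instance : One (CatAlg C) :=
  ⟨fun x y => if h : x = y then eqToHom h else 0⟩

@[simp] theorem one_apply_self (x : C) : (1 : CatAlg C) x x = 𝟙 x :=
  (dif_pos rfl).trans rfl

theorem one_apply_ne {x y : C} (h : x ≠ y) : (1 : CatAlg C) x y = 0 :=
  dif_neg h

variable [Fintype C]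

/-- The product `b * a` is composition, from right to left: first `a`, then `b`. -/
instance : Mul (CatAlg C) := ⟨fun b a x z => ∑ y, a x y ≫ b y z⟩

theorem mul_apply (b a : CatAlg C) (x z : C) : (b * a) x z = ∑ y, a x y ≫ b y z := rfl

noncomputable instance : Ring (CatAlg C) :=
  { (inferInstance : AddCommGroup (CatAlg C)) with
    mul := (· * ·)
    one := 1
    left_distrib := by intro a b c; ext x y; simp [mul_apply, Finset.sum_add_distrib]
    right_distrib := by intro a b c; ext x y; simp [mul_apply, Finset.sum_add_distrib]
    zero_mul := by intro a; ext x y; simp [mul_apply]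
    mul_zero := by intro a; ext x y; simp [mul_apply]
    mul_assoc := by
      intro a b c
      ext x y
      simp only [mul_apply, Preadditive.sum_comp, Preadditive.comp_sum, Category.assoc]
      exact Finset.sum_comm
    one_mul := by
      intro a
      ext x y
      rw [mul_apply, Finset.sum_eq_single y]
      · simp
      · intro z _ hz; simp [one_apply_ne hz]
      · simp
    mul_one := by
      intro a
      ext x y
      rw [mul_apply, Finset.sum_eq_single x]
      · simp
      · intro z _ hz; simp [one_apply_ne hz.symm]
      · simp }

variable {k : Type w} [Field k] [Linear k C]

instance : Module k (CatAlg C) := inferInstanceAs (Module k (∀ x y : C, (x ⟶ y)))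

@[simp] theorem smul_apply (r : k) (a : CatAlg C) (x y : C) : (r • a) x y = r • a x y := rfl

noncomputable instance : Algebra k (CatAlg C) :=
  Algebra.ofModule
    (by intro r a b; ext x y; simp [mul_apply, Finset.smul_sum])
    (by intro r a b; ext x y; simp [mul_apply, Finset.smul_sum])

/-- Evaluation at a pair of objects, as a linear map. -/
def evalₗ (k : Type w) [Field k] [Linear k C] (x y : C) : CatAlg C →ₗ[k] (x ⟶ y) where
  toFun a := a x y
  map_add' _ _ := rfl
  map_smul' _ _ := rfl

@[simp] theorem evalₗ_apply (a : CatAlg C) (x y : C) : evalₗ k x y a = a x y := rfl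

theorem eq_sum_single (a : CatAlg C) :
    a = ∑ x, ∑ y, CatAlg.single x y (a x y) := by
  ext x' y'
  have key : ∀ (f : C → CatAlg C) (x' y' : C), (∑ x, f x) x' y' = ∑ x, f x x' y' := by
    intro f x' y'
    exact map_sum (AddMonoidHom.mk' (fun a : CatAlg C => a x' y') fun _ _ => rfl) f Finset.univ
  rw [key, Finset.sum_eq_single x']
  · rw [key, Finset.sum_eq_single y']
    · simp [single]
    · intro y _ hy; simp [single, hy]
    · simp
  · intro x _ hx
    rw [key]
    exact Finset.sum_eq_zero fun y _ => by simp [single, hx.symm]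
  · simp

end CatAlg

/-! ## Graded directed categories -/

/-- A grading and a partial order that make the `k`-linear category `C` a graded directed
category: morphism spaces are finite dimensional, `C(x, y) ≠ 0` only if `x ≤ y`,
`C(x, y) = ⨁_{i ≥ 0} C(x, y)_i`, one has `C_j · C_i = C_{i + j}`, and `C_0` is
the direct sum of all the endomorphism algebras `C(x, x)`. -/
structure GradedDirectedCategory (k : Type w) [Field k] (C : Type u) [Category.{v} C]
    [Preadditive C] [Linear k C] where
  order : PartialOrder C
  directed : ∀ {x y : C} (f : x ⟶ y), f ≠ 0 → order.le x y
  finite : ∀ x y : C, FiniteDimensional k (x ⟶ y)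
  hom : ∀ x y : C, ℕ → Submodule k (x ⟶ y)
  isInternal : ∀ x y : C, DirectSum.IsInternal (hom x y)
  comp_mem : ∀ {x y z : C} {i j : ℕ} {f : x ⟶ y} {g : y ⟶ z},
    f ∈ hom x y i → g ∈ hom y z j → f ≫ g ∈ hom x z (i + j)
  le_span_comp : ∀ (x z : C) (i j : ℕ), hom x z (i + j) ≤
    Submodule.span k {h | ∃ (y : C) (f : x ⟶ y) (g : y ⟶ z),
      f ∈ hom x y i ∧ g ∈ hom y z j ∧ f ≫ g = h}
  hom_self_zero : ∀ x : C, hom x x 0 = ⊤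
  hom_ne_zero : ∀ {x y : C}, x ≠ y → hom x y 0 = ⊥

namespace GradedDirectedCategory

variable {k : Type w} [Field k] {C : Type u} [Category.{v} C] [Preadditive C] [Linear k C]
  [Fintype C] (𝒞 : GradedDirectedCategory k C)

/-- The degree `n` component of the associated algebra. -/
def deg (n : ℕ) : Submodule k (CatAlg C) where
  carrier := {a | ∀ x y, a x y ∈ 𝒞.hom x y n}
  add_mem' ha hb x y := Submodule.add_mem _ (ha x y) (hb x y)
  zero_mem' _ _ := Submodule.zero_mem _
  smul_mem' r _ ha x y := Submodule.smul_mem _ r (ha x y)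

theorem single_mem_deg {x y : C} {f : x ⟶ y} {n : ℕ} (hf : f ∈ 𝒞.hom x y n) :
    CatAlg.single x y f ∈ 𝒞.deg n := by
  intro x' y'
  unfold CatAlg.single
  split_ifs with h
  · obtain ⟨rfl, rfl⟩ := h
    simpa using hf
  · exact Submodule.zero_mem _

theorem deg_isInternal : DirectSum.IsInternal 𝒞.deg := by
  classical
  rw [DirectSum.isInternal_submodule_iff_iSupIndep_and_iSup_eq_top]
  constructor
  · rw [iSupIndep_iff_dfinsupp_lsum_injective]
    rw [← LinearMap.ker_eq_bot, LinearMap.ker_eq_bot']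
    intro m hm
    ext n x y
    have hi := (DirectSum.isInternal_submodule_iff_iSupIndep_and_iSup_eq_top _).1
      (𝒞.isInternal x y)
    have hinj := hi.1.dfinsupp_lsum_injective
    let φ : ∀ n, 𝒞.deg n →ₗ[k] 𝒞.hom x y n := fun n =>
      ((CatAlg.evalₗ k x y).comp (𝒞.deg n).subtype).codRestrict _ (fun a => a.2 x y)
    let m' := DFinsupp.mapRange.linearMap φ m
    have hm' : (DFinsupp.lsum ℕ fun i => (𝒞.hom x y i).subtype) m' = 0 := by
      have h2 : (CatAlg.evalₗ k x y) ((DFinsupp.lsum ℕ fun i => (𝒞.deg i).subtype) m) = 0 := by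
        rw [hm]; rfl
      rw [← h2, ← LinearMap.comp_apply, ← LinearMap.comp_apply]
      congr 1
      ext i a
      rfl
    have h3 : m' = 0 := hinj (by rw [hm', map_zero])
    have h4 := congrArg (fun t => ((t n : 𝒞.hom x y n) : x ⟶ y)) h3
    exact h4
  · rw [eq_top_iff]
    intro a _
    rw [CatAlg.eq_sum_single a]
    refine Submodule.sum_mem _ fun x _ => Submodule.sum_mem _ fun y _ => ?_
    have htop := ((DirectSum.isInternal_submodule_iff_iSupIndep_and_iSup_eq_top _).1
      (𝒞.isInternal x y)).2
    have hmem : a x y ∈ ⨆ n, 𝒞.hom x y n := by rw [htop]; trivial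
    generalize a x y = f at hmem ⊢
    induction hmem using Submodule.iSup_induction' with
    | mem n f hf => exact Submodule.mem_iSup_of_mem n (𝒞.single_mem_deg hf)
    | zero =>
      have : CatAlg.single x y (0 : x ⟶ y) = 0 := by
        ext; simp [CatAlg.single]
      rw [this]; exact Submodule.zero_mem _
    | add f g _ _ hf hg =>
      have : CatAlg.single x y (f + g) = CatAlg.single x y f + CatAlg.single x y g := by
        ext x' y'
        by_cases h : x' = x ∧ y = y' <;> simp [CatAlg.single, h]
      rw [this]; exact Submodule.add_mem _ hf hg

instance : SetLike.GradedMonoid 𝒞.deg where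
  one_mem := by
    intro x y
    by_cases h : x = y
    · subst h
      rw [𝒞.hom_self_zero]; trivial
    · rw [CatAlg.one_apply_ne h]; exact Submodule.zero_mem _
  mul_mem := by
    intro i j b a hb ha x z
    rw [CatAlg.mul_apply]
    refine Submodule.sum_mem _ fun y _ => ?_
    rw [add_comm]
    exact 𝒞.comp_mem (ha x y) (hb y z)

noncomputable instance : GradedAlgebra 𝒞.deg :=
  { toGradedMonoid := inferInstance
    toDecomposition := 𝒞.deg_isInternal.chooseDecomposition }

theorem comp_eq_zero {k : Type w} [Field k] {C : Type u} [Category.{v} C] [Preadditive C]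
    [Linear k C] (𝒞 : GradedDirectedCategory k C) {x y : C} (h : x ≠ y) (f : x ⟶ y) (g : y ⟶ x) : f ≫ g = 0 := by
  by_contra hne
  have hf : f ≠ 0 := by rintro rfl; simp at hne
  have hg : g ≠ 0 := by rintro rfl; simp at hne
  exact h (𝒞.order.le_antisymm _ _ (𝒞.directed f hf) (𝒞.directed g hg))

/-- The associated algebra of the subcategory `𝒟` of `C` with the same objects,
`𝒟(x, x) = k · 1_x`, and `𝒟(x, y) = C(x, y)` for `x ≠ y`. -/
noncomputable def diagonalSub : Subalgebra k (CatAlg C) where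
  carrier := {a | ∀ x, a x x ∈ Submodule.span k {𝟙 x}}
  add_mem' ha hb x := Submodule.add_mem _ (ha x) (hb x)
  mul_mem' := by
    intro b a hb ha x
    rw [CatAlg.mul_apply, Finset.sum_eq_single x]
    · obtain ⟨r, hr⟩ := Submodule.mem_span_singleton.1 (ha x)
      rw [← hr, Linear.smul_comp, Category.id_comp]
      exact Submodule.smul_mem _ r (hb x)
    · intro y _ hy
      exact 𝒞.comp_eq_zero hy.symm _ _
    · simp
  algebraMap_mem' r x := by
    rw [Algebra.algebraMap_eq_smul_one, CatAlg.smul_apply, CatAlg.one_apply_self]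
    exact Submodule.smul_mem _ r (Submodule.mem_span_singleton_self _)

/-- The grading of `𝒟`, induced from the grading of `C`. -/
noncomputable abbrev diagonalSubDeg : ℕ → Submodule k 𝒞.diagonalSub :=
  fun n => (𝒞.deg n).comap 𝒞.diagonalSub.val.toLinearMap

theorem decompose_mem_diagonalSub {a : CatAlg C} (ha : a ∈ 𝒞.diagonalSub) (n : ℕ) :
    (DirectSum.decompose 𝒞.deg a n : CatAlg C) ∈ 𝒞.diagonalSub := by
  classical
  have hpos : ∀ m, m ≠ 0 → ∀ x, (DirectSum.decompose 𝒞.deg a m : CatAlg C) x x = 0 := by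
    intro m hm x
    have h1 := (DirectSum.decompose 𝒞.deg a m).2 x x
    have hi := ((DirectSum.isInternal_submodule_iff_iSupIndep_and_iSup_eq_top _).1
      (𝒞.isInternal x x)).1.pairwiseDisjoint hm
    rw [Function.onFun, 𝒞.hom_self_zero, disjoint_top] at hi
    rw [hi] at h1
    simpa using h1
  intro x
  by_cases hn : n = 0
  · subst hn
    have hsum := DirectSum.sum_support_decompose 𝒞.deg a
    have h2 : a x x = (DirectSum.decompose 𝒞.deg a 0 : CatAlg C) x x := by
      have h3 : CatAlg.evalₗ k x x a = CatAlg.evalₗ k x x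
          (DirectSum.decompose 𝒞.deg a 0 : CatAlg C) := by
        conv_lhs => rw [← hsum]
        rw [map_sum, Finset.sum_eq_single 0]
        · intro m _ hm; exact hpos m hm x
        · intro h0
          have : DirectSum.decompose 𝒞.deg a 0 = 0 := by simpa using h0
          simp [this]
      exact h3
    rw [← h2]
    exact ha x
  · rw [hpos n hn x]
    exact Submodule.zero_mem _

theorem diagonalSubDeg_isInternal : DirectSum.IsInternal 𝒞.diagonalSubDeg := by
  classical
  rw [DirectSum.isInternal_submodule_iff_iSupIndep_and_iSup_eq_top]
  constructor
  · rw [iSupIndep_iff_dfinsupp_lsum_injective]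
    intro m₁ m₂ hm
    have hinj := ((DirectSum.isInternal_submodule_iff_iSupIndep_and_iSup_eq_top _).1
      𝒞.deg_isInternal).1.dfinsupp_lsum_injective
    let φ : ∀ n, 𝒞.diagonalSubDeg n →ₗ[k] 𝒞.deg n := fun n =>
      (𝒞.diagonalSub.val.toLinearMap.comp (𝒞.diagonalSubDeg n).subtype).codRestrict _
        (fun a => a.2)
    have hcomp : (DFinsupp.lsum ℕ fun i => (𝒞.deg i).subtype).comp
        (DFinsupp.mapRange.linearMap φ) = 𝒞.diagonalSub.val.toLinearMap.comp
          (DFinsupp.lsum ℕ fun i => (𝒞.diagonalSubDeg i).subtype) := by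
      apply DFinsupp.lhom_ext
      intro i a
      simp only [LinearMap.comp_apply, DFinsupp.mapRange.linearMap_apply,
        DFinsupp.mapRange_single, DFinsupp.lsum_single]
      rfl
    have h3 : DFinsupp.mapRange.linearMap φ m₁ = DFinsupp.mapRange.linearMap φ m₂ := by
      apply hinj
      have h1 := LinearMap.congr_fun hcomp m₁
      have h2 := LinearMap.congr_fun hcomp m₂
      simp only [LinearMap.comp_apply] at h1 h2
      rw [h1, h2, hm]
    apply DFinsupp.ext
    intro n
    have h4 := congrArg (fun t => ((t n : 𝒞.deg n) : CatAlg C)) h3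
    exact Subtype.ext (Subtype.ext h4)
  · rw [eq_top_iff]
    rintro ⟨a, ha⟩ _
    have hs : (⟨a, ha⟩ : 𝒞.diagonalSub) =
        ∑ n ∈ (DirectSum.decompose 𝒞.deg a).support,
          ⟨DirectSum.decompose 𝒞.deg a n, 𝒞.decompose_mem_diagonalSub ha n⟩ := by
      apply Subtype.ext
      rw [AddSubmonoidClass.coe_finsetSum]
      exact (DirectSum.sum_support_decompose 𝒞.deg a).symm
    rw [hs]
    exact Submodule.sum_mem _ fun n _ => Submodule.mem_iSup_of_mem n
      (DirectSum.decompose 𝒞.deg a n).2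

instance : SetLike.GradedMonoid 𝒞.diagonalSubDeg where
  one_mem := SetLike.GradedOne.one_mem (A := 𝒞.deg)
  mul_mem _ _ _ _ ha hb := SetLike.GradedMul.mul_mem (A := 𝒞.deg) ha hb

noncomputable instance : GradedAlgebra 𝒞.diagonalSubDeg :=
  { toGradedMonoid := inferInstance
    toDecomposition := 𝒞.diagonalSubDeg_isInternal.chooseDecomposition }

end GradedDirectedCategory

/-- A choice, for every object `x`, of a complete set of orthogonal primitive idempotents of the
endomorphism algebra `C(x, x)`. -/
structure PrimitiveIdempotents (C : Type u) [Category.{v} C] [Preadditive C] where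
  card : C → ℕ
  idem : ∀ x : C, Fin (card x) → End x
  complete : ∀ x : C, CompleteOrthogonalIdempotents (idem x)
  primitive : ∀ (x : C) (i : Fin (card x)), IsPrimitiveIdempotent (idem x i)

namespace GradedDirectedCategory

variable {k : Type w} [Field k] {C : Type u} [Category.{v} C] [Preadditive C] [Linear k C]
  [Fintype C] (𝒞 : GradedDirectedCategory k C)

/-- `C` is standardly stratified: its associated algebra is so for the given complete set of
orthogonal primitive idempotents, preordered by the order of the underlying objects. -/
def IsStandardlyStratified (E : PrimitiveIdempotents C) : Prop :=
  IsStandardlyStratifiedFor (A := CatAlg C) (ι := Σ x : C, Fin (E.card x))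
    (fun p q => 𝒞.order.le p.1 q.1)
    (fun p => CatAlg.single p.1 p.1 (E.idem p.1 p.2))

/-- `C` is a Koszul category. -/
def IsKoszul : Prop := IsKoszulAlgebra 𝒞.deg

/-- The subcategory `𝒟` is a Koszul category in the classical sense. -/
def SubIsClassicalKoszul : Prop := IsClassicalKoszulAlgebra 𝒞.diagonalSubDeg

end GradedDirectedCategory

set_option linter.unusedSectionVars false

/-! ## Projections onto homogeneous components -/

section GradedModules

variable {k : Type w} [Field k]

/-! Write `A` and `D` for the two algebras, with degree `0` parts `A_0` and `D_0`. Both assertions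
rest on two equivalences: `A` is Koszul if and only if `A` is projective over `A_0` and `D` is
Koszul (`isKoszul_iff_projective`), and `A` is standardly stratified if and only if `A` is
projective over `A_0` (`isStandardlyStratified_iff`).

Linear resolutions are replaced by iterated syzygies. A cover of `M` in degree `t` is a projective
module generated in degree `t` that maps onto `M` and is isomorphic to it in degree `t`. It exists
when `M` is generated in degree `t` and `M_t` is projective over `A_0` (`exists_isCover`). `IsLinear
n t M` asks for `n` successive covers, in degrees `t`, `t + 1`, …; the truncation at `n` makes
inductions possible, and Koszul means linear for all `n` (`isKoszul_iff`). Linearity does not depend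
on the covers, passes to retracts and extensions, and obeys rules for kernels and cokernels.

`A` and `D` have the same positive part, and `D_0` is semisimple. So `A / D` sits in degree `0`, and
if `D` is Koszul, finite dimensional projective `A`-modules generated in degree `t` become linear
over `D`. The sequences `0 → ΩM → P → M → 0` then carry linearity down to `D` (`IsLinear.restrict`)
and up to `A` (`isLinear_of_restrict`). Going up, each `ΩM` must again have a cover, which holds
once `A` and `M` are projective over `A_0`. Conversely the splitting condition shows, degree by
degree along a linear resolution, that `M_i = P_i / (ΩM)_i` is projective
(`IsLinear.projective_degSub`); applied to the positive part of `A` this gives projectivity of `A`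
itself.

In a stratification each `Δ_λ` is forced to live at the single object `x` of `λ`, and is then a
direct summand of `A_0`, so everything filtered by the `Δ_λ` is projective over `A_0`. Conversely, a
module that is projective over `A_0` maps onto a standard module at a minimal object of its support,
with projective kernel (`exists_surjective_standard`), and induction on the dimension yields a
filtration. -/

theorem isInternal_of_projections {V : Type*} [AddCommGroup V] [Module k V]
    (deg : ℤ → Submodule k V) (p : ℤ → V →ₗ[k] V)
    (hmem : ∀ i, ∀ v ∈ deg i, p i v = v) (hne : ∀ i j, i ≠ j → ∀ v ∈ deg j, p i v = 0)
    (htop : ∀ v, v ∈ ⨆ i, deg i) : DirectSum.IsInternal deg := by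
  rw [DirectSum.isInternal_submodule_iff_iSupIndep_and_iSup_eq_top]
  refine ⟨fun i => ?_, eq_top_iff.2 fun v _ => htop v⟩
  rw [Submodule.disjoint_def]
  intro v hv hv'
  rw [← hmem i v hv]
  have h : (⨆ j, ⨆ (_ : j ≠ i), deg j) ≤ LinearMap.ker (p i) :=
    iSup₂_le fun j hj v hv => hne i j hj.symm v hv
  exact h hv'

namespace GrMod

variable {R : Type u} [Ring R] [Algebra k R] {𝒜 : ℕ → Submodule k R}

theorem bijective_coeLinearMap (M : GrMod k R 𝒜) :
    Function.Bijective (DirectSum.coeLinearMap M.deg) := M.isInternal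

/-- The projection of a graded module onto its component of degree `i`. -/
noncomputable def proj (M : GrMod k R 𝒜) (i : ℤ) : M.carrier →ₗ[k] M.carrier :=
  (M.deg i).subtype ∘ₗ DirectSum.component k ℤ (fun i => M.deg i) i ∘ₗ
    (LinearEquiv.ofBijective (DirectSum.coeLinearMap M.deg) M.bijective_coeLinearMap).symm.toLinearMap

theorem proj_mem (M : GrMod k R 𝒜) (i : ℤ) (m : M.carrier) : M.proj i m ∈ M.deg i :=
  Subtype.property _

theorem proj_of_mem_aux (M : GrMod k R 𝒜) {j : ℤ} (i : ℤ) {m : M.carrier} (hm : m ∈ M.deg j) :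
    M.proj i m = (DirectSum.lof k ℤ (fun i => M.deg i) j ⟨m, hm⟩ i : M.deg i) := by
  have : (LinearEquiv.ofBijective (DirectSum.coeLinearMap M.deg) M.bijective_coeLinearMap).symm m =
      DirectSum.lof k ℤ (fun i => M.deg i) j ⟨m, hm⟩ := by
    rw [LinearEquiv.symm_apply_eq, LinearEquiv.ofBijective_apply, DirectSum.coeLinearMap_lof]
  simp only [proj, LinearMap.comp_apply, LinearEquiv.coe_coe, this]
  rfl

theorem proj_of_mem (M : GrMod k R 𝒜) {i : ℤ} {m : M.carrier} (hm : m ∈ M.deg i) :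
    M.proj i m = m := by
  rw [M.proj_of_mem_aux i hm]
  simp [DirectSum.lof_eq_of]

theorem proj_of_mem_ne (M : GrMod k R 𝒜) {i j : ℤ} (h : i ≠ j) {m : M.carrier}
    (hm : m ∈ M.deg j) : M.proj i m = 0 := by
  rw [M.proj_of_mem_aux i hm, DirectSum.lof_eq_of, DirectSum.of_eq_of_ne _ _ _ h]
  rfl

theorem induction_homogeneous (M : GrMod k R 𝒜) {p : M.carrier → Prop}
    (homog : ∀ i, ∀ m ∈ M.deg i, p m) (add : ∀ m n, p m → p n → p (m + n)) (m : M.carrier) :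
    p m := by
  have h : m ∈ ⨆ i, M.deg i := by
    rw [((DirectSum.isInternal_submodule_iff_iSupIndep_and_iSup_eq_top _).1 M.isInternal).2]
    trivial
  induction h using Submodule.iSup_induction' with
  | mem i x hx => exact homog i x hx
  | zero => exact homog 0 0 (zero_mem _)
  | add x y _ _ hx hy => exact add x y hx hy

/-- Every element is the finite sum of its components. Additive subgroups are general enough to
serve both subspaces of a module and a subalgebra of `R`. -/
theorem mem_of_forall_proj_mem (M : GrMod k R 𝒜) (N : AddSubgroup M.carrier) {m : M.carrier}
    (h : ∀ i, M.proj i m ∈ N) : m ∈ N := by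
  classical
  have hm : m = DirectSum.coeLinearMap M.deg
      ((LinearEquiv.ofBijective (DirectSum.coeLinearMap M.deg) M.bijective_coeLinearMap).symm m) :=
    ((LinearEquiv.ofBijective (DirectSum.coeLinearMap M.deg) M.bijective_coeLinearMap).apply_symm_apply m).symm
  rw [hm, DirectSum.coeLinearMap_eq_dfinsuppSum]
  exact dfinsuppSum_mem N _ _ fun i _ => h i

theorem proj_comm {M N : GrMod k R 𝒜} {f : M.carrier →+ N.carrier}
    (hf : ∀ i, ∀ m ∈ M.deg i, f m ∈ N.deg i) (i : ℤ) (m : M.carrier) :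
    f (M.proj i m) = N.proj i (f m) := by
  induction m using M.induction_homogeneous with
  | homog j m hm =>
    by_cases h : i = j
    · subst h
      rw [M.proj_of_mem hm, N.proj_of_mem (hf _ _ hm)]
    · rw [M.proj_of_mem_ne h hm, N.proj_of_mem_ne h (hf _ _ hm), map_zero]
  | add m n hm hn => rw [map_add, map_add, hm, hn, map_add, map_add]

theorem IsGradedHom.proj_comm {M N : GrMod k R 𝒜} {f : M.carrier →ₗ[R] N.carrier}
    (hf : IsGradedHom f) (i : ℤ) (m : M.carrier) : f (M.proj i m) = N.proj i (f m) :=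
  GrMod.proj_comm (f := f.toAddMonoidHom) hf i m

theorem IsGradedHom.comp {M N L : GrMod k R 𝒜} {g : N.carrier →ₗ[R] L.carrier}
    {f : M.carrier →ₗ[R] N.carrier} (hg : IsGradedHom g) (hf : IsGradedHom f) :
    IsGradedHom (M := M) (N := L) (g ∘ₗ f) := fun i m hm => hg i _ (hf i m hm)

theorem isGradedHom_id (M : GrMod k R 𝒜) :
    IsGradedHom (M := M) (N := M) LinearMap.id := fun _ _ hm => hm

theorem IsGradedHom.exists_homogeneous_preimage {M N : GrMod k R 𝒜}
    {f : M.carrier →ₗ[R] N.carrier} (hf : IsGradedHom f) {i : ℤ} {n : N.carrier}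
    (hn : n ∈ N.deg i) (h : ∃ m, f m = n) : ∃ m ∈ M.deg i, f m = n := by
  obtain ⟨m, rfl⟩ := h
  exact ⟨M.proj i m, M.proj_mem i m, by rw [hf.proj_comm, N.proj_of_mem hn]⟩

theorem IsGradedHom.mem_deg_of_injective {M N : GrMod k R 𝒜}
    {f : M.carrier →ₗ[R] N.carrier} (hf : IsGradedHom f) (hi : Function.Injective f) {i : ℤ}
    {m : M.carrier} (h : f m ∈ N.deg i) : m ∈ M.deg i := by
  have : M.proj i m = m := hi (by rw [hf.proj_comm, N.proj_of_mem h])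
  rw [← this]
  exact M.proj_mem i m

theorem eq_zero_of_mem_of_mem (M : GrMod k R 𝒜) {i j : ℤ} (h : i ≠ j) {m : M.carrier}
    (hi : m ∈ M.deg i) (hj : m ∈ M.deg j) : m = 0 := by
  rw [← M.proj_of_mem hi, M.proj_of_mem_ne h hj]

theorem smul_mem' (M : GrMod k R 𝒜) {i : ℕ} {j l : ℤ} {a : R} {m : M.carrier}
    (ha : a ∈ 𝒜 i) (hm : m ∈ M.deg j) (h : i + j = l) : a • m ∈ M.deg l :=
  h ▸ M.smul_mem ha hm

theorem proj_smul (M : GrMod k R 𝒜) {i : ℕ} {a : R} (ha : a ∈ 𝒜 i) (j : ℤ) (m : M.carrier) :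
    M.proj j (a • m) = a • M.proj (j - i) m := by
  induction m using M.induction_homogeneous with
  | homog l m hm =>
    have hm' := M.smul_mem ha hm
    by_cases h : j = i + l
    · rw [M.proj_of_mem (h ▸ hm'), M.proj_of_mem (by rwa [show j - i = l by omega])]
    · rw [M.proj_of_mem_ne h hm', M.proj_of_mem_ne (by omega) hm, smul_zero]
  | add m n hm hn => rw [smul_add, map_add, hm, hn, map_add, smul_add]

/-! ### Constructions -/

/-- A homogeneous submodule as a graded module. -/
noncomputable def sub (M : GrMod k R 𝒜) (N : Submodule R M.carrier)
    (h : ∀ i, ∀ m ∈ N, M.proj i m ∈ N) : GrMod k R 𝒜 where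
  carrier := N
  deg i := (M.deg i).comap (N.subtype.restrictScalars k)
  isInternal := by
    refine isInternal_of_projections _
      (fun i => ((M.proj i).restrict (p := N.restrictScalars k) (q := N.restrictScalars k)
        (fun m hm => h i m hm))) ?_ ?_ ?_
    · intro i v hv
      exact Subtype.ext (M.proj_of_mem hv)
    · intro i j hij v hv
      exact Subtype.ext (M.proj_of_mem_ne hij hv)
    · intro v
      set T := ⨆ i, (M.deg i).comap (N.subtype.restrictScalars k) with hT
      have key : (v : M.carrier) ∈ (T.map (N.subtype.restrictScalars k)).toAddSubgroup := by
        refine M.mem_of_forall_proj_mem _ fun i => ?_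
        refine ⟨⟨M.proj i v, h i v v.2⟩, ?_, rfl⟩
        exact Submodule.mem_iSup_of_mem i (M.proj_mem i v)
      obtain ⟨v', hv', hvv⟩ := key
      rwa [← (Subtype.ext hvv : v' = v)]
  smul_mem := fun ha hm => M.smul_mem ha hm

/-- The kernel of a graded homomorphism. -/
noncomputable def ker {M N : GrMod k R 𝒜} (f : M.carrier →ₗ[R] N.carrier)
    (hf : IsGradedHom f) : GrMod k R 𝒜 :=
  M.sub (LinearMap.ker f) fun i m hm => by
    rw [LinearMap.mem_ker] at hm ⊢
    rw [hf.proj_comm, hm, map_zero]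

/-- The inclusion of the kernel of a graded homomorphism. -/
def kerι {M N : GrMod k R 𝒜} (f : M.carrier →ₗ[R] N.carrier) (hf : IsGradedHom f) :
    (ker f hf).carrier →ₗ[R] M.carrier := (LinearMap.ker f).subtype

theorem kerι_injective {M N : GrMod k R 𝒜} (f : M.carrier →ₗ[R] N.carrier)
    (hf : IsGradedHom f) : Function.Injective (kerι f hf) := Subtype.val_injective

theorem kerι_graded {M N : GrMod k R 𝒜} (f : M.carrier →ₗ[R] N.carrier)
    (hf : IsGradedHom f) : IsGradedHom (kerι f hf) := fun _ _ hm => hm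

@[simp] theorem apply_kerι {M N : GrMod k R 𝒜} (f : M.carrier →ₗ[R] N.carrier)
    (hf : IsGradedHom f) (x : (ker f hf).carrier) : f (kerι f hf x) = 0 := x.2

/-- The corestriction to the kernel of a map killed by `f`. -/
def kerLift {M N : GrMod k R 𝒜} (f : M.carrier →ₗ[R] N.carrier) (hf : IsGradedHom f)
    {L : Type*} [AddCommGroup L] [Module R L] (g : L →ₗ[R] M.carrier) (h : ∀ x, f (g x) = 0) :
    L →ₗ[R] (ker f hf).carrier := g.codRestrict (LinearMap.ker f) h

@[simp] theorem kerι_kerLift {M N : GrMod k R 𝒜} (f : M.carrier →ₗ[R] N.carrier)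
    (hf : IsGradedHom f) {L : Type*} [AddCommGroup L] [Module R L] (g : L →ₗ[R] M.carrier)
    (h : ∀ x, f (g x) = 0) (x : L) : kerι f hf (kerLift f hf g h x) = g x := rfl

theorem kerLift_graded {L M N : GrMod k R 𝒜} (f : M.carrier →ₗ[R] N.carrier)
    (hf : IsGradedHom f) (g : L.carrier →ₗ[R] M.carrier) (h : ∀ x, f (g x) = 0)
    (hg : IsGradedHom g) : IsGradedHom (M := L) (N := ker f hf) (kerLift f hf g h) := hg

theorem exact_kerι {M N : GrMod k R 𝒜} (f : M.carrier →ₗ[R] N.carrier) (hf : IsGradedHom f) :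
    Function.Exact (kerι f hf) f := fun y => ⟨fun h => ⟨⟨y, h⟩, rfl⟩, by rintro ⟨x, rfl⟩; simp⟩

/-- The product of two graded modules. -/
noncomputable def prod (M N : GrMod k R 𝒜) : GrMod k R 𝒜 where
  carrier := M.carrier × N.carrier
  deg i := (M.deg i).prod (N.deg i)
  isInternal := by
    refine isInternal_of_projections _ (fun i => (M.proj i).prodMap (N.proj i)) ?_ ?_ ?_
    · intro i v hv
      exact Prod.ext (M.proj_of_mem hv.1) (N.proj_of_mem hv.2)
    · intro i j hij v hv
      exact Prod.ext (M.proj_of_mem_ne hij hv.1) (N.proj_of_mem_ne hij hv.2)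
    · rintro ⟨m, n⟩
      rw [show (m, n) = (m, 0) + (0, n) by simp]
      refine add_mem ?_ ?_
      · induction m using M.induction_homogeneous with
        | homog i m hm => exact Submodule.mem_iSup_of_mem i ⟨hm, zero_mem _⟩
        | add m m' hm hm' =>
          rw [show (m + m', (0 : N.carrier)) = (m, 0) + (m', 0) by simp]
          exact add_mem hm hm'
      · induction n using N.induction_homogeneous with
        | homog i n hn => exact Submodule.mem_iSup_of_mem i ⟨zero_mem _, hn⟩
        | add n n' hn hn' =>
          rw [show ((0 : M.carrier), n + n') = (0, n) + (0, n') by simp]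
          exact add_mem hn hn'
  smul_mem := fun ha hm => ⟨M.smul_mem ha hm.1, N.smul_mem ha hm.2⟩

/-- The shift of a graded module: its component of degree `i` is `M_{i - s}`. -/
def shift (M : GrMod k R 𝒜) (s : ℤ) : GrMod k R 𝒜 where
  carrier := M.carrier
  deg i := M.deg (i - s)
  isInternal := by
    refine isInternal_of_projections _ (fun i => M.proj (i - s)) ?_ ?_ ?_
    · intro i v hv
      exact M.proj_of_mem hv
    · intro i j hij v hv
      exact M.proj_of_mem_ne (by omega) hv
    · intro m
      induction m using M.induction_homogeneous with
      | homog i m hm =>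
        exact Submodule.mem_iSup_of_mem (i + s) (by rwa [show i + s - s = i by omega])
      | add m m' hm hm' => exact add_mem hm hm'
  smul_mem := fun ha hm => M.smul_mem' ha hm (by omega)

/-- A module on which the elements of positive degree act as zero, placed in degree `t`. -/
noncomputable def concentrated [GradedAlgebra 𝒜] (V : Type u) [AddCommGroup V] [Module k V]
    [Module R V] [IsScalarTower k R V] (t : ℤ)
    (h : ∀ i : ℕ, 0 < i → ∀ a ∈ 𝒜 i, ∀ v : V, a • v = 0) : GrMod k R 𝒜 where
  carrier := V
  deg i := if i = t then ⊤ else ⊥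
  isInternal := by
    classical
    refine isInternal_of_projections _ (fun i => if i = t then LinearMap.id else 0) ?_ ?_ ?_
    · intro i v hv
      by_cases hi : i = t <;> simp_all
    · intro i j hij v hv
      by_cases hi : i = t <;> by_cases hj : j = t <;> simp_all
    · intro v
      exact Submodule.mem_iSup_of_mem t (by simp)
  smul_mem := by
    intro i j a m ha hm
    by_cases hj : j = t
    · rcases Nat.eq_zero_or_pos i with rfl | hi
      · simp [hj]
      · rw [h i hi a ha]
        exact zero_mem _
    · rw [if_neg hj, Submodule.mem_bot] at hm
      rw [hm, smul_zero]
      exact zero_mem _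

end GrMod

end GradedModules

/-! ### Components over the degree `0` part, generation in one degree, graded lifts. -/

section GradedRingModules

variable {k : Type w} [Field k] {R : Type u} [Ring R] [Algebra k R] {𝒜 : ℕ → Submodule k R}

namespace GrMod

/-- Finitely supported functions with values in a graded module. -/
noncomputable def finsupp (ι : Type u) (M : GrMod k R 𝒜) : GrMod k R 𝒜 where
  carrier := ι →₀ M.carrier
  deg i :=
    { carrier := {f | ∀ x, f x ∈ M.deg i}
      add_mem' := fun hf hg x => add_mem (hf x) (hg x)
      zero_mem' := fun _ => zero_mem _
      smul_mem' := fun c _ hf x => Submodule.smul_mem _ c (hf x) }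
  isInternal := by
    classical
    refine isInternal_of_projections _ (fun i => Finsupp.mapRange.linearMap (M.proj i)) ?_ ?_ ?_
    · intro i f hf
      ext x
      exact M.proj_of_mem (hf x)
    · intro i j hij f hf
      ext x
      exact M.proj_of_mem_ne hij (hf x)
    · intro f
      induction f using Finsupp.induction_linear with
      | zero => exact zero_mem _
      | add f g hf hg => exact add_mem hf hg
      | single x m =>
        induction m using M.induction_homogeneous with
        | homog i m hm =>
          refine Submodule.mem_iSup_of_mem i fun y => ?_
          rw [Finsupp.single_apply]
          split_ifs
          exacts [hm, zero_mem _]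
        | add m n hm hn =>
          rw [Finsupp.single_add]
          exact add_mem hm hn
  smul_mem := fun ha hf x => M.smul_mem ha (hf x)

variable [GradedAlgebra 𝒜]

theorem _root_.GradedAlgebra.induction_homogeneous {p : R → Prop}
    (homog : ∀ i, ∀ a ∈ 𝒜 i, p a) (add : ∀ a b, p a → p b → p (a + b)) (a : R) : p a := by
  induction a using DirectSum.Decomposition.inductionOn 𝒜 with
  | zero => exact homog 0 0 (zero_mem _)
  | homogeneous a => exact homog _ a a.2
  | add a b ha hb => exact add a b ha hb

variable (𝒜) in
/-- The regular module as a graded module. -/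
noncomputable def self : GrMod k R 𝒜 where
  carrier := R
  deg i := if 0 ≤ i then 𝒜 i.toNat else ⊥
  isInternal := by
    refine isInternal_of_projections _
      (fun i => if 0 ≤ i then GradedAlgebra.proj 𝒜 i.toNat else 0) ?_ ?_ ?_
    · intro i a ha
      by_cases hi : 0 ≤ i
      · simp only [hi, if_true] at ha ⊢
        exact DirectSum.decompose_of_mem_same 𝒜 ha
      · simp_all
    · intro i j hij a ha
      by_cases hi : 0 ≤ i <;> by_cases hj : 0 ≤ j <;> simp only [hi, hj, if_true, if_false] at ha ⊢
      · exact DirectSum.decompose_of_mem_ne 𝒜 ha (by omega)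
      · simp_all
      · simp
      · simp
    · intro a
      induction a using GradedAlgebra.induction_homogeneous (𝒜 := 𝒜) with
      | homog i a ha => exact Submodule.mem_iSup_of_mem (i : ℤ) (by simpa using ha)
      | add a b ha hb => exact add_mem ha hb
  smul_mem := by
    intro i j a m ha hm
    by_cases hj : 0 ≤ j
    · simp only [hj, if_true] at hm
      rw [if_pos (by omega), show ((i : ℤ) + j).toNat = i + j.toNat by omega]
      exact SetLike.GradedMul.mul_mem ha hm
    · simp only [hj, if_false, Submodule.mem_bot] at hm
      rw [hm, smul_zero]
      exact zero_mem _

theorem mem_self_deg {a : R} {i : ℕ} : a ∈ (self 𝒜).deg i ↔ a ∈ 𝒜 i := by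
  simp only [self, Int.natCast_nonneg, if_true, Int.toNat_natCast]
  rfl

theorem self_deg_neg {i : ℤ} (h : i < 0) : (self 𝒜).deg i = ⊥ := if_neg (by omega)

theorem one_mem_self_deg : (1 : R) ∈ (self 𝒜).deg 0 :=
  mem_self_deg (i := 0).2 SetLike.GradedOne.one_mem

/-- A homogeneous component as a module over the degree `0` subalgebra. -/
def degSub (M : GrMod k R 𝒜) (i : ℤ) : Submodule (degZeroAlg 𝒜) M.carrier where
  carrier := M.deg i
  add_mem' := add_mem
  zero_mem' := zero_mem _
  smul_mem' c _ hm := M.smul_mem' c.2 hm (by simp)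

@[simp] theorem mem_degSub {M : GrMod k R 𝒜} {i : ℤ} {m : M.carrier} :
    m ∈ M.degSub i ↔ m ∈ M.deg i := Iff.rfl

/-- The projection onto a homogeneous component, linear over the degree `0` subalgebra. -/
noncomputable def projZ (M : GrMod k R 𝒜) (i : ℤ) : M.carrier →ₗ[degZeroAlg 𝒜] M.degSub i where
  toFun m := ⟨M.proj i m, M.proj_mem i m⟩
  map_add' m n := Subtype.ext (map_add _ m n)
  map_smul' c m := Subtype.ext (by
    have := M.proj_smul c.2 i m
    simp only [Nat.cast_zero, sub_zero] at this
    exact this)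

theorem projZ_comp_subtype (M : GrMod k R 𝒜) (i : ℤ) :
    M.projZ i ∘ₗ (M.degSub i).subtype = LinearMap.id :=
  LinearMap.ext fun m => Subtype.ext (M.proj_of_mem m.2)

theorem projective_degSub (M : GrMod k R 𝒜) [Module.Projective (degZeroAlg 𝒜) M.carrier]
    (i : ℤ) : Module.Projective (degZeroAlg 𝒜) (M.degSub i) :=
  Module.Projective.of_split _ _ (M.projZ_comp_subtype i)

theorem projective_of_degSub (M : GrMod k R 𝒜)
    (h : ∀ i, Module.Projective (degZeroAlg 𝒜) (M.degSub i)) :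
    Module.Projective (degZeroAlg 𝒜) M.carrier :=
  Module.Projective.of_equiv (LinearEquiv.ofBijective (DirectSum.coeLinearMap M.degSub)
    (show Function.Bijective (DirectSum.coeLinearMap M.degSub) from M.isInternal))

/-- The restriction of a graded homomorphism to a homogeneous component. -/
def degMap {M N : GrMod k R 𝒜} {f : M.carrier →ₗ[R] N.carrier} (hf : IsGradedHom f) (i : ℤ) :
    M.degSub i →ₗ[degZeroAlg 𝒜] N.degSub i :=
  (f.restrictScalars (degZeroAlg 𝒜)).restrict (hf i)

/-! ### Generation in one degree -/

theorem GeneratedInDegree.induction {M : GrMod k R 𝒜} {t : ℤ} (hM : M.GeneratedInDegree t)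
    {p : M.carrier → Prop} (smul : ∀ i : ℕ, ∀ a ∈ 𝒜 i, ∀ m ∈ M.deg t, p (a • m))
    (add : ∀ m n, p m → p n → p (m + n)) (m : M.carrier) : p m := by
  have hm : m ∈ Submodule.span R (M.deg t : Set M.carrier) := by rw [hM]; trivial
  have h0 : p 0 := by simpa using smul 0 0 (zero_mem _) 0 (zero_mem _)
  refine Submodule.closure_induction (p := fun m _ => p m) h0
    (fun x y _ _ hx hy => add x y hx hy) ?_ hm
  intro a m hm
  induction a using GradedAlgebra.induction_homogeneous (𝒜 := 𝒜) with
  | homog i a ha => exact smul i a ha m hm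
  | add a b ha hb => rw [add_smul]; exact add _ _ ha hb

/-- Scalars have degree at least `0`, so `a • m` with `m` of degree `t` never reaches a degree below
`t`. -/
theorem GeneratedInDegree.eq_zero {M : GrMod k R 𝒜} {t : ℤ} (hM : M.GeneratedInDegree t)
    {i : ℤ} (hi : i < t) {m : M.carrier} (hm : m ∈ M.deg i) : m = 0 := by
  rw [← M.proj_of_mem hm]
  clear hm
  induction m using hM.induction with
  | smul j a ha m hm => exact M.proj_of_mem_ne (by omega) (M.smul_mem ha hm)
  | add m n hm hn => rw [map_add, hm, hn, add_zero]

theorem GeneratedInDegree.surjective {M N : GrMod k R 𝒜} {t : ℤ} (hN : N.GeneratedInDegree t)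
    {f : M.carrier →ₗ[R] N.carrier} (h : ∀ n ∈ N.deg t, ∃ m, f m = n) :
    Function.Surjective f := by
  rw [← LinearMap.range_eq_top, eq_top_iff, ← hN, Submodule.span_le]
  exact h

theorem GeneratedInDegree.of_surjective {M N : GrMod k R 𝒜} {t : ℤ}
    (hM : M.GeneratedInDegree t) {f : M.carrier →ₗ[R] N.carrier} (hf : IsGradedHom f)
    (h : Function.Surjective f) : N.GeneratedInDegree t := by
  rw [GeneratedInDegree, eq_top_iff, ← LinearMap.range_eq_top.2 h, LinearMap.range_eq_map, ← hM,
    Submodule.map_span_le]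
  exact fun m hm => Submodule.subset_span (hf _ _ hm)

theorem GeneratedInDegree.hom_ext {M N : GrMod k R 𝒜} {t : ℤ} (hM : M.GeneratedInDegree t)
    {f g : M.carrier →ₗ[R] N.carrier} (h : ∀ m ∈ M.deg t, f m = g m) : f = g :=
  LinearMap.ext_on hM h

theorem GeneratedInDegree.of_subsingleton (M : GrMod k R 𝒜) [Subsingleton M.carrier] (t : ℤ) :
    M.GeneratedInDegree t := Subsingleton.elim _ _

theorem GeneratedInDegree.map_mem_span {M N : GrMod k R 𝒜} {t : ℤ}
    (hM : M.GeneratedInDegree t) {f : M.carrier →ₗ[R] N.carrier} (hf : IsGradedHom f)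
    (m : M.carrier) : f m ∈ Submodule.span R (N.deg t : Set N.carrier) := by
  have h : Submodule.map f ⊤ ≤ Submodule.span R (N.deg t : Set N.carrier) := by
    rw [← hM, Submodule.map_span_le]
    exact fun m hm => Submodule.subset_span (hf _ _ hm)
  exact h ⟨m, trivial, rfl⟩

/-- The first inclusion into a product of graded modules. -/
def inl (M N : GrMod k R 𝒜) : M.carrier →ₗ[R] (M.prod N).carrier :=
  LinearMap.inl R M.carrier N.carrier

/-- The second inclusion into a product of graded modules. -/
def inr (M N : GrMod k R 𝒜) : N.carrier →ₗ[R] (M.prod N).carrier :=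
  LinearMap.inr R M.carrier N.carrier

/-- The first projection from a product of graded modules. -/
def fst (M N : GrMod k R 𝒜) : (M.prod N).carrier →ₗ[R] M.carrier :=
  LinearMap.fst R M.carrier N.carrier

/-- The second projection from a product of graded modules. -/
def snd (M N : GrMod k R 𝒜) : (M.prod N).carrier →ₗ[R] N.carrier :=
  LinearMap.snd R M.carrier N.carrier

theorem inl_graded (M N : GrMod k R 𝒜) : IsGradedHom (inl M N) := fun _ _ hm => ⟨hm, zero_mem _⟩

theorem inr_graded (M N : GrMod k R 𝒜) : IsGradedHom (inr M N) := fun _ _ hm => ⟨zero_mem _, hm⟩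

theorem fst_graded (M N : GrMod k R 𝒜) : IsGradedHom (fst M N) := fun _ _ hm => hm.1

theorem snd_graded (M N : GrMod k R 𝒜) : IsGradedHom (snd M N) := fun _ _ hm => hm.2

@[simp] theorem fst_inl (M N : GrMod k R 𝒜) (m : M.carrier) : fst M N (inl M N m) = m := rfl

@[simp] theorem snd_inl (M N : GrMod k R 𝒜) (m : M.carrier) : snd M N (inl M N m) = 0 := rfl

@[simp] theorem fst_inr (M N : GrMod k R 𝒜) (n : N.carrier) : fst M N (inr M N n) = 0 := rfl

@[simp] theorem snd_inr (M N : GrMod k R 𝒜) (n : N.carrier) : snd M N (inr M N n) = n := rfl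

theorem inl_fst_add_inr_snd (M N : GrMod k R 𝒜) (x : (M.prod N).carrier) :
    inl M N (fst M N x) + inr M N (snd M N x) = x :=
  Prod.ext (add_zero x.1) (zero_add x.2)

theorem GeneratedInDegree.prod {M N : GrMod k R 𝒜} {t : ℤ} (hM : M.GeneratedInDegree t)
    (hN : N.GeneratedInDegree t) : (M.prod N).GeneratedInDegree t := by
  rw [GeneratedInDegree, eq_top_iff]
  intro x _
  rw [← inl_fst_add_inr_snd M N x]
  exact add_mem (hM.map_mem_span (inl_graded M N) _) (hN.map_mem_span (inr_graded M N) _)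

theorem self_generatedInDegree : (self 𝒜).GeneratedInDegree 0 := by
  rw [GeneratedInDegree, eq_top_iff]
  intro x _
  have e : (id x : R) • ((1 : R) : (self 𝒜).carrier) = x := mul_one (M := R) x
  rw [← e]
  exact Submodule.smul_mem _ _ (Submodule.subset_span one_mem_self_deg)

/-- The inclusion of a summand of `finsupp`. -/
noncomputable def single {ι : Type u} (M : GrMod k R 𝒜) (x : ι) :
    M.carrier →ₗ[R] (M.finsupp ι).carrier := Finsupp.lsingle x

theorem single_graded {ι : Type u} (M : GrMod k R 𝒜) (x : ι) : IsGradedHom (M.single x) := by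
  classical
  intro i m hm y
  change Finsupp.single x m y ∈ _
  rw [Finsupp.single_apply]
  split_ifs
  exacts [hm, zero_mem _]

theorem GeneratedInDegree.finsupp {M : GrMod k R 𝒜} {t : ℤ} (hM : M.GeneratedInDegree t)
    (ι : Type u) : (M.finsupp ι).GeneratedInDegree t := by
  rw [GeneratedInDegree, eq_top_iff]
  intro f _
  induction f using Finsupp.induction_linear with
  | zero => exact zero_mem _
  | add f g hf hg => exact add_mem (hf trivial) (hg trivial)
  | single x m => exact hM.map_mem_span (M.single_graded x) m

theorem GeneratedInDegree.shift {M : GrMod k R 𝒜} {t : ℤ} (hM : M.GeneratedInDegree t) (s : ℤ) :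
    (M.shift s).GeneratedInDegree (t + s) := by
  rw [← add_sub_cancel_right t s] at hM
  exact hM

/-! ### Lifting of graded homomorphisms -/

/-- The degree `0` part of a homomorphism between graded modules. -/
theorem exists_degree_zero_part {M N : GrMod k R 𝒜} (f : M.carrier →ₗ[R] N.carrier) :
    ∃ g : M.carrier →ₗ[R] N.carrier, IsGradedHom g ∧
      ∀ i, ∀ m ∈ M.deg i, g m = N.proj i (f m) := by
  classical
  let g₀ : (DirectSum ℤ fun i => M.deg i) →ₗ[k] N.carrier :=
    DirectSum.toModule k ℤ N.carrier fun i =>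
      N.proj i ∘ₗ f.restrictScalars k ∘ₗ (M.deg i).subtype
  let e := LinearEquiv.ofBijective (DirectSum.coeLinearMap M.deg) M.bijective_coeLinearMap
  have key : ∀ i, ∀ m ∈ M.deg i, g₀ (e.symm m) = N.proj i (f m) := by
    intro i m hm
    have : e.symm m = DirectSum.lof k ℤ (fun i => M.deg i) i ⟨m, hm⟩ := by
      rw [LinearEquiv.symm_apply_eq, LinearEquiv.ofBijective_apply, DirectSum.coeLinearMap_lof]
    rw [this, DirectSum.toModule_lof]
    rfl
  have hsmul : ∀ (a : R) (m : M.carrier), g₀ (e.symm (a • m)) = a • g₀ (e.symm m) := by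
    intro a m
    induction a using GradedAlgebra.induction_homogeneous (𝒜 := 𝒜) with
    | add a b ha hb => rw [add_smul, map_add, map_add, ha, hb, add_smul]
    | homog j a ha =>
      induction m using M.induction_homogeneous with
      | add m n hm hn => rw [smul_add, map_add, map_add, hm, hn, map_add, map_add, smul_add]
      | homog i m hm =>
        rw [key _ _ hm, key _ _ (M.smul_mem ha hm), map_smul, N.proj_smul ha,
          show (j : ℤ) + i - j = i by omega]
  refine ⟨{ toFun := fun m => g₀ (e.symm m), map_add' := by simp, map_smul' := hsmul }, ?_, key⟩
  intro i m hm
  exact (key i m hm).symm ▸ N.proj_mem i _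

/-- The degree `0` part of an arbitrary lift is still a lift, since `f` and `g` preserve degrees. -/
theorem exists_graded_lift {P M N : GrMod k R 𝒜} (hP : Module.Projective R P.carrier)
    {f : P.carrier →ₗ[R] N.carrier} (hf : IsGradedHom f) {g : M.carrier →ₗ[R] N.carrier}
    (hg : IsGradedHom g) (hs : Function.Surjective g) :
    ∃ h : P.carrier →ₗ[R] M.carrier, IsGradedHom h ∧ ∀ p, g (h p) = f p := by
  obtain ⟨h₀, hh₀⟩ := Module.projective_lifting_property g f hs
  obtain ⟨h, hh, hh'⟩ := exists_degree_zero_part h₀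
  refine ⟨h, hh, fun p => ?_⟩
  induction p using P.induction_homogeneous with
  | homog i p hp =>
    rw [hh' i p hp, hg.proj_comm, ← LinearMap.comp_apply, hh₀, N.proj_of_mem (hf i p hp)]
  | add p q hp hq => rw [map_add, map_add, hp, hq, map_add]

end GrMod

end GradedRingModules

/-! ### Covers and truncated linear resolutions. -/

section Covers

variable {k : Type w} [Field k] {R : Type u} [Ring R] [Algebra k R] {𝒜 : ℕ → Submodule k R}

namespace GrMod

variable [GradedAlgebra 𝒜]

/-- A graded projective module generated in degree `t` that surjects onto `M`, such that the
surjection is an isomorphism in degree `t`. -/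
structure IsCover (t : ℤ) {P M : GrMod k R 𝒜} (f : P.carrier →ₗ[R] M.carrier) : Prop where
  projective : Module.Projective R P.carrier
  generated : P.GeneratedInDegree t
  graded : IsGradedHom f
  surjective : Function.Surjective f
  injective : ∀ x ∈ P.deg t, f x = 0 → x = 0

/-- `M` is generated in degree `t` and has the first `n` steps of a graded projective resolution
whose terms are generated in degrees `t`, `t + 1`, …. -/
def IsLinear : ℕ → ℤ → GrMod k R 𝒜 → Prop
  | 0, _, _ => True
  | n + 1, t, M => ∃ (P : GrMod k R 𝒜) (f : P.carrier →ₗ[R] M.carrier) (hf : IsCover t f),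
      IsLinear n (t + 1) (ker f hf.graded)

theorem IsCover.generatedInDegree {t : ℤ} {P M : GrMod k R 𝒜} {f : P.carrier →ₗ[R] M.carrier}
    (hf : IsCover t f) : M.GeneratedInDegree t :=
  hf.generated.of_surjective hf.graded hf.surjective

theorem IsLinear.generatedInDegree {n : ℕ} {t : ℤ} {M : GrMod k R 𝒜} (h : IsLinear (n + 1) t M) :
    M.GeneratedInDegree t := by
  obtain ⟨P, f, hf, -⟩ := h
  exact hf.generatedInDegree

theorem IsLinear.of_succ {n : ℕ} {t : ℤ} {M : GrMod k R 𝒜} (h : IsLinear (n + 1) t M) :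
    IsLinear n t M := by
  induction n generalizing t M with
  | zero => trivial
  | succ n ih =>
    obtain ⟨P, f, hf, h⟩ := h
    exact ⟨P, f, hf, ih h⟩

/-- The inclusion of the degree `0` subalgebra. -/
def degZeroIncl (𝒜 : ℕ → Submodule k R) [GradedAlgebra 𝒜] : degZeroAlg 𝒜 →ₗ[degZeroAlg 𝒜] R where
  toFun := Subtype.val
  map_add' _ _ := rfl
  map_smul' _ _ := rfl

theorem smul_mem_of_mem_self (M : GrMod k R 𝒜) {i j l : ℤ} {a : R} {m : M.carrier}
    (ha : a ∈ (self 𝒜).deg i) (hm : m ∈ M.deg j) (h : i + j = l) : a • m ∈ M.deg l := by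
  rcases lt_or_ge i 0 with hi | hi
  · rw [self_deg_neg hi] at ha
    have ha' : a = 0 := ha
    rw [ha', zero_smul]
    exact zero_mem _
  · lift i to ℕ using hi
    exact M.smul_mem' (mem_self_deg.1 ha) hm h

/-- The free graded module on a family of generators of degree `t`. -/
noncomputable def free (𝒜 : ℕ → Submodule k R) [GradedAlgebra 𝒜] (ι : Type u) (t : ℤ) :
    GrMod k R 𝒜 := ((self 𝒜).finsupp ι).shift t

theorem mem_free_deg {ι : Type u} {t i : ℤ} {f : ι →₀ R} :
    f ∈ (free 𝒜 ι t).deg i ↔ ∀ x, f x ∈ (self 𝒜).deg (i - t) := Iff.rfl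

theorem free_generatedInDegree (ι : Type u) (t : ℤ) :
    (free 𝒜 ι t).GeneratedInDegree t := by
  have := ((self_generatedInDegree (𝒜 := 𝒜)).finsupp ι).shift t
  rwa [zero_add] at this

instance free_projective (ι : Type u) (t : ℤ) : Module.Projective R (free 𝒜 ι t).carrier :=
  inferInstanceAs (Module.Projective R (ι →₀ R))

theorem linearCombination_graded {ι : Type u} {t : ℤ} {M : GrMod k R 𝒜} {v : ι → M.carrier}
    (hv : ∀ x, v x ∈ M.deg t) :
    IsGradedHom (M := free 𝒜 ι t) (N := M) (Finsupp.linearCombination R v) := by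
  intro i f hf
  exact Submodule.sum_mem _ fun x _ => M.smul_mem_of_mem_self (hf x) (hv x) (by omega)

open Classical in
-- The cover is the module induced from `M_t` along `R_0 → R`, realised as the image of an
-- idempotent endomorphism of a free graded module; projectivity of `M_t` supplies the idempotent.
theorem exists_isCover {M : GrMod k R 𝒜} {t : ℤ} (hM : M.GeneratedInDegree t)
    [hproj : Module.Projective (degZeroAlg 𝒜) (M.degSub t)] :
    ∃ (P : GrMod k R 𝒜) (f : P.carrier →ₗ[R] M.carrier), IsCover t f := by
  -- `s` splits the canonical map onto `M_t` from the free module on its elements. After extension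
  -- of scalars, `ε` sends the generator `z` to `s z`; it is idempotent (`hεε`), and `lc ∘ ε = lc`
  -- (`h3`), so `lc` stays surjective on the image of `ε`.
  obtain ⟨s, hs⟩ := Module.projective_def'.1 hproj
  let emb : (M.degSub t →₀ degZeroAlg 𝒜) →ₗ[degZeroAlg 𝒜] (M.degSub t →₀ R) :=
    Finsupp.mapRange.linearMap (degZeroIncl 𝒜)
  let lc₀ := Finsupp.linearCombination (degZeroAlg 𝒜) (id : M.degSub t → M.degSub t)
  let ε := Finsupp.linearCombination R fun z => emb (s z)
  let lc := Finsupp.linearCombination R fun z : M.degSub t => (z : M.carrier)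
  have hemb : ∀ x, emb x ∈ (free 𝒜 (M.degSub t) t).deg t := by
    refine fun x => mem_free_deg.2 fun z => ?_
    change ((x z : degZeroAlg 𝒜) : R) ∈ _
    rw [sub_self]
    exact mem_self_deg.2 (x z).2
  have hs' : ∀ z, lc₀ (s z) = z := fun z => LinearMap.congr_fun hs z
  have hεs : ∀ (z : M.degSub t) (a : R), ε (Finsupp.single z a) = a • emb (s z) :=
    fun z a => Finsupp.linearCombination_single _ _ _
  have hlcs : ∀ (z : M.degSub t) (a : R), lc (Finsupp.single z a) = a • (z : M.carrier) :=
    fun z a => Finsupp.linearCombination_single _ _ _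
  have hembs : ∀ (z : M.degSub t) (c : degZeroAlg 𝒜),
      emb (Finsupp.single z c) = Finsupp.single z (c : R) :=
    fun z c => Finsupp.mapRange_single (hf := rfl)
  have hlc₀s : ∀ (z : M.degSub t) (c : degZeroAlg 𝒜), lc₀ (Finsupp.single z c) = c • z :=
    fun z c => Finsupp.linearCombination_single _ _ _
  have h1 : ∀ x, lc (emb x) = lc₀ x := by
    intro x
    induction x using Finsupp.induction_linear with
    | zero => simp
    | add x y hx hy => rw [map_add, map_add, hx, hy, map_add, Submodule.coe_add]
    | single z c => rw [hembs, hlcs, hlc₀s]; rfl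
  have h2 : ∀ x, ε (emb x) = emb (s (lc₀ x)) := by
    intro x
    induction x using Finsupp.induction_linear with
    | zero => simp
    | add x y hx hy => rw [map_add, map_add, hx, hy, map_add, map_add, map_add]
    | single z c => rw [hembs, hεs, hlc₀s, map_smul, map_smul]; rfl
  have h3 : ∀ f, lc (ε f) = lc f := by
    intro f
    induction f using Finsupp.induction_linear with
    | zero => simp
    | add f g hf hg => rw [map_add, map_add, hf, hg, map_add]
    | single z a => rw [hεs, hlcs, map_smul, h1, hs']
  have hεε : ∀ f, ε (ε f) = ε f := by
    intro f
    induction f using Finsupp.induction_linear with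
    | zero => simp
    | add f g hf hg => rw [map_add, map_add, hf, hg]
    | single z a => rw [hεs, map_smul, h2, hs']
  let F := free 𝒜 (M.degSub t) t
  have hεg : IsGradedHom (M := F) (N := F) ε :=
    linearCombination_graded (M := F) (v := fun z => emb (s z)) fun z => hemb _
  have hlcg : IsGradedHom (M := F) (N := M) lc := linearCombination_graded fun z => z.2
  let P := F.sub (LinearMap.range ε) (by
    rintro i _ ⟨f, rfl⟩
    exact ⟨F.proj i f, hεg.proj_comm i f⟩)
  let q : F.carrier →ₗ[R] P.carrier := ε.rangeRestrict
  let ι : P.carrier →ₗ[R] F.carrier := (LinearMap.range ε).subtype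
  have hιq : ∀ x, q (ι x) = x := by
    rintro ⟨_, f, rfl⟩
    exact Subtype.ext (hεε f)
  have hq : IsGradedHom q := hεg
  refine ⟨P, lc ∘ₗ ι, ⟨Module.Projective.of_split ι q (LinearMap.ext hιq),
    (free_generatedInDegree _ t).of_surjective hq ε.surjective_rangeRestrict,
    fun i x hx => hlcg i _ hx, hM.surjective fun z hz => ?_, ?_⟩⟩
  · refine ⟨q (Finsupp.single ⟨z, hz⟩ (1 : R) : M.degSub t →₀ R), ?_⟩
    change lc (ε _) = z
    rw [h3, hlcs, one_smul]
  -- In degree `t` the coefficients of `ε f` have degree `0`, so `ε f = emb x₀`. On such elements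
  -- `ε` is `emb ∘ s ∘ lc₀`, and `lc₀ x₀` is the image of `ε f` in `M`, which is zero.
  · rintro ⟨x, f, rfl⟩ hx hx'
    replace hx := mem_free_deg.1 (show ε f ∈ (free 𝒜 (M.degSub t) t).deg t from hx)
    change lc (ε f) = 0 at hx'
    have hmem : ∀ z, ε f z ∈ 𝒜 0 := fun z =>
      mem_self_deg.1 (by have := hx z; rwa [sub_self] at this)
    let x₀ : M.degSub t →₀ degZeroAlg 𝒜 := Finsupp.mapRange
      (fun a => if h : a ∈ 𝒜 0 then ⟨a, h⟩ else 0) (by simp; rfl) (ε f)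
    have hx₀ : emb x₀ = ε f := by
      refine Finsupp.ext fun z => ?_
      change ((if h : _ then _ else _ : degZeroAlg 𝒜) : R) = _
      rw [dif_pos (hmem z)]
    have h0 : lc₀ x₀ = 0 := Subtype.ext (by rw [← h1, hx₀, hx']; rfl)
    refine Subtype.ext ?_
    change ε f = 0
    rw [← hεε, ← hx₀, h2, h0, map_zero, map_zero]

/-- A section of a surjection onto a projective graded module can be chosen graded. -/
theorem exists_graded_section {P M : GrMod k R 𝒜} (hP : Module.Projective R P.carrier)
    {g : M.carrier →ₗ[R] P.carrier} (hg : IsGradedHom g) (hs : Function.Surjective g) :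
    ∃ h : P.carrier →ₗ[R] M.carrier, IsGradedHom h ∧ ∀ p, g (h p) = p :=
  exists_graded_lift hP (isGradedHom_id P) hg hs

theorem IsCover.degMap_bijective {t : ℤ} {P M : GrMod k R 𝒜} {f : P.carrier →ₗ[R] M.carrier}
    (hf : IsCover t f) : Function.Bijective (degMap hf.graded t) := by
  constructor
  · rw [← LinearMap.ker_eq_bot, LinearMap.ker_eq_bot']
    exact fun x hx => Subtype.ext (hf.injective x x.2 (congrArg Subtype.val hx))
  · intro y
    obtain ⟨x, hx, hxy⟩ := hf.graded.exists_homogeneous_preimage y.2 (hf.surjective y)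
    exact ⟨⟨x, hx⟩, Subtype.ext hxy⟩

theorem projective_free_degSub {ι : Type u} {t : ℤ} (j : ℤ)
    (hj : Module.Projective (degZeroAlg 𝒜) ((self 𝒜).degSub j)) :
    Module.Projective (degZeroAlg 𝒜) ((free 𝒜 ι t).degSub (j + t)) := by
  classical
  have : Module.Projective (degZeroAlg 𝒜) (ι →₀ (self 𝒜).degSub j) :=
    Module.Projective.of_equiv (finsuppLequivDFinsupp (degZeroAlg 𝒜)).symm
  let b : (ι →₀ (self 𝒜).degSub j) →ₗ[degZeroAlg 𝒜] (ι →₀ R) :=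
    Finsupp.mapRange.linearMap ((self 𝒜).degSub j).subtype
  let a : (ι →₀ (self 𝒜).degSub j) →ₗ[degZeroAlg 𝒜] (free 𝒜 ι t).degSub (j + t) :=
    LinearMap.codRestrict ((free 𝒜 ι t).degSub (j + t)) b (fun x => mem_free_deg.2 fun z => by
        change ((x z : (self 𝒜).degSub j) : (self 𝒜).carrier) ∈ _
        rw [add_sub_cancel_right]
        exact (x z).2)
  refine Module.Projective.of_equiv (LinearEquiv.ofBijective a ⟨fun x y hxy => ?_, ?_⟩)
  · refine Finsupp.ext fun z => Subtype.ext ?_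
    exact DFunLike.congr_fun (congrArg Subtype.val hxy : (_ : ι →₀ R) = _) z
  · rintro ⟨(y : ι →₀ R), hy⟩
    have hy' : ∀ z, y z ∈ (self 𝒜).degSub j := fun z => by
      have := mem_free_deg.1 hy z
      rwa [add_sub_cancel_right] at this
    refine ⟨Finsupp.mapRange (fun r : R => if h : r ∈ (self 𝒜).degSub j then
      (⟨r, h⟩ : (self 𝒜).degSub j) else 0) (by split_ifs <;> rfl) y,
      Subtype.ext (Finsupp.ext fun z => ?_ : (_ : ι →₀ R) = y)⟩
    change ((if h : _ then _ else _ : (self 𝒜).degSub j) : (self 𝒜).carrier) = _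
    rw [dif_pos (hy' z)]

/-- The generating family is arbitrary, so that both the whole component `P_t` and a finite spanning
set of it can be used. -/
theorem exists_free_retract {P : GrMod k R 𝒜} (hP : Module.Projective R P.carrier) {t : ℤ}
    {ι : Type u} (v : ι → P.carrier) (hv : ∀ x, v x ∈ P.deg t)
    (hspan : Submodule.span R (Set.range v) = ⊤) :
    ∃ (i : P.carrier →ₗ[R] (free 𝒜 ι t).carrier) (r : (free 𝒜 ι t).carrier →ₗ[R] P.carrier),
      IsGradedHom i ∧ IsGradedHom r ∧ ∀ x, r (i x) = x := by
  have hr := linearCombination_graded hv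
  have hs : Function.Surjective (Finsupp.linearCombination R v) := by
    rw [← LinearMap.range_eq_top, Finsupp.range_linearCombination, hspan]
  obtain ⟨σ, hσ, hσ'⟩ := exists_graded_section (M := free 𝒜 ι t) hP hr hs
  exact ⟨σ, _, hσ, hr, hσ'⟩

/-- `P` is a graded summand of a free module with generators in degree `t`, whose component of
degree `j + t` is a direct sum of copies of `R_j`. -/
theorem projective_degSub_add {P : GrMod k R 𝒜} (hP : Module.Projective R P.carrier) {t : ℤ}
    (hgen : P.GeneratedInDegree t) (j : ℤ)
    (hj : Module.Projective (degZeroAlg 𝒜) ((self 𝒜).degSub j)) :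
    Module.Projective (degZeroAlg 𝒜) (P.degSub (j + t)) := by
  obtain ⟨i, r, hi, hr, hir⟩ := exists_free_retract hP (ι := P.deg t) (fun z => z.1)
    (fun z => z.2) ((congrArg (Submodule.span R) Subtype.range_coe).trans hgen)
  have := projective_free_degSub (ι := P.deg t) (t := t) j hj
  exact Module.Projective.of_split (degMap hi (j + t)) (degMap hr (j + t))
    (LinearMap.ext fun x => Subtype.ext (hir x))

theorem projective_self_degSub_zero :
    Module.Projective (degZeroAlg 𝒜) ((self 𝒜).degSub 0) :=
  Module.Projective.of_equiv (LinearEquiv.ofBijective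
    ((degZeroIncl 𝒜).codRestrict ((self 𝒜).degSub 0) fun c => mem_self_deg (i := 0).2 c.2)
    ⟨fun _ _ h => Subtype.ext (congrArg Subtype.val h),
      fun y => ⟨⟨(y : (self 𝒜).carrier), mem_self_deg (i := 0).1 y.2⟩, rfl⟩⟩)

theorem projective_degSub_of_generated {P : GrMod k R 𝒜} (hP : Module.Projective R P.carrier)
    {t : ℤ} (hgen : P.GeneratedInDegree t) : Module.Projective (degZeroAlg 𝒜) (P.degSub t) := by
  have := projective_degSub_add hP hgen 0 projective_self_degSub_zero
  rwa [zero_add] at this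

theorem IsCover.projective_degSub {t : ℤ} {P M : GrMod k R 𝒜} {f : P.carrier →ₗ[R] M.carrier}
    (hf : IsCover t f) : Module.Projective (degZeroAlg 𝒜) (M.degSub t) :=
  have := projective_degSub_of_generated hf.projective hf.generated
  Module.Projective.of_equiv (LinearEquiv.ofBijective _ hf.degMap_bijective)

end GrMod

end Covers

/-! ### Closure properties of linear modules. -/

section Linear

variable {k : Type w} [Field k] {R : Type u} [Ring R] [Algebra k R] {𝒜 : ℕ → Submodule k R}
  [GradedAlgebra 𝒜]

namespace GrMod

/-! ### Retracts and isomorphisms -/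

/-- A retraction of `M` onto `X` lifts to covers, so the syzygy of `X` is a retract of that of `M`.
Working with retracts keeps the induction going and yields at once the independence of the cover and
the closure under direct summands. -/
theorem IsLinear.ker_of_retract {n : ℕ} {t : ℤ} {M X PX : GrMod k R 𝒜}
    (h : IsLinear (n + 1) t M) {i : X.carrier →ₗ[R] M.carrier} {r : M.carrier →ₗ[R] X.carrier}
    (hi : IsGradedHom i) (hr : IsGradedHom r) (hri : ∀ x, r (i x) = x)
    {f : PX.carrier →ₗ[R] X.carrier} (hf : IsCover t f) : IsLinear n (t + 1) (ker f hf.graded) := by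
  induction n generalizing t M X PX with
  | zero => trivial
  | succ n ih =>
    obtain ⟨P, g, hg, hP⟩ := h
    obtain ⟨a, ha, hga⟩ := exists_graded_lift hf.projective (hi.comp hf.graded) hg.graded
      hg.surjective
    obtain ⟨b, hb, hfb⟩ := exists_graded_lift hg.projective (hr.comp hg.graded) hf.graded
      hf.surjective
    have hga' : ∀ p, g (a p) = i (f p) := hga
    have hfb' : ∀ p, f (b p) = r (g p) := hfb
    -- Both sides have the same image under `f`, which is injective in degree `t`, and `PX` is
    -- generated in that degree.
    have hba : ∀ x, b (a x) = x := by
      refine LinearMap.congr_fun (f := b ∘ₗ a) (g := LinearMap.id) (hf.generated.hom_ext ?_)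
      intro x hx
      rw [← sub_eq_zero]
      refine hf.injective _ (Submodule.sub_mem _ (hb _ _ (ha _ _ hx)) hx) ?_
      rw [map_sub, LinearMap.comp_apply, hfb', hga', hri, LinearMap.id_apply, sub_self]
    let a' := kerLift g hg.graded (a ∘ₗ kerι f hf.graded) fun x => by
      rw [LinearMap.comp_apply, hga', apply_kerι, map_zero]
    let b' := kerLift f hf.graded (b ∘ₗ kerι g hg.graded) fun x => by
      rw [LinearMap.comp_apply, hfb', apply_kerι, map_zero]
    have ha' : IsGradedHom a' := kerLift_graded _ _ _ _ (ha.comp (kerι_graded _ _))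
    have hb' : IsGradedHom b' := kerLift_graded _ _ _ _ (hb.comp (kerι_graded _ _))
    have hba' : ∀ x, b' (a' x) = x := fun x => kerι_injective f hf.graded (hba _)
    have hgen : (ker f hf.graded).GeneratedInDegree (t + 1) :=
      hP.generatedInDegree.of_surjective hb' fun x => ⟨a' x, hba' x⟩
    -- The syzygy of `X` has a cover because its component of degree `t + 1` is a summand of that of
    -- the syzygy of `M`, which is projective.
    obtain ⟨Q, q, hq, -⟩ := id hP
    have := hq.projective_degSub
    have : Module.Projective (degZeroAlg 𝒜) ((ker f hf.graded).degSub (t + 1)) :=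
      Module.Projective.of_split (degMap ha' (t + 1)) (degMap hb' (t + 1))
        (LinearMap.ext fun x => Subtype.ext (hba' x))
    obtain ⟨Q', q', hq'⟩ := exists_isCover hgen
    exact ⟨Q', q', hq', ih hP ha' hb' hba' hq'⟩

/-- Linearity does not depend on the choice of the cover. -/
theorem IsLinear.ker {n : ℕ} {t : ℤ} {P M : GrMod k R 𝒜} (h : IsLinear (n + 1) t M)
    {f : P.carrier →ₗ[R] M.carrier} (hf : IsCover t f) : IsLinear n (t + 1) (ker f hf.graded) :=
  h.ker_of_retract (isGradedHom_id M) (isGradedHom_id M) (fun _ => rfl) hf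

theorem IsLinear.of_retract {n : ℕ} {t : ℤ} {M X : GrMod k R 𝒜}
    (h : IsLinear n t M) {i : X.carrier →ₗ[R] M.carrier} {r : M.carrier →ₗ[R] X.carrier}
    (hi : IsGradedHom i) (hr : IsGradedHom r) (hri : ∀ x, r (i x) = x) : IsLinear n t X := by
  cases n with
  | zero => trivial
  | succ n =>
    obtain ⟨Q, q, hq, -⟩ := id h
    have := hq.projective_degSub
    have : Module.Projective (degZeroAlg 𝒜) (X.degSub t) :=
      Module.Projective.of_split (degMap hi t) (degMap hr t)
        (LinearMap.ext fun x => Subtype.ext (hri x))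
    obtain ⟨P, f, hf⟩ := exists_isCover (h.generatedInDegree.of_surjective hr fun x => ⟨i x, hri x⟩)
    exact ⟨P, f, hf, h.ker_of_retract hi hr hri hf⟩

theorem IsLinear.of_bijective {n : ℕ} {t : ℤ} {M X : GrMod k R 𝒜} (h : IsLinear n t M)
    {i : X.carrier →ₗ[R] M.carrier} (hi : IsGradedHom i) (hb : Function.Bijective i) :
    IsLinear n t X := by
  let e := LinearEquiv.ofBijective i hb
  refine h.of_retract (r := e.symm.toLinearMap) hi (fun j m hm => ?_) e.symm_apply_apply
  refine hi.mem_deg_of_injective hb.1 ?_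
  change e (e.symm m) ∈ _
  rwa [e.apply_symm_apply]

theorem IsLinear.of_subsingleton (n : ℕ) (t : ℤ) (M : GrMod k R 𝒜) [Subsingleton M.carrier] :
    IsLinear n t M := by
  induction n generalizing t M with
  | zero => trivial
  | succ n ih =>
    refine ⟨M, LinearMap.id, ⟨inferInstance, .of_subsingleton M t, isGradedHom_id M,
      Function.surjective_id, fun x _ _ => Subsingleton.elim _ _⟩, ?_⟩
    have : Subsingleton (GrMod.ker (LinearMap.id : M.carrier →ₗ[R] M.carrier)
      (isGradedHom_id M)).carrier := (kerι_injective _ _).subsingleton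
    exact ih _ _

theorem isCover_id {P : GrMod k R 𝒜} {t : ℤ} (hP : Module.Projective R P.carrier)
    (hgen : P.GeneratedInDegree t) : IsCover (P := P) (M := P) t LinearMap.id :=
  ⟨hP, hgen, isGradedHom_id P, Function.surjective_id, fun _ _ h => h⟩

theorem IsLinear.of_projective {P : GrMod k R 𝒜} {t : ℤ} (hP : Module.Projective R P.carrier)
    (hgen : P.GeneratedInDegree t) (n : ℕ) : IsLinear n t P := by
  cases n with
  | zero => trivial
  | succ n =>
    refine ⟨P, LinearMap.id, isCover_id hP hgen, ?_⟩
    have : Subsingleton (GrMod.ker (LinearMap.id : P.carrier →ₗ[R] P.carrier)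
        (isGradedHom_id P)).carrier :=
      ⟨fun x y => kerι_injective _ _ ((apply_kerι _ _ x).trans (apply_kerι _ _ y).symm)⟩
    exact .of_subsingleton _ _ _

/-! ### Short exact sequences -/

/-- Graded homomorphisms `0 → L → M → N → 0` that form a short exact sequence. -/
structure ShortExact {L M N : GrMod k R 𝒜} (f : L.carrier →ₗ[R] M.carrier)
    (g : M.carrier →ₗ[R] N.carrier) : Prop where
  left_graded : IsGradedHom f
  right_graded : IsGradedHom g
  injective : Function.Injective f
  exact : Function.Exact f g
  surjective : Function.Surjective g

theorem ShortExact.ker {M N : GrMod k R 𝒜} {f : M.carrier →ₗ[R] N.carrier} (hf : IsGradedHom f)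
    (hs : Function.Surjective f) : ShortExact (kerι f hf) f :=
  ⟨kerι_graded f hf, hf, kerι_injective f hf, exact_kerι f hf, hs⟩

/-- Horseshoe lemma: the sum of covers of `L` and `N` covers `M`, and the kernels again form a short
exact sequence. -/
theorem IsLinear.extension {n : ℕ} {t : ℤ} {L M N : GrMod k R 𝒜} {f : L.carrier →ₗ[R] M.carrier}
    {g : M.carrier →ₗ[R] N.carrier} (h : ShortExact f g) (hL : IsLinear n t L)
    (hN : IsLinear n t N) : IsLinear n t M := by
  induction n generalizing t L M N with
  | zero => trivial
  | succ n ih =>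
    obtain ⟨P, p, hp, hp'⟩ := hL
    obtain ⟨Q, q, hq, hq'⟩ := hN
    obtain ⟨s, hs, hgs⟩ := exists_graded_lift hq.projective hq.graded h.right_graded h.surjective
    have hgf : ∀ x, g (f x) = 0 := h.exact.apply_apply_eq_zero
    let m : (P.prod Q).carrier →ₗ[R] M.carrier := f ∘ₗ p ∘ₗ fst P Q + s ∘ₗ snd P Q
    have hmdef : ∀ x, m x = f (p (fst P Q x)) + s (snd P Q x) := fun _ => rfl
    have hmpair : ∀ x z, m (inl P Q x + inr P Q z) = f (p x) + s z := fun x z => by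
      have h1 : fst P Q (inl P Q x + inr P Q z) = x := by rw [map_add, fst_inl, fst_inr, add_zero]
      have h2 : snd P Q (inl P Q x + inr P Q z) = z := by rw [map_add, snd_inl, snd_inr, zero_add]
      rw [hmdef, h1, h2]
    have hgm : ∀ x, g (m x) = q (snd P Q x) := fun x => by
      rw [hmdef, map_add, hgf, zero_add, hgs]
    have hm : IsGradedHom m := fun i x hx => add_mem
      (h.left_graded _ _ (hp.graded _ _ (fst_graded P Q _ _ hx))) (hs _ _ (snd_graded P Q _ _ hx))
    have hcover : IsCover t m := by
      have := hp.projective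
      have := hq.projective
      refine ⟨inferInstanceAs (Module.Projective R (P.carrier × Q.carrier)),
        hp.generated.prod hq.generated, hm, fun y => ?_, fun x hx hx0 => ?_⟩
      · obtain ⟨z, hz⟩ := hq.surjective (g y)
        obtain ⟨l, hl⟩ := (h.exact (y - s z)).1 (by rw [map_sub, hgs, hz, sub_self])
        obtain ⟨x, rfl⟩ := hp.surjective l
        refine ⟨inl P Q x + inr P Q z, ?_⟩
        rw [hmpair, hl, sub_add_cancel]
      · have h2 : snd P Q x = 0 := hq.injective _ (snd_graded P Q _ _ hx) (by rw [← hgm, hx0, map_zero])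
        have h1 : fst P Q x = 0 := by
          refine hp.injective _ (fst_graded P Q _ _ hx) (h.injective ?_)
          rw [map_zero, ← hx0, hmdef, h2, map_zero, add_zero]
        rw [← inl_fst_add_inr_snd P Q x, h1, h2, map_zero, map_zero, add_zero]
    refine ⟨P.prod Q, m, hcover, ?_⟩
    let a := kerLift m hm (inl P Q ∘ₗ kerι p hp.graded) fun x => by
      rw [LinearMap.comp_apply, hmdef, fst_inl, snd_inl, apply_kerι, map_zero, map_zero, add_zero]
    let b := kerLift q hq.graded (snd P Q ∘ₗ kerι m hm) fun x => by
      rw [LinearMap.comp_apply, ← hgm, apply_kerι, map_zero]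
    refine ih (f := a) (g := b) ⟨kerLift_graded _ _ _ _ ((inl_graded P Q).comp (kerι_graded _ _)),
      kerLift_graded _ _ _ _ ((snd_graded P Q).comp (kerι_graded _ _)), fun x y hxy => ?_,
      fun x => ⟨fun hx => ?_, ?_⟩, fun y => ?_⟩ hp' hq'
    · exact kerι_injective _ _ (congrArg (fun z => fst P Q (kerι m hm z)) hxy)
    · have h2 : snd P Q (kerι m hm x) = 0 := congrArg (kerι q hq.graded) hx
      have h1 := apply_kerι m hm x
      rw [hmdef, h2, map_zero, add_zero] at h1
      have h1' : p (fst P Q (kerι m hm x)) = 0 := h.injective (by rw [h1, map_zero])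
      refine ⟨⟨fst P Q (kerι m hm x), h1'⟩, kerι_injective _ _ ?_⟩
      change inl P Q (fst P Q (kerι m hm x)) = kerι m hm x
      conv_rhs => rw [← inl_fst_add_inr_snd P Q (kerι m hm x), h2, map_zero, add_zero]
    · rintro ⟨y, rfl⟩
      rfl
    · obtain ⟨l, hl⟩ := (h.exact (s (kerι _ _ y))).1 (by rw [hgs, apply_kerι])
      obtain ⟨x, rfl⟩ := hp.surjective l
      -- For `y` in the kernel of `q` the element `s y` lies in the image of `f`, say `s y = f (p
      -- x)`; the entry `-x` in the first summand cancels it under `m`.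
      refine ⟨⟨inl P Q (-x) + inr P Q (kerι _ _ y), ?_⟩, kerι_injective _ _ ?_⟩
      · rw [LinearMap.mem_ker, hmpair, map_neg, map_neg, hl, neg_add_cancel]
      · change snd P Q (inl P Q (-x) + inr P Q (kerι _ _ y)) = _
        rw [map_add, snd_inl, snd_inr, zero_add]

theorem IsCover.comp {t : ℤ} {P M N : GrMod k R 𝒜} {p : P.carrier →ₗ[R] M.carrier}
    (hp : IsCover t p) {g : M.carrier →ₗ[R] N.carrier} (hg : IsGradedHom g)
    (hs : Function.Surjective g) (hinj : ∀ m ∈ M.deg t, g m = 0 → m = 0) :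
    IsCover (P := P) (M := N) t (g ∘ₗ p) :=
  ⟨hp.projective, hp.generated, hg.comp hp.graded, hs.comp hp.surjective, fun x hx h =>
    hp.injective x hx (hinj _ (hp.graded _ _ hx) h)⟩

theorem ShortExact.apply_apply {L M N : GrMod k R 𝒜} {f : L.carrier →ₗ[R] M.carrier}
    {g : M.carrier →ₗ[R] N.carrier} (h : ShortExact f g) (x : L.carrier) : g (f x) = 0 :=
  h.exact.apply_apply_eq_zero x

theorem ShortExact.exists_lift {X L M N : GrMod k R 𝒜} {f : L.carrier →ₗ[R] M.carrier}
    {g : M.carrier →ₗ[R] N.carrier} (h : ShortExact f g) {u : X.carrier →ₗ[R] M.carrier}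
    (hu : IsGradedHom u) (hgu : ∀ x, g (u x) = 0) :
    ∃ v : X.carrier →ₗ[R] L.carrier, IsGradedHom v ∧ ∀ x, f (v x) = u x := by
  let e := LinearEquiv.ofInjective f h.injective
  let v : X.carrier →ₗ[R] L.carrier :=
    e.symm.toLinearMap ∘ₗ u.codRestrict (LinearMap.range f) fun x => (h.exact _).1 (hgu x)
  have hv : ∀ x, f (v x) = u x := fun x => congrArg Subtype.val (e.apply_symm_apply _)
  exact ⟨v, fun i x hx => h.left_graded.mem_deg_of_injective h.injective
    ((hv x).symm ▸ hu i x hx), hv⟩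

/-- The kernel of a composition of surjections is an extension of the kernels. -/
theorem ShortExact.ker_comp {P L M N : GrMod k R 𝒜} {f : L.carrier →ₗ[R] M.carrier}
    {g : M.carrier →ₗ[R] N.carrier} (h : ShortExact f g) {p : P.carrier →ₗ[R] M.carrier}
    (hp : IsGradedHom p) (hps : Function.Surjective p) {q : P.carrier →ₗ[R] N.carrier}
    (hq : IsGradedHom q) (hgp : ∀ x, g (p x) = q x) :
    ∃ (a : (GrMod.ker p hp).carrier →ₗ[R] (GrMod.ker q hq).carrier)
      (b : (GrMod.ker q hq).carrier →ₗ[R] L.carrier), ShortExact a b := by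
  let a := kerLift q hq (kerι p hp) fun x => by rw [← hgp, apply_kerι, map_zero]
  obtain ⟨b, hb, hfb⟩ := h.exists_lift (hp.comp (kerι_graded q hq)) fun x => by
    rw [LinearMap.comp_apply, hgp, apply_kerι]
  have hfb' : ∀ x, f (b x) = p (kerι q hq x) := hfb
  refine ⟨a, b, kerLift_graded _ _ _ _ (kerι_graded _ _), hb, fun x y hxy =>
    kerι_injective _ _ (congrArg (kerι q hq) hxy), fun x => ⟨fun hx => ?_, ?_⟩, fun y => ?_⟩
  · have hx' : p (kerι q hq x) = 0 := by rw [← hfb', hx, map_zero]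
    exact ⟨⟨kerι q hq x, hx'⟩, rfl⟩
  · rintro ⟨y, rfl⟩
    refine h.injective ?_
    rw [hfb', map_zero]
    exact apply_kerι p hp y
  · obtain ⟨x, hx⟩ := hps (f y)
    have hx' : q x = 0 := by rw [← hgp, hx, h.apply_apply]
    exact ⟨⟨x, hx'⟩, h.injective ((hfb' _).trans hx)⟩

/-- The cokernel of a linear module in the next degree. -/
theorem IsLinear.cokernel {n : ℕ} {t : ℤ} {L M N : GrMod k R 𝒜} {f : L.carrier →ₗ[R] M.carrier}
    {g : M.carrier →ₗ[R] N.carrier} (h : ShortExact f g) (hL : IsLinear n (t + 1) L)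
    (hM : IsLinear (n + 1) t M) (hinj : ∀ m ∈ M.deg t, g m = 0 → m = 0) :
    IsLinear (n + 1) t N := by
  obtain ⟨P, p, hp, hp'⟩ := hM
  -- As `g` is injective in degree `t`, the cover of `M` also covers `N`. The syzygy of `N` is then
  -- an extension of `L` by the syzygy of `M`, both linear in degree `t + 1`.
  have hc := hp.comp h.right_graded h.surjective hinj
  obtain ⟨a, b, hab⟩ := h.ker_comp hp.graded hp.surjective hc.graded fun _ => rfl
  exact ⟨P, _, hc, hp'.extension hab hL⟩

section Semisimple

variable [IsSemisimpleRing (degZeroAlg 𝒜)]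

theorem exists_isCover_of_isSemisimpleRing {M : GrMod k R 𝒜} {t : ℤ}
    (hM : M.GeneratedInDegree t) :
    ∃ (P : GrMod k R 𝒜) (f : P.carrier →ₗ[R] M.carrier), IsCover t f :=
  have := Module.projective_of_isSemisimpleRing (degZeroAlg 𝒜) (M.degSub t)
  exists_isCover hM

/-- The cokernel of a linear module in the same degree. -/
theorem IsLinear.cokernel_same {n : ℕ} {t : ℤ} {X Y Z : GrMod k R 𝒜}
    {f : X.carrier →ₗ[R] Y.carrier} {g : Y.carrier →ₗ[R] Z.carrier} (h : ShortExact f g)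
    (hX : IsLinear n t X) (hY : IsLinear (n + 1) t Y) : IsLinear (n + 1) t Z := by
  induction n generalizing t X Y Z with
  | zero =>
    obtain ⟨P, p, hp⟩ := exists_isCover_of_isSemisimpleRing
      (hY.generatedInDegree.of_surjective h.right_graded h.surjective)
    exact ⟨P, p, hp, trivial⟩
  | succ n ih =>
    -- Semisimplicity provides a cover `Q` of `Z`. The cover `P` of `Y` maps onto `Q` and splits;
    -- the complement of `Q` covers `X`, and the three syzygies form a short exact sequence in
    -- degree `t + 1` to which the induction hypothesis applies.
    obtain ⟨Q, q, hq⟩ := exists_isCover_of_isSemisimpleRing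
      (hY.generatedInDegree.of_surjective h.right_graded h.surjective)
    obtain ⟨P, p, hp, hp'⟩ := hY
    obtain ⟨φ, hφ, hqφ⟩ := exists_graded_lift hp.projective (h.right_graded.comp hp.graded)
      hq.graded hq.surjective
    have hqφ' : ∀ x, q (φ x) = g (p x) := hqφ
    have hφs : Function.Surjective φ := hq.generated.surjective fun z hz => by
      obtain ⟨y, hy⟩ := h.surjective (q z)
      obtain ⟨x, rfl⟩ := hp.surjective y
      obtain ⟨x', hx', hgx⟩ := (h.right_graded.comp hp.graded).exists_homogeneous_preimage
        (hq.graded _ _ hz) ⟨x, hy⟩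
      refine ⟨x', ?_⟩
      rw [← sub_eq_zero]
      refine hq.injective _ (Submodule.sub_mem _ (hφ _ _ hx') hz) ?_
      rw [map_sub, hqφ, hgx, sub_self]
    obtain ⟨σ, hσ, hφσ⟩ := exists_graded_section hq.projective hφ hφs
    let K := GrMod.ker φ hφ
    -- the complementary summand of `Q` in `P` covers `X`
    let ρ : P.carrier →ₗ[R] K.carrier := kerLift φ hφ (LinearMap.id - σ ∘ₗ φ) fun x => by
      rw [LinearMap.sub_apply, LinearMap.comp_apply, LinearMap.id_apply, map_sub, hφσ, sub_self]
    have hρι : ∀ x, ρ (kerι φ hφ x) = x := fun x => kerι_injective φ hφ (by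
      rw [kerι_kerLift, LinearMap.sub_apply, LinearMap.comp_apply, apply_kerι, map_zero,
        LinearMap.id_apply, sub_zero])
    have hρ : IsGradedHom ρ := kerLift_graded _ _ _ _ fun i x hx =>
      Submodule.sub_mem _ hx (hσ _ _ (hφ _ _ hx))
    obtain ⟨u, hu, hfu⟩ := h.exists_lift (hp.graded.comp (kerι_graded φ hφ)) fun x => by
      rw [LinearMap.comp_apply, ← hqφ', apply_kerι, map_zero]
    have hfu' : ∀ x, f (u x) = p (kerι φ hφ x) := hfu
    have hucover : IsCover t u := by
      have := hp.projective
      refine ⟨Module.Projective.of_split (kerι φ hφ) ρ (LinearMap.ext hρι),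
        hp.generated.of_surjective hρ fun x => ⟨_, hρι x⟩, hu,
        hX.generatedInDegree.surjective fun x hx => ?_, fun x hx hx0 => ?_⟩
      · obtain ⟨y, hy, hpy⟩ := hp.graded.exists_homogeneous_preimage (h.left_graded _ _ hx)
          (hp.surjective _)
        have hφy : φ y = 0 := hq.injective _ (hφ _ _ hy) (by rw [hqφ', hpy, h.apply_apply])
        exact ⟨⟨y, hφy⟩, h.injective ((hfu' _).trans hpy)⟩
      · refine kerι_injective φ hφ ?_
        rw [map_zero]
        exact hp.injective _ (kerι_graded φ hφ _ _ hx) (by rw [← hfu', hx0, map_zero])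
    refine ⟨Q, q, hq, ?_⟩
    let a := kerLift p hp.graded (kerι φ hφ ∘ₗ kerι u hu) fun x => by
      rw [LinearMap.comp_apply, ← hfu', apply_kerι, map_zero]
    let b := kerLift q hq.graded (φ ∘ₗ kerι p hp.graded) fun x => by
      rw [LinearMap.comp_apply, hqφ', apply_kerι, map_zero]
    have hbι : ∀ x, kerι q hq.graded (b x) = φ (kerι p hp.graded x) := fun _ => rfl
    refine ih (f := a) (g := b) ⟨kerLift_graded _ _ _ _ ((kerι_graded _ _).comp (kerι_graded _ _)),
      kerLift_graded _ _ _ _ (hφ.comp (kerι_graded _ _)), fun x y hxy => ?_,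
      fun x => ⟨fun hx => ?_, ?_⟩, fun y => ?_⟩ (hX.ker hucover) hp'
    · exact kerι_injective _ _ (kerι_injective _ _ (congrArg (kerι p hp.graded) hxy))
    · have h1 : φ (kerι p hp.graded x) = 0 := by rw [← hbι, hx, map_zero]
      have h2 : u ⟨kerι p hp.graded x, h1⟩ = 0 := h.injective (by
        rw [map_zero]
        exact (hfu' _).trans (apply_kerι p hp.graded x))
      exact ⟨⟨_, h2⟩, rfl⟩
    · rintro ⟨y, rfl⟩
      exact kerι_injective _ _ ((hbι _).trans (apply_kerι φ hφ _))
    · obtain ⟨x, hx⟩ := hφs (kerι q hq.graded y)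
      obtain ⟨l, hl⟩ := (h.exact (p x)).1 (by rw [← hqφ', hx, apply_kerι])
      obtain ⟨z, rfl⟩ := hucover.surjective l
      have h1 : p (x - kerι φ hφ z) = 0 := by rw [map_sub, ← hfu', hl, sub_self]
      refine ⟨⟨_, h1⟩, kerι_injective _ _ ((hbι _).trans ?_)⟩
      change φ (x - kerι φ hφ z) = _
      rw [map_sub, apply_kerι, sub_zero, hx]

/-- The kernel, in degrees above `t`, of a surjection between linear modules in degree `t`. -/
theorem IsLinear.kernel {n : ℕ} {t : ℤ} {L M N : GrMod k R 𝒜} {f : L.carrier →ₗ[R] M.carrier}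
    {g : M.carrier →ₗ[R] N.carrier} (h : ShortExact f g) (hM : IsLinear n t M)
    (hN : IsLinear (n + 1) t N) (hinj : ∀ m ∈ M.deg t, g m = 0 → m = 0) :
    IsLinear n (t + 1) L := by
  cases n with
  | zero => trivial
  | succ n =>
    obtain ⟨P, p, hp, hp'⟩ := hM
    -- The cover of `M` also covers `N`, and `L` is the quotient of the syzygy of `N` by the syzygy
    -- of `M`, both linear in degree `t + 1`.
    have hc := hp.comp h.right_graded h.surjective hinj
    obtain ⟨a, b, hab⟩ := h.ker_comp hp.graded hp.surjective hc.graded fun _ => rfl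
    exact hp'.cokernel_same hab (hN.ker hc)

end Semisimple

/-! ### Linear resolutions -/

/-- The tail of the resolution, one degree higher, resolves the kernel of `ε`. This kernel is
generated in degree `t + 1`, hence zero in degree `t`, which makes `ε` a cover. -/
theorem isLinear_of_resolution {M : GrMod k R 𝒜} {P : ℕ → GrMod k R 𝒜} {t : ℤ}
    {d : ∀ n : ℕ, (P (n + 1)).carrier →ₗ[R] (P n).carrier} {ε : (P 0).carrier →ₗ[R] M.carrier}
    (hP : ∀ n, Module.Projective R (P n).carrier)
    (hgen : ∀ n : ℕ, (P n).GeneratedInDegree (t + n)) (hd : ∀ n, IsGradedHom (d n))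
    (hε : IsGradedHom ε) (hexact : ∀ n, Function.Exact (d (n + 1)) (d n))
    (hexact₀ : Function.Exact (d 0) ε) (hs : Function.Surjective ε) (n : ℕ) : IsLinear n t M := by
  induction n generalizing M P t with
  | zero => trivial
  | succ n ih =>
    let ε' := kerLift ε hε (d 0) hexact₀.apply_apply_eq_zero
    have hε' : IsGradedHom ε' := kerLift_graded _ _ _ _ (hd 0)
    have hs' : Function.Surjective ε' := by
      rintro ⟨x, hx⟩
      obtain ⟨y, hy⟩ := (hexact₀ x).1 hx
      exact ⟨y, Subtype.ext hy⟩
    have hgen' : ∀ n : ℕ, (P (n + 1)).GeneratedInDegree (t + 1 + n) := fun n => by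
      have := hgen (n + 1)
      rwa [Nat.cast_succ, add_comm (n : ℤ) 1, ← add_assoc] at this
    have hex : Function.Exact (d 1) ε' := fun x => by
      rw [← hexact 0 x]
      exact ⟨fun h => congrArg Subtype.val h, fun h => Subtype.ext h⟩
    have hgen0 : (P 0).GeneratedInDegree t := by simpa using hgen 0
    refine ⟨P 0, ε, ⟨hP 0, hgen0, hε, hs, fun x hx hx0 => ?_⟩,
      ih (P := fun n => P (n + 1)) (d := fun n => d (n + 1)) (fun n => hP (n + 1)) hgen'
        (fun n => hd (n + 1)) hε' (fun n => hexact (n + 1)) hex hs'⟩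
    have h1 : (P 1).GeneratedInDegree (t + 1) := by simpa using hgen 1
    exact congrArg Subtype.val ((h1.of_surjective hε' hs').eq_zero (lt_add_one t)
      (m := (⟨x, hx0⟩ : (GrMod.ker ε hε).carrier)) hx)

theorem isKoszul_iff {M : GrMod k R 𝒜} : M.IsKoszul ↔ ∀ n, IsLinear n 0 M := by
  constructor
  · rintro ⟨-, P, d, ε, hP, hgen, hd, hε, hex, hex₀, hs⟩ n
    exact isLinear_of_resolution hP (fun n => by simpa using hgen n) hd hε hex hex₀ hs n
  · intro h
    -- For each `n` the hypothesis may come with its own cover; independence of the cover makes a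
    -- single kernel linear to every order.
    have step : ∀ (t : ℤ) (M : GrMod k R 𝒜), (∀ n, IsLinear n t M) →
        ∃ (P : GrMod k R 𝒜) (f : P.carrier →ₗ[R] M.carrier) (hf : IsCover t f),
          ∀ n, IsLinear n (t + 1) (GrMod.ker f hf.graded) := by
      intro t M hM
      obtain ⟨P, f, hf, -⟩ := hM 1
      exact ⟨P, f, hf, fun n => (hM (n + 1)).ker hf⟩
    choose P f hf hker using step
    -- `X i` is the `i`-th syzygy, bundled with its linearity so that the next cover can be chosen.
    let X : ∀ i : ℕ, {M : GrMod k R 𝒜 // ∀ n, IsLinear n (i : ℤ) M} := fun i =>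
      Nat.rec ⟨M, by simpa using h⟩
        (fun i X => ⟨GrMod.ker (f i X.1 X.2) (hf i X.1 X.2).graded, by
          simpa using hker i X.1 X.2⟩) i
    let p : ∀ i : ℕ, (P i (X i).1 (X i).2).carrier →ₗ[R] (X i).1.carrier :=
      fun i => f i (X i).1 (X i).2
    have hp : ∀ i : ℕ, IsCover (i : ℤ) (p i) := fun i => hf i (X i).1 (X i).2
    let j : ∀ i : ℕ, (X (i + 1)).1.carrier →ₗ[R] (P i (X i).1 (X i).2).carrier :=
      fun i => kerι (p i) (hp i).graded
    have hj : ∀ i, IsGradedHom (j i) := fun i => kerι_graded (p i) (hp i).graded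
    have hji : ∀ i, Function.Injective (j i) := fun i => kerι_injective (p i) (hp i).graded
    have hjp : ∀ i, Function.Exact (j i) (p i) := fun i => exact_kerι (p i) (hp i).graded
    have hexact : ∀ i, Function.Exact (j i ∘ₗ p (i + 1)) (p i) := fun i x => by
      rw [hjp i x]
      exact ⟨fun ⟨y, hy⟩ => ((hp (i + 1)).surjective y).imp fun z hz => by
        rw [LinearMap.comp_apply, hz, hy], fun ⟨z, hz⟩ => ⟨_, hz⟩⟩
    refine ⟨(h 1).generatedInDegree, fun i => P i (X i).1 (X i).2, fun i => j i ∘ₗ p (i + 1), p 0,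
      fun i => (hp i).projective, fun i => (hp i).generated,
      fun i => (hj i).comp (hp (i + 1)).graded, (hp 0).graded, fun i x => ?_, hexact 0,
      (hp 0).surjective⟩
    rw [← hexact (i + 1) x, LinearMap.comp_apply]
    exact ⟨fun h => hji i (h.trans (map_zero _).symm), fun h => by rw [h, map_zero]⟩

end GrMod

end Linear

/-! ### Modules in one degree, and projectivity over the degree `0` part. -/

section Concentrated

variable {k : Type w} [Field k] {R : Type u} [Ring R] [Algebra k R] {𝒜 : ℕ → Submodule k R}
  [GradedAlgebra 𝒜]

namespace GrMod

/-! ### The degree zero module -/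

theorem degreeZero_deg_zero : (degreeZero 𝒜).deg 0 = ⊤ := concentratedInZero_zero _

variable (𝒜) in
/-- The projection from the regular module to its quotient by the elements of positive degree. -/
def toDegreeZero : (self 𝒜).carrier →ₗ[R] (degreeZero 𝒜).carrier :=
  Submodule.mkQ (HomogeneousIdeal.irrelevant 𝒜).toIdeal

theorem self_proj_zero (a : R) : (self 𝒜).proj 0 a = GradedRing.proj 𝒜 0 a := by
  induction a using GradedAlgebra.induction_homogeneous (𝒜 := 𝒜) with
  | homog i a ha =>
    rw [GradedRing.proj_apply]
    have ha' := (mem_self_deg (R := R) (𝒜 := 𝒜)).2 ha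
    by_cases hi : i = 0
    · subst hi
      rw [DirectSum.decompose_of_mem_same 𝒜 ha]
      exact (self 𝒜).proj_of_mem ha'
    · rw [DirectSum.decompose_of_mem_ne 𝒜 ha hi]
      exact (self 𝒜).proj_of_mem_ne (Ne.symm (Nat.cast_ne_zero.2 hi)) ha'
  | add a b ha hb =>
    exact (map_add ((self 𝒜).proj 0) a b).trans
      ((congrArg₂ (fun x y : R => x + y) ha hb).trans (map_add (GradedRing.proj 𝒜 0) a b).symm)

theorem toDegreeZero_eq_zero_iff {x : (self 𝒜).carrier} :
    toDegreeZero 𝒜 x = 0 ↔ (self 𝒜).proj 0 x = 0 := by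
  have h := self_proj_zero (𝒜 := 𝒜) x
  refine (Submodule.Quotient.mk_eq_zero _).trans
    ((HomogeneousIdeal.mem_irrelevant_iff 𝒜 _).trans ⟨h.trans, h.symm.trans⟩)

theorem toDegreeZero_isCover : IsCover 0 (toDegreeZero 𝒜) := by
  refine ⟨(inferInstance : Module.Projective R R), self_generatedInDegree, fun i x hx => ?_,
    Submodule.mkQ_surjective (HomogeneousIdeal.irrelevant 𝒜).toIdeal, fun x hx hx0 => ?_⟩
  · by_cases hi : i = 0
    · rw [hi, degreeZero_deg_zero]
      trivial
    · rw [toDegreeZero_eq_zero_iff.2 ((self 𝒜).proj_of_mem_ne (Ne.symm hi) hx)]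
      exact zero_mem _
  · rw [← (self 𝒜).proj_of_mem hx]
    exact toDegreeZero_eq_zero_iff.1 hx0

/-! ### Modules concentrated in one degree -/

theorem eq_zero_of_deg_eq_top {M : GrMod k R 𝒜} {t i : ℤ} (hM : M.deg t = ⊤) (hi : i ≠ t)
    {m : M.carrier} (hm : m ∈ M.deg i) : m = 0 :=
  M.eq_zero_of_mem_of_mem hi hm (by rw [hM]; trivial)

theorem smul_eq_zero_of_deg_eq_top {M : GrMod k R 𝒜} {t : ℤ} (hM : M.deg t = ⊤) {i : ℕ}
    (hi : 0 < i) {a : R} (ha : a ∈ 𝒜 i) (m : M.carrier) : a • m = 0 :=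
  eq_zero_of_deg_eq_top (i := i + t) hM (by omega)
    (M.smul_mem ha (by rw [hM]; trivial))

theorem isGradedHom_of_deg_eq_top {M N : GrMod k R 𝒜} {t : ℤ} (hM : M.deg t = ⊤)
    (hN : N.deg t = ⊤) (f : M.carrier →ₗ[R] N.carrier) : IsGradedHom f := by
  intro i m hm
  by_cases hi : i = t
  · rw [hi, hN]
    trivial
  · rw [eq_zero_of_deg_eq_top hM hi hm, map_zero]
    exact zero_mem _

/-- Elements of positive degree act as zero on both modules, so only linearity over the degree `0`
part is at stake. -/
theorem exists_linearMap_of_deg_eq_top {M N : GrMod k R 𝒜} {t : ℤ} (hM : M.deg t = ⊤)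
    (hN : N.deg t = ⊤) (f : M.carrier →ₗ[degZeroAlg 𝒜] N.carrier) :
    ∃ g : M.carrier →ₗ[R] N.carrier, ∀ m, g m = f m := by
  refine ⟨{ f with map_smul' := fun a m => ?_ }, fun _ => rfl⟩
  change f (a • m) = a • f m
  induction a using GradedAlgebra.induction_homogeneous (𝒜 := 𝒜) with
  | homog i a ha =>
    rcases Nat.eq_zero_or_pos i with rfl | hi
    · exact f.map_smul ⟨a, ha⟩ m
    · rw [smul_eq_zero_of_deg_eq_top hM hi ha, smul_eq_zero_of_deg_eq_top hN hi ha, map_zero]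
  | add a b ha hb => rw [add_smul, map_add, ha, hb, add_smul]

theorem IsLinear.shift {n : ℕ} {t : ℤ} {M : GrMod k R 𝒜} (h : IsLinear n t M) (s : ℤ) :
    IsLinear n (t + s) (M.shift s) := by
  induction n generalizing t M with
  | zero => trivial
  | succ n ih =>
    obtain ⟨P, f, hf, hP⟩ := h
    have hg : IsGradedHom (M := P.shift s) (N := M.shift s) f := fun i x hx => hf.graded _ x hx
    refine ⟨P.shift s, f, ⟨hf.projective, hf.generated.shift s, hg, hf.surjective,
      fun x hx => hf.injective x ?_⟩, ?_⟩
    · have hx' : x ∈ P.deg (t + s - s) := hx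
      rwa [add_sub_cancel_right] at hx'
    · have := ih hP
      rw [add_right_comm] at this
      exact this.of_bijective (X := GrMod.ker (M := P.shift s) (N := M.shift s) f hg)
        (i := (LinearMap.id : LinearMap.ker f →ₗ[R] LinearMap.ker f)) (fun i x hx => hx)
        Function.bijective_id

/-- If the degree zero module is linear then so is any finite dimensional module that is
concentrated in one degree. -/
theorem IsLinear.of_concentrated {n : ℕ} (h : IsLinear n 0 (degreeZero 𝒜)) {t : ℤ}
    {M : GrMod k R 𝒜} (hM : M.deg t = ⊤) [FiniteDimensional k M.carrier]
    [Module.Projective (degZeroAlg 𝒜) M.carrier] : IsLinear n t M := by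
  classical
  -- A finite direct sum of shifted copies of `R_0` is built one generator at a time, so that
  -- linearity follows from closure under extensions.
  have key : ∀ s : Finset M.carrier, ∃ (X : GrMod k R 𝒜) (g : X.carrier →ₗ[R] M.carrier),
      X.deg t = ⊤ ∧ IsLinear n t X ∧ ∀ x ∈ s, x ∈ LinearMap.range g := by
    intro s
    induction s using Finset.induction_on with
    | empty =>
      have : Subsingleton (M.sub ⊥ fun i m hm => by
          rw [(Submodule.mem_bot R).1 hm, map_zero]; exact zero_mem _).carrier :=
        inferInstanceAs (Subsingleton (⊥ : Submodule R M.carrier))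
      exact ⟨_, 0, (Submodule.subsingleton_iff k).2 this |>.elim _ _, .of_subsingleton n t _, by simp⟩
    | insert v s _ ih =>
      obtain ⟨X, g, hX, hXl, hg⟩ := ih
      have hle : (HomogeneousIdeal.irrelevant 𝒜).toIdeal ≤
          LinearMap.ker (LinearMap.toSpanSingleton R M.carrier v) := by
        intro a ha
        have ha' : GradedRing.proj 𝒜 0 a = 0 := (HomogeneousIdeal.mem_irrelevant_iff 𝒜 a).1 ha
        rw [LinearMap.mem_ker, LinearMap.toSpanSingleton_apply]
        rw [← DirectSum.sum_support_decompose 𝒜 a, Finset.sum_smul]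
        refine Finset.sum_eq_zero fun i _ => ?_
        rcases Nat.eq_zero_or_pos i with rfl | hi
        · rw [← GradedRing.proj_apply, ha', zero_smul]
        · exact smul_eq_zero_of_deg_eq_top hM hi (DirectSum.decompose 𝒜 a i).2 v
      let Y := (degreeZero 𝒜).shift t
      let l : Y.carrier →ₗ[R] M.carrier := Submodule.liftQ _ _ hle
      have hl : ∀ a : R, l (Submodule.Quotient.mk a) = a • v := fun a => rfl
      have hY : Y.deg t = ⊤ := by
        change (degreeZero 𝒜).deg (t - t) = ⊤
        rw [sub_self, degreeZero_deg_zero]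
      have hYl : IsLinear n t Y := by simpa using h.shift t
      refine ⟨Y.prod X, l ∘ₗ fst Y X + g ∘ₗ snd Y X, ?_, ?_, fun x hx => ?_⟩
      · change (Y.deg t).prod (X.deg t) = ⊤
        rw [hY, hX, Submodule.prod_top]
      · exact hYl.extension (f := inl Y X) (g := snd Y X) ⟨inl_graded Y X, snd_graded Y X,
          LinearMap.inl_injective, .inl_snd, Prod.snd_surjective⟩ hXl
      · rcases Finset.mem_insert.1 hx with rfl | hx
        · let y : Y.carrier := Submodule.Quotient.mk (1 : R)
          refine ⟨inl Y X y, ?_⟩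
          rw [LinearMap.add_apply, LinearMap.comp_apply, LinearMap.comp_apply, fst_inl, snd_inl,
            map_zero, add_zero]
          exact (hl 1).trans (one_smul R x)
        · obtain ⟨y, hy⟩ := hg x hx
          refine ⟨inr Y X y, ?_⟩
          rw [LinearMap.add_apply, LinearMap.comp_apply, LinearMap.comp_apply, fst_inr, snd_inr,
            map_zero, zero_add, hy]
  obtain ⟨s, hs⟩ := Module.Finite.fg_top (R := k) (M := M.carrier)
  obtain ⟨X, g, hX, hXl, hg⟩ := key s
  have hgs : Function.Surjective g := by
    have : Submodule.span k (s : Set M.carrier) ≤ (LinearMap.range g).restrictScalars k :=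
      Submodule.span_le.2 hg
    intro x
    exact this (hs ▸ Submodule.mem_top)
  -- `M` is projective over `R_0`, so the surjection splits over `R_0`; a splitting is automatically
  -- `R`-linear between modules concentrated in one degree, and `M` is a retract of a linear module.
  obtain ⟨σ, hσ⟩ := Module.projective_lifting_property (g.restrictScalars (degZeroAlg 𝒜))
    LinearMap.id hgs
  obtain ⟨τ, hτ⟩ := exists_linearMap_of_deg_eq_top hM hX σ
  exact hXl.of_retract (isGradedHom_of_deg_eq_top hM hX τ) (isGradedHom_of_deg_eq_top hX hM g)
    fun x => by rw [hτ]; exact LinearMap.congr_fun hσ x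

/-! ### Finite dimensionality and projectivity over the degree zero subalgebra -/

/-- A module generated by a finite dimensional component is finite dimensional. -/
theorem GeneratedInDegree.finiteDimensional [FiniteDimensional k R] {P : GrMod k R 𝒜}
    {t : ℤ} (hP : P.GeneratedInDegree t) (h : FiniteDimensional k (P.deg t)) :
    FiniteDimensional k P.carrier := by
  obtain ⟨s, hs⟩ := (P.deg t).fg_iff_finiteDimensional.2 h
  have hfg : Module.Finite R P.carrier := by
    refine ⟨⟨s, eq_top_iff.2 ?_⟩⟩
    rw [← hP, Submodule.span_le, ← hs]
    exact Submodule.span_subset_span k R _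
  exact Module.Finite.trans R P.carrier

theorem IsCover.finiteDimensional [FiniteDimensional k R] {P M : GrMod k R 𝒜} {t : ℤ}
    {f : P.carrier →ₗ[R] M.carrier} (hf : IsCover t f) [FiniteDimensional k M.carrier] :
    FiniteDimensional k P.carrier := by
  refine hf.generated.finiteDimensional (FiniteDimensional.of_injective
      ((f.restrictScalars k).restrict (p := P.deg t) (q := M.deg t) (hf.graded t)) ?_)
  rw [← LinearMap.ker_eq_bot, LinearMap.ker_eq_bot']
  exact fun x hx => Subtype.ext (hf.injective x x.2 (congrArg Subtype.val hx))

theorem finiteDimensional_ker {M N : GrMod k R 𝒜} {f : M.carrier →ₗ[R] N.carrier}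
    (hf : IsGradedHom f) [FiniteDimensional k M.carrier] :
    FiniteDimensional k (GrMod.ker f hf).carrier :=
  FiniteDimensional.of_injective ((kerι f hf).restrictScalars k) (kerι_injective f hf)

theorem degMap_injective {M N : GrMod k R 𝒜} {f : M.carrier →ₗ[R] N.carrier}
    (hf : IsGradedHom f) (hi : Function.Injective f) (i : ℤ) :
    Function.Injective (degMap hf i) := fun x y hxy => by
  have h : f x = f y := congrArg Subtype.val hxy
  exact Subtype.ext (hi h)

theorem finite_degSub (M : GrMod k R 𝒜) [FiniteDimensional k M.carrier] (i : ℤ) :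
    Module.Finite (degZeroAlg 𝒜) (M.degSub i) := by
  have : Module.Finite (degZeroAlg 𝒜) M.carrier :=
    Module.Finite.of_restrictScalars_finite k _ _
  exact Module.Finite.of_surjective (M.projZ i) fun m =>
    ⟨m, LinearMap.congr_fun (M.projZ_comp_subtype i) m⟩

theorem _root_.SplitsProjectives.projective {B : Type u} [Ring B] (hB : SplitsProjectives B)
    {P Q N : Type u} [AddCommGroup P] [AddCommGroup Q] [AddCommGroup N]
    [Module B P] [Module B Q] [Module B N] [Module.Finite B P] [Module.Finite B Q]
    [Module.Projective B P] [Module.Projective B Q] {f : P →ₗ[B] Q} {g : Q →ₗ[B] N}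
    (hf : Function.Injective f) (hfg : Function.Exact f g) (hg : Function.Surjective g) :
    Module.Projective B N := by
  obtain ⟨s, hs⟩ := hB P Q N f g hf hfg hg
  exact .of_split s g hs

/-- In degree `m + t`, `M` is the quotient of its cover by the syzygy. The latter starts in degree
`t + 1`, so induction on `m` applies to it, and the splitting condition makes the quotient
projective. Only the components `R_j` with `j ≤ m` enter, which allows a bootstrap for `R` itself.
-/
theorem IsLinear.projective_degSub [FiniteDimensional k R]
    (hS : SplitsProjectives (degZeroAlg 𝒜)) {m : ℕ}
    (hm : ∀ j ≤ m, Module.Projective (degZeroAlg 𝒜) ((self 𝒜).degSub j)) {t : ℤ}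
    {M : GrMod k R 𝒜} [FiniteDimensional k M.carrier] (h : IsLinear (m + 1) t M) :
    Module.Projective (degZeroAlg 𝒜) (M.degSub (m + t)) := by
  induction m generalizing t M with
  | zero =>
    obtain ⟨P, f, hf, -⟩ := h
    rw [Nat.cast_zero, zero_add]
    exact hf.projective_degSub
  | succ m ih =>
    obtain ⟨P, f, hf, hP⟩ := h
    have := hf.finiteDimensional
    have := finiteDimensional_ker hf.graded
    have h1 := ih (fun j hj => hm j (by omega)) hP
    have h2 := projective_degSub_add hf.projective hf.generated ((m + 1 : ℕ) : ℤ) (hm _ le_rfl)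
    rw [show (m : ℤ) + (t + 1) = ((m + 1 : ℕ) : ℤ) + t by push_cast; ring] at h1
    have := finite_degSub P ((m + 1 : ℕ) + t)
    have := finite_degSub (GrMod.ker f hf.graded) ((m + 1 : ℕ) + t)
    refine hS.projective (f := degMap (kerι_graded f hf.graded) _) (g := degMap hf.graded _)
      (degMap_injective _ (kerι_injective _ _) _)
      (fun x => ⟨fun hx => ?_, ?_⟩) (fun y => ?_)
    · exact ⟨⟨⟨x, congrArg Subtype.val hx⟩, x.2⟩, rfl⟩
    · rintro ⟨y, rfl⟩
      exact Subtype.ext (apply_kerι f hf.graded y)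
    · obtain ⟨x, hx, hxy⟩ := hf.graded.exists_homogeneous_preimage y.2 (hf.surjective y)
      exact ⟨⟨x, hx⟩, Subtype.ext hxy⟩

theorem projective_of_isLinear [FiniteDimensional k R] (hS : SplitsProjectives (degZeroAlg 𝒜))
    (hR : ∀ j : ℕ, Module.Projective (degZeroAlg 𝒜) ((self 𝒜).degSub j)) {t : ℤ}
    {M : GrMod k R 𝒜} [FiniteDimensional k M.carrier] (h : ∀ n, IsLinear n t M) :
    Module.Projective (degZeroAlg 𝒜) M.carrier := by
  refine M.projective_of_degSub fun i => ?_
  rcases lt_or_ge i t with hi | hi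
  · have : Subsingleton (M.degSub i) := ⟨fun x y => Subtype.ext <| by
      rw [(h 1).generatedInDegree.eq_zero hi x.2, (h 1).generatedInDegree.eq_zero hi y.2]⟩
    infer_instance
  · obtain ⟨m, hm⟩ := Int.eq_ofNat_of_zero_le (sub_nonneg.2 hi)
    rw [show i = m + t by omega]
    exact (h (m + 1)).projective_degSub hS fun j _ => hR j

/-- The homogeneous components of a Koszul algebra are projective over the degree `0` subalgebra. -/
theorem projective_self_degSub_of_isLinear [FiniteDimensional k R]
    (hS : SplitsProjectives (degZeroAlg 𝒜)) (h : ∀ n, IsLinear n 0 (degreeZero 𝒜)) (j : ℕ) :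
    Module.Projective (degZeroAlg 𝒜) ((self 𝒜).degSub j) := by
  induction j using Nat.strong_induction_on with
  | _ j ih =>
    rcases j with - | j
    · exact projective_self_degSub_zero
    -- `R_{j+1}` is a component of the positive part of `R`, the first syzygy of `R_0`, which is
    -- linear in degree `1`. Its projectivity therefore involves only `R_0, …, R_j`.
    · have hl := (h (j + 2)).ker toDegreeZero_isCover
      have hg := toDegreeZero_isCover.graded (𝒜 := 𝒜)
      have : FiniteDimensional k (self 𝒜).carrier := ‹FiniteDimensional k R›
      have := finiteDimensional_ker hg
      have hp := hl.projective_degSub hS fun i hi => ih i (by omega)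
      rw [show (j : ℤ) + (0 + 1) = (j + 1 : ℕ) by push_cast; ring] at hp
      refine Module.Projective.of_equiv (LinearEquiv.ofBijective
        (degMap (kerι_graded (toDegreeZero 𝒜) hg) _) ⟨degMap_injective _ (kerι_injective _ _) _,
          fun y => ?_⟩)
      exact ⟨⟨⟨y, eq_zero_of_deg_eq_top degreeZero_deg_zero (i := (j + 1 : ℕ)) (by omega)
        (hg _ _ y.2)⟩, y.2⟩, rfl⟩

theorem projective_of_projective_self_degSub
    (h : ∀ j : ℕ, Module.Projective (degZeroAlg 𝒜) ((self 𝒜).degSub j)) :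
    Module.Projective (degZeroAlg 𝒜) (self 𝒜).carrier := by
  refine (self 𝒜).projective_of_degSub fun i => ?_
  rcases lt_or_ge i 0 with hi | hi
  · have : Subsingleton ((self 𝒜).degSub i) := ⟨fun x y => Subtype.ext <| by
      rw [self_generatedInDegree.eq_zero hi x.2, self_generatedInDegree.eq_zero hi y.2]⟩
    infer_instance
  · lift i to ℕ using hi
    exact h i

end GrMod

end Concentrated

/-! ### Transfer of linearity between an algebra and a subalgebra with the same positive part. -/

section Restriction

variable {k : Type w} [Field k] {R : Type u} [Ring R] [Algebra k R] {𝒜 : ℕ → Submodule k R}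
  [GradedAlgebra 𝒜] {S : Subalgebra k R}

namespace GrMod

/-- The inclusion of a subalgebra, linear over the subalgebra. -/
def subalgebraIncl (S : Subalgebra k R) : S →ₗ[S] R where
  toFun := Subtype.val
  map_add' _ _ := rfl
  map_smul' _ _ := rfl

/-- Restriction of a homomorphism to a subalgebra. -/
def restrictMap (S : Subalgebra k R) {M N : GrMod k R 𝒜} (f : M.carrier →ₗ[R] N.carrier) :
    (M.restrict S).carrier →ₗ[S] (N.restrict S).carrier where
  toFun := f
  map_add' := f.map_add
  map_smul' a m := f.map_smul (a : R) m

theorem ShortExact.restrict {L M N : GrMod k R 𝒜} {f : L.carrier →ₗ[R] M.carrier}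
    {g : M.carrier →ₗ[R] N.carrier} (h : ShortExact f g) :
    ShortExact (restrictMap S f) (restrictMap S g) :=
  ⟨h.left_graded, h.right_graded, h.injective, h.exact, h.surjective⟩

theorem GeneratedInDegree.of_restrict {M : GrMod k R 𝒜} {t : ℤ}
    (h : (M.restrict S).GeneratedInDegree t) : M.GeneratedInDegree t := by
  rw [GeneratedInDegree, eq_top_iff]
  intro m _
  have hm : m ∈ Submodule.span S (M.deg t : Set M.carrier) := by
    change m ∈ Submodule.span S ((M.restrict S).deg t : Set (M.restrict S).carrier)
    rw [h]
    trivial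
  exact Submodule.span_subset_span S R _ hm

/-- This makes `R / S` a left `S`-module on which elements of positive degree act as zero. -/
theorem mul_mem_of_pos (hS : ∀ n, 0 < n → 𝒜 n ≤ Subalgebra.toSubmodule S) {i : ℕ} (hi : 0 < i)
    {a : R} (ha : a ∈ 𝒜 i) (r : R) : a * r ∈ S := by
  induction r using GradedAlgebra.induction_homogeneous (𝒜 := 𝒜) with
  | homog j r hr => exact hS (i + j) (by omega) (SetLike.GradedMul.mul_mem ha hr)
  | add r s hr hs => rw [mul_add]; exact add_mem hr hs

theorem mem_of_proj_zero (hS : ∀ n, 0 < n → 𝒜 n ≤ Subalgebra.toSubmodule S) {a : R}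
    (ha : (self 𝒜).proj 0 a = 0) : a ∈ S := by
  refine (self 𝒜).mem_of_forall_proj_mem (Subalgebra.toSubmodule S).toAddSubgroup fun i => ?_
  rcases lt_trichotomy i 0 with hi | rfl | hi
  · have h := (self 𝒜).proj_mem i a
    rw [self_deg_neg hi] at h
    rw [(Submodule.mem_bot k).1 h]
    exact zero_mem S
  · rw [ha]
    exact zero_mem S
  · lift i to ℕ using hi.le
    exact hS i (by omega) (mem_self_deg.1 ((self 𝒜).proj_mem i a))

/-- The grading of a subalgebra induced from the grading of the algebra. -/
abbrev inducedDeg (𝒜 : ℕ → Submodule k R) (S : Subalgebra k R) : ℕ → Submodule k S :=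
  fun n => (𝒜 n).comap S.val.toLinearMap

variable [GradedAlgebra (inducedDeg 𝒜 S)]

theorem mem_self_restrict_deg {i : ℤ} {b : S} :
    b ∈ (self (inducedDeg 𝒜 S)).deg i ↔ (b : R) ∈ (self 𝒜).deg i := by
  rcases lt_or_ge i 0 with hi | hi
  · rw [self_deg_neg hi, self_deg_neg hi]
    have h : b ∈ (⊥ : Submodule k S) ↔ (b : R) ∈ (⊥ : Submodule k R) := by simp
    exact h
  · lift i to ℕ using hi
    exact (mem_self_deg (𝒜 := inducedDeg 𝒜 S) (a := b)).trans
      (mem_self_deg (𝒜 := 𝒜) (a := (b : R))).symm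

/-- The inclusion of the regular module of a subalgebra. -/
def selfIncl (𝒜 : ℕ → Submodule k R) [GradedAlgebra 𝒜] (S : Subalgebra k R)
    [GradedAlgebra (inducedDeg 𝒜 S)] :
    (self (inducedDeg 𝒜 S)).carrier →ₗ[S] ((self 𝒜).restrict S).carrier := subalgebraIncl S

theorem selfIncl_graded : IsGradedHom (selfIncl 𝒜 S) := fun _ b hb =>
  mem_self_restrict_deg (𝒜 := 𝒜) (S := S) (b := b).1 hb

/-- A free `R`-module is an extension of a direct sum of copies of `R / S` by a free `S`-module. The
former is concentrated in degree `t`, hence linear, because the degree `0` part of `S` is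
semisimple. -/
theorem IsLinear.restrict_free {n : ℕ} (hS : ∀ n, 0 < n → 𝒜 n ≤ Subalgebra.toSubmodule S)
    [IsSemisimpleRing (degZeroAlg (inducedDeg 𝒜 S))] [FiniteDimensional k R]
    (h0 : IsLinear n 0 (degreeZero (inducedDeg 𝒜 S))) (ι : Type u) [Finite ι] (t : ℤ) :
    IsLinear n t ((free 𝒜 ι t).restrict S) := by
  classical
  let f : (ι →₀ S) →ₗ[S] (ι →₀ R) := Finsupp.mapRange.linearMap (subalgebraIncl S)
  have hrange : ∀ y : ι →₀ R, (∀ z, y z ∈ S) → y ∈ LinearMap.range f := by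
    intro y hy
    refine ⟨Finsupp.mapRange (fun r : R => if h : r ∈ S then (⟨r, h⟩ : S) else 0)
      (by split_ifs <;> rfl) y, Finsupp.ext fun z => ?_⟩
    change ((if h : _ then _ else _ : S) : R) = _
    rw [dif_pos (hy z)]
  have hinj : Function.Injective f := Finsupp.mapRange_injective _ rfl Subtype.val_injective
  have hexact : Function.Exact f (Submodule.mkQ (LinearMap.range f)) :=
    LinearMap.exact_iff.2 (Submodule.ker_mkQ _)
  have hsurj := Submodule.mkQ_surjective (LinearMap.range f)
  let N : GrMod k S (inducedDeg 𝒜 S) := concentrated ((ι →₀ R) ⧸ LinearMap.range f) t (by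
    intro i hi a ha v
    obtain ⟨y, rfl⟩ := Submodule.Quotient.mk_surjective _ v
    rw [← Submodule.Quotient.mk_smul, Submodule.Quotient.mk_eq_zero]
    exact hrange _ fun z => mul_mem_of_pos hS hi ha (y z))
  have hN : N.deg t = ⊤ := if_pos rfl
  have : FiniteDimensional k N.carrier :=
    inferInstanceAs (FiniteDimensional k ((ι →₀ R) ⧸ LinearMap.range f))
  have := Module.projective_of_isSemisimpleRing (degZeroAlg (inducedDeg 𝒜 S)) N.carrier
  have hNl : IsLinear n t N := h0.of_concentrated hN
  let g : ((free 𝒜 ι t).restrict S).carrier →ₗ[S] N.carrier := Submodule.mkQ (LinearMap.range f)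
  refine IsLinear.extension (L := free (inducedDeg 𝒜 S) ι t) (f := f) (g := g) ⟨fun i x hx z => ?_,
    fun i x hx => ?_, hinj, hexact, hsurj⟩
    (.of_projective inferInstance (free_generatedInDegree ι t) n) hNl
  · exact mem_self_restrict_deg (𝒜 := 𝒜) (S := S) (b := (show ι →₀ S from x) z).1 (hx z)
  · by_cases hi : i = t
    · rw [hi, hN]
      trivial
    · have : g x = 0 := by
        refine (Submodule.Quotient.mk_eq_zero _).2 (hrange x fun z => ?_)
        exact mem_of_proj_zero hS ((self 𝒜).proj_of_mem_ne (by omega) (hx z))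
      rw [this]
      exact zero_mem _

theorem IsLinear.restrict_projective {n : ℕ}
    (hS : ∀ n, 0 < n → 𝒜 n ≤ Subalgebra.toSubmodule S) [IsSemisimpleRing (degZeroAlg (inducedDeg 𝒜 S))]
    [FiniteDimensional k R] (h0 : IsLinear n 0 (degreeZero (inducedDeg 𝒜 S))) {P : GrMod k R 𝒜}
    (hP : Module.Projective R P.carrier) {t : ℤ} (hgen : P.GeneratedInDegree t)
    [FiniteDimensional k P.carrier] : IsLinear n t (P.restrict S) := by
  obtain ⟨s, hs⟩ := (P.deg t).fg_iff_finiteDimensional.2 inferInstance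
  obtain ⟨i, r, hi, hr, hir⟩ := exists_free_retract hP (t := t) (fun z : s => (z : P.carrier))
    (fun z => hs ▸ Submodule.subset_span z.2) (by
      have hrange : Set.range (fun z : s => (z : P.carrier)) = s := Subtype.range_coe
      rw [hrange, eq_top_iff, ← hgen, Submodule.span_le, ← hs]
      exact Submodule.span_subset_span k R _)
  exact (IsLinear.restrict_free hS h0 s t).of_retract (X := P.restrict S) (i := restrictMap S i)
    (r := restrictMap S r) hi hr hir

/-- A linear module over `R` is linear over a subalgebra with the same components of positive
degree. -/
theorem IsLinear.restrict {n : ℕ} (hS : ∀ n, 0 < n → 𝒜 n ≤ Subalgebra.toSubmodule S)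
    [IsSemisimpleRing (degZeroAlg (inducedDeg 𝒜 S))] [FiniteDimensional k R]
    (h0 : IsLinear n 0 (degreeZero (inducedDeg 𝒜 S))) {t : ℤ} {M : GrMod k R 𝒜} [FiniteDimensional k M.carrier]
    (h : IsLinear n t M) : IsLinear n t (M.restrict S) := by
  induction n generalizing t M with
  | zero => trivial
  | succ n ih =>
    obtain ⟨P, f, hf, hP⟩ := h
    have := hf.finiteDimensional
    have := finiteDimensional_ker hf.graded
    -- Over `S` the cover need not be projective, but it is linear in degree `t`; the syzygy is
    -- linear in degree `t + 1` by induction, and `M` is the cokernel.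
    exact IsLinear.cokernel (ShortExact.ker hf.graded hf.surjective).restrict
      (ih h0.of_succ hP) (IsLinear.restrict_projective hS h0 hf.projective hf.generated)
      hf.injective

/-- The common positive part of `R` and `S` is the first syzygy of `R_0` over `R` and of `S_0` over
`S`. Restricting it to order `n` needs `S_0` linear only to order `n`, and gives `S_0` linear to
order `n + 1`. -/
theorem isLinear_degreeZero_restrict (hS : ∀ n, 0 < n → 𝒜 n ≤ Subalgebra.toSubmodule S)
    [IsSemisimpleRing (degZeroAlg (inducedDeg 𝒜 S))] [FiniteDimensional k R]
    (h : ∀ n, IsLinear n 0 (degreeZero 𝒜)) (n : ℕ) : IsLinear n 0 (degreeZero (inducedDeg 𝒜 S)) := by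
  induction n with
  | zero => trivial
  | succ n ih =>
    refine ⟨self (inducedDeg 𝒜 S), toDegreeZero (inducedDeg 𝒜 S), toDegreeZero_isCover, ?_⟩
    have hA := (toDegreeZero_isCover (𝒜 := 𝒜)).graded
    have hB := (toDegreeZero_isCover (𝒜 := (inducedDeg 𝒜 S))).graded
    have : FiniteDimensional k (self 𝒜).carrier := ‹FiniteDimensional k R›
    have := finiteDimensional_ker hA
    have key := IsLinear.restrict hS ih ((h (n + 1)).ker toDegreeZero_isCover)
    have hincl : ∀ x, (self 𝒜).proj 0 (selfIncl 𝒜 S x) = selfIncl 𝒜 S ((self (inducedDeg 𝒜 S)).proj 0 x) :=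
      fun x => ((selfIncl_graded (𝒜 := 𝒜) (S := S)).proj_comm 0 x).symm
    have hinj : Function.Injective (selfIncl 𝒜 S) := Subtype.val_injective
    let i : (ker (toDegreeZero (inducedDeg 𝒜 S)) hB).carrier →ₗ[S]
        ((ker (toDegreeZero 𝒜) hA).restrict S).carrier :=
      { toFun := fun x => ⟨selfIncl 𝒜 S (kerι _ hB x), toDegreeZero_eq_zero_iff.2 (by
          rw [hincl, toDegreeZero_eq_zero_iff.1 (apply_kerι _ hB x), map_zero]; rfl)⟩
        map_add' := fun _ _ => rfl
        map_smul' := fun _ _ => rfl }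
    refine key.of_bijective (i := i) (fun j x hx =>
        mem_self_restrict_deg (𝒜 := 𝒜) (S := S) (b := kerι _ hB x).1 hx)
      ⟨fun x y hxy => ?_, ?_⟩
    · exact kerι_injective _ hB (hinj (congrArg (kerι _ hA) hxy))
    · rintro ⟨y, hy⟩
      have hy0 := toDegreeZero_eq_zero_iff.1 hy
      let b : (self (inducedDeg 𝒜 S)).carrier := (⟨y, mem_of_proj_zero hS hy0⟩ : S)
      have hb : selfIncl 𝒜 S b = y := rfl
      refine ⟨⟨b, toDegreeZero_eq_zero_iff.2 (hinj ?_)⟩, rfl⟩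
      rw [← hincl, hb, hy0, map_zero]
      rfl

theorem projective_degZeroAlg_of_projective [Module.Projective (degZeroAlg 𝒜) (self 𝒜).carrier]
    {P : Type u} [AddCommGroup P] [Module R P] (hP : Module.Projective R P) :
    Module.Projective (degZeroAlg 𝒜) P := by
  classical
  obtain ⟨s, hs⟩ := Module.projective_def'.1 hP
  have : Module.Projective (degZeroAlg 𝒜) R :=
    ‹Module.Projective (degZeroAlg 𝒜) (self 𝒜).carrier›
  have : Module.Projective (degZeroAlg 𝒜) (P →₀ R) :=
    Module.Projective.of_equiv (finsuppLequivDFinsupp (degZeroAlg 𝒜)).symm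
  exact Module.Projective.of_split (s.restrictScalars (degZeroAlg 𝒜))
    ((Finsupp.linearCombination R id).restrictScalars (degZeroAlg 𝒜))
    (LinearMap.ext fun x => LinearMap.congr_fun hs x)

theorem _root_.Module.Projective.ker {B M N : Type*} [Ring B] [AddCommGroup M] [AddCommGroup N]
    [Module B M] [Module B N] [Module.Projective B M] [Module.Projective B N] {f : M →ₗ[B] N}
    (hf : Function.Surjective f) : Module.Projective B (LinearMap.ker f) := by
  obtain ⟨σ, hσ⟩ := Module.projective_lifting_property f LinearMap.id hf
  have hσ' : ∀ x, f (σ x) = x := LinearMap.congr_fun hσ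
  refine Module.Projective.of_split (LinearMap.ker f).subtype
    ((LinearMap.id - σ ∘ₗ f).codRestrict (LinearMap.ker f) fun x => by simp [hσ'])
    (LinearMap.ext fun x => Subtype.ext ?_)
  have hx : f x = 0 := x.2
  simp [hx]

/-- A module that is projective over the degree `0` subalgebra is linear over `R` if it is linear
over a subalgebra with the same components of positive degree. -/
theorem isLinear_of_restrict (hS : ∀ n, 0 < n → 𝒜 n ≤ Subalgebra.toSubmodule S)
    [IsSemisimpleRing (degZeroAlg (inducedDeg 𝒜 S))] [FiniteDimensional k R]
    [Module.Projective (degZeroAlg 𝒜) (self 𝒜).carrier]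
    (h0 : ∀ n, IsLinear n 0 (degreeZero (inducedDeg 𝒜 S))) {t : ℤ} {M : GrMod k R 𝒜}
    [FiniteDimensional k M.carrier] [Module.Projective (degZeroAlg 𝒜) M.carrier]
    (h : ∀ n, IsLinear n t (M.restrict S)) (n : ℕ) : IsLinear n t M := by
  induction n generalizing t M with
  | zero => trivial
  | succ n ih =>
    have := M.projective_degSub t
    obtain ⟨P, f, hf⟩ := exists_isCover (h 1).generatedInDegree.of_restrict
    have := hf.finiteDimensional
    have := finiteDimensional_ker hf.graded
    have := projective_degZeroAlg_of_projective (𝒜 := 𝒜) hf.projective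
    have : Module.Projective (degZeroAlg 𝒜) (ker f hf.graded).carrier :=
      Module.Projective.ker (f := f.restrictScalars (degZeroAlg 𝒜)) hf.surjective
    -- The syzygy is projective over `R_0` as the kernel of a surjection between projectives, so the
    -- induction hypothesis applies once it is linear over `S`. There it is the kernel of a
    -- surjection between linear modules that is bijective in degree `t`.
    refine ⟨P, f, hf, ih fun m => ?_⟩
    exact IsLinear.kernel (ShortExact.ker hf.graded hf.surjective).restrict
      (IsLinear.restrict_projective hS (h0 m) hf.projective hf.generated) (h (m + 1)) hf.injective

end GrMod

end Restriction

/-! ### Ascent of the Koszul property. -/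

section KoszulTransfer

variable {k : Type w} [Field k] {R : Type u} [Ring R] [Algebra k R] {𝒜 : ℕ → Submodule k R}
  [GradedAlgebra 𝒜] {S : Subalgebra k R} [GradedAlgebra (GrMod.inducedDeg 𝒜 S)]

namespace GrMod

/-- The Koszul property ascends from a subalgebra with the same components of positive degree. -/
theorem isLinear_degreeZero_of_restrict
    (hS : ∀ n, 0 < n → 𝒜 n ≤ Subalgebra.toSubmodule S)
    [IsSemisimpleRing (degZeroAlg (inducedDeg 𝒜 S))] [FiniteDimensional k R]
    [Module.Projective (degZeroAlg 𝒜) (self 𝒜).carrier]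
    (h0 : ∀ n, IsLinear n 0 (degreeZero (inducedDeg 𝒜 S))) (n : ℕ) :
    IsLinear n 0 (degreeZero 𝒜) := by
  have htop : (degreeZero 𝒜).degSub 0 = ⊤ :=
    eq_top_iff.2 fun x _ => by rw [mem_degSub, degreeZero_deg_zero]; trivial
  have h1 := (toDegreeZero_isCover (𝒜 := 𝒜)).projective_degSub
  have : Module.Projective (degZeroAlg 𝒜) (degreeZero 𝒜).carrier :=
    Module.Projective.of_equiv (LinearEquiv.ofTop _ htop)
  have : FiniteDimensional k (degreeZero 𝒜).carrier :=
    inferInstanceAs (FiniteDimensional k (R ⧸ (HomogeneousIdeal.irrelevant 𝒜).toIdeal))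
  have : FiniteDimensional k ((degreeZero 𝒜).restrict S).carrier :=
    ‹FiniteDimensional k (degreeZero 𝒜).carrier›
  have := Module.projective_of_isSemisimpleRing (degZeroAlg (inducedDeg 𝒜 S))
    ((degreeZero 𝒜).restrict S).carrier
  have hdeg : ((degreeZero 𝒜).restrict S).deg 0 = ⊤ := degreeZero_deg_zero (𝒜 := 𝒜)
  -- Over `S` the module `R_0` lies in degree `0` and is projective over the semisimple ring `S_0`,
  -- hence it is linear.
  exact isLinear_of_restrict hS h0 (fun n =>
    (h0 n).of_concentrated hdeg) n

end GrMod

end KoszulTransfer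

/-! ### The Koszul property of a directed category and of its subcategory `𝒟`. -/

namespace GradedDirectedCategory

variable {k : Type w} [Field k] {C : Type u} [Category.{v} C] [Preadditive C] [Linear k C]

theorem hom_self_pos (𝒞 : GradedDirectedCategory k C) {n : ℕ} (hn : 0 < n) (x : C) :
    𝒞.hom x x n = ⊥ := by
  have hi := ((DirectSum.isInternal_submodule_iff_iSupIndep_and_iSup_eq_top _).1
    (𝒞.isInternal x x)).1.pairwiseDisjoint hn.ne'
  rwa [Function.onFun, 𝒞.hom_self_zero, disjoint_top] at hi

variable [Fintype C] (𝒞 : GradedDirectedCategory k C)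

theorem finiteDimensional_catAlg {k : Type w} [Field k] {C : Type u} [Category.{v} C]
    [Preadditive C] [Linear k C] [Fintype C] (𝒞 : GradedDirectedCategory k C) :
    FiniteDimensional k (CatAlg C) :=
  have := 𝒞.finite
  inferInstanceAs (FiniteDimensional k (∀ x y : C, (x ⟶ y)))

/-- All endomorphisms have degree `0`, so an element of positive degree has zero diagonal entries.
Hence the transfer results apply to `𝒟`. -/
theorem deg_le_diagonalSub (n : ℕ) (hn : 0 < n) :
    𝒞.deg n ≤ Subalgebra.toSubmodule 𝒞.diagonalSub := by
  intro a ha x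
  have h := ha x x
  rw [𝒞.hom_self_pos hn, Submodule.mem_bot] at h
  rw [h]
  exact zero_mem _

/-- The diagonal element of the associated algebra with the given coefficients. -/
noncomputable def _root_.CatAlg.diagonal (c : C → k) : CatAlg C :=
  fun x y => c x • (1 : CatAlg C) x y

@[simp] theorem _root_.CatAlg.diagonal_apply (c : C → k) (x y : C) :
    CatAlg.diagonal c x y = c x • (1 : CatAlg C) x y := rfl

theorem diagonal_mem_diagonalSub (c : C → k) : CatAlg.diagonal c ∈ 𝒞.diagonalSub := fun x => by
  rw [CatAlg.diagonal_apply, CatAlg.one_apply_self]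
  exact Submodule.smul_mem _ _ (Submodule.mem_span_singleton_self _)

theorem diagonal_mem_deg_zero (c : C → k) : CatAlg.diagonal c ∈ 𝒞.deg 0 := fun x y =>
  Submodule.smul_mem _ _ ((SetLike.GradedOne.one_mem : (1 : CatAlg C) ∈ 𝒞.deg 0) x y)

/-- The ring homomorphism from families of scalars onto the degree `0` part of `𝒟`. -/
noncomputable def diagonalHom : (C → k) →+* degZeroAlg 𝒞.diagonalSubDeg where
  toFun c := ⟨⟨CatAlg.diagonal c, 𝒞.diagonal_mem_diagonalSub c⟩, 𝒞.diagonal_mem_deg_zero c⟩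
  map_one' := Subtype.ext (Subtype.ext (CatAlg.ext fun x y => one_smul k _))
  map_zero' := Subtype.ext (Subtype.ext (CatAlg.ext fun x y => zero_smul k _))
  map_add' b c := Subtype.ext (Subtype.ext (CatAlg.ext fun x y => add_smul (b x) (c x) _))
  map_mul' b c := by
    refine Subtype.ext (Subtype.ext (CatAlg.ext fun x z => ?_))
    change CatAlg.diagonal (b * c) x z = (CatAlg.diagonal b * CatAlg.diagonal c : CatAlg C) x z
    rw [CatAlg.mul_apply, Finset.sum_eq_single x]
    · simp [smul_smul]
    · intro y _ hy
      rw [CatAlg.diagonal_apply, CatAlg.one_apply_ne hy.symm, smul_zero, Limits.zero_comp]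
    · simp

theorem diagonalHom_surjective : Function.Surjective 𝒞.diagonalHom := by
  rintro ⟨⟨a, ha⟩, ha0⟩
  choose c hc using fun x => Submodule.mem_span_singleton.1 (ha x)
  refine ⟨c, Subtype.ext (Subtype.ext (CatAlg.ext fun x y => ?_))⟩
  change c x • (1 : CatAlg C) x y = a x y
  by_cases h : x = y
  · subst h
    rw [CatAlg.one_apply_self, hc]
  · have h0 : a x y ∈ 𝒞.hom x y 0 := ha0 x y
    rw [𝒞.hom_ne_zero h, Submodule.mem_bot] at h0
    rw [CatAlg.one_apply_ne h, smul_zero, h0]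

/-- The degree `0` part of `𝒟` is a quotient of a finite product of copies of `k`. -/
instance : IsSemisimpleRing (degZeroAlg 𝒞.diagonalSubDeg) :=
  𝒞.diagonalHom.isSemisimpleRing_of_surjective 𝒞.diagonalHom_surjective

theorem isKoszul_iff_isLinear :
    𝒞.IsKoszul ↔ ∀ n, GrMod.IsLinear n 0 (GrMod.degreeZero 𝒞.deg) := GrMod.isKoszul_iff

theorem subIsClassicalKoszul_iff_isLinear : 𝒞.SubIsClassicalKoszul ↔
    ∀ n, GrMod.IsLinear n 0 (GrMod.degreeZero 𝒞.diagonalSubDeg) :=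
  (and_iff_right (inferInstance : IsSemisimpleRing (degZeroAlg 𝒞.diagonalSubDeg))).trans
    GrMod.isKoszul_iff

/-- The Koszul property of `𝒞` in terms of the subcategory `𝒟`. -/
theorem isKoszul_iff_projective (hS : SplitsProjectives (degZeroAlg 𝒞.deg)) :
    𝒞.IsKoszul ↔ Module.Projective (degZeroAlg 𝒞.deg) (CatAlg C) ∧ 𝒞.SubIsClassicalKoszul := by
  have := 𝒞.finiteDimensional_catAlg
  rw [isKoszul_iff_isLinear, subIsClassicalKoszul_iff_isLinear]
  constructor
  · intro h
    exact ⟨GrMod.projective_of_projective_self_degSub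
      (GrMod.projective_self_degSub_of_isLinear hS h),
      GrMod.isLinear_degreeZero_restrict 𝒞.deg_le_diagonalSub h⟩
  · rintro ⟨h1, h2⟩
    have : Module.Projective (degZeroAlg 𝒞.deg) (GrMod.self 𝒞.deg).carrier := h1
    exact GrMod.isLinear_degreeZero_of_restrict 𝒞.deg_le_diagonalSub h2

/-- Finite dimensionality of `M_0` suffices: it generates `M` over a finite dimensional algebra, so
`M` is finite dimensional and linearity can be transferred in both directions. -/
theorem isKoszul_module_iff (hS : SplitsProjectives (degZeroAlg 𝒞.deg)) (h : 𝒞.IsKoszul)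
    {M : GrMod k (CatAlg C) 𝒞.deg} (hM : M.LocallyFinite) (hgen : M.GeneratedInDegree 0) :
    M.IsKoszul ↔ (M.restrict 𝒞.diagonalSub).IsKoszul ∧
      Module.Projective (degZeroAlg 𝒞.deg) M.carrier := by
  have := 𝒞.finiteDimensional_catAlg
  have := hgen.finiteDimensional (hM 0)
  have hk := 𝒞.isKoszul_iff_isLinear.1 h
  have hproj := GrMod.projective_self_degSub_of_isLinear hS hk
  have := GrMod.projective_of_projective_self_degSub hproj
  have hD := GrMod.isLinear_degreeZero_restrict 𝒞.deg_le_diagonalSub hk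
  rw [GrMod.isKoszul_iff, GrMod.isKoszul_iff]
  constructor
  · intro hl
    exact ⟨fun n => GrMod.IsLinear.restrict 𝒞.deg_le_diagonalSub (hD n) (hl n),
      GrMod.projective_of_isLinear hS hproj hl⟩
  · rintro ⟨hl, hp⟩
    exact GrMod.isLinear_of_restrict 𝒞.deg_le_diagonalSub hD hl

end GradedDirectedCategory

/-! ## Primitive idempotents of finite dimensional algebras -/

section PrimitiveIdempotent

variable {k : Type w} [Field k] {B : Type u} [Ring B] [Algebra k B]

theorem mem_leftIdealOf {e a : B} (he : IsIdempotentElem e) : a ∈ leftIdealOf e ↔ a * e = a := by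
  rw [Submodule.mem_span_singleton]
  constructor
  · rintro ⟨b, rfl⟩
    rw [smul_eq_mul, mul_assoc, he.eq]
  · exact fun h => ⟨a, h⟩

theorem projective_leftIdealOf {e : B} (he : IsIdempotentElem e) :
    Module.Projective B (leftIdealOf e) := by
  refine Module.Projective.of_split (leftIdealOf e).subtype
    ((LinearMap.toSpanSingleton B B e).codRestrict (leftIdealOf e) fun a =>
      Submodule.mem_span_singleton.2 ⟨a, rfl⟩) (LinearMap.ext fun x => Subtype.ext ?_)
  exact (mem_leftIdealOf he).1 x.2

/-- Fitting's lemma in a corner ring `e B e`. -/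
theorem IsPrimitiveIdempotent.isNilpotent_or_exists_mul_eq [FiniteDimensional k B] {e u : B}
    (he : IsPrimitiveIdempotent e) (heu : e * u = u) (hue : u * e = u) :
    IsNilpotent u ∨ ∃ c, c * u = e := by
  obtain ⟨hee, -, hprim⟩ := he
  obtain ⟨p, hp0, hp⟩ : ∃ p : Polynomial k, p ≠ 0 ∧ Polynomial.aeval u p = 0 :=
    Algebra.IsAlgebraic.isAlgebraic (R := k) u
  obtain ⟨q, hq, hqX⟩ := Polynomial.exists_eq_pow_rootMultiplicity_mul_and_not_dvd p hp0 0
  set n := p.rootMultiplicity 0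
  rw [Polynomial.C_0, sub_zero] at hq hqX
  -- The exponent `n + 1` instead of `n` makes `f` a multiple of `u` even when `n = 0`, which puts
  -- the idempotent `f` into the corner `e B e`. Then `f = 0` forces `u ^ (n + 1) = 0`, and `f = e`
  -- gives a left inverse of `u`.
  have hcop : IsCoprime (Polynomial.X ^ (n + 1)) q :=
    (Polynomial.irreducible_X.coprime_iff_not_dvd.2 hqX).pow_left
  obtain ⟨a, b, hab⟩ := hcop
  obtain ⟨φ, hφX, hφp⟩ : ∃ φ : Polynomial k →ₐ[k] B, φ Polynomial.X = u ∧ φ p = 0 :=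
    ⟨Polynomial.aeval u, Polynomial.aeval_X u, hp⟩
  obtain ⟨f, hf⟩ : ∃ f, f = φ (a * Polynomial.X ^ (n + 1)) := ⟨_, rfl⟩
  have hf1 : 1 - f = φ (b * q) := by
    rw [hf, sub_eq_iff_eq_add, ← map_add, add_comm, hab, map_one]
  have hzero : ∀ r s : Polynomial k, φ (r * Polynomial.X ^ (n + 1) * (s * q)) = 0 := by
    intro r s
    have h1 : r * Polynomial.X ^ (n + 1) * (s * q) = r * s * Polynomial.X * p := by
      rw [hq, pow_succ]
      ring
    rw [h1, map_mul, hφp, mul_zero]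
  have hff : f * (1 - f) = 0 := by rw [hf1, hf, ← map_mul, hzero]
  have hfu : f = φ (a * Polynomial.X ^ n) * u := by
    rw [hf, pow_succ, ← mul_assoc, map_mul, hφX]
  have hfu' : f = u * φ (a * Polynomial.X ^ n) := by
    rw [hf, pow_succ', mul_left_comm, map_mul, hφX]
  have hfe : f * e = f := by rw [hfu, mul_assoc, hue]
  have hef : e * f = f := by rw [hfu', ← mul_assoc, heu]
  have hfi : f * f = f := by rwa [mul_sub, mul_one, sub_eq_zero, eq_comm] at hff
  rcases hprim f (e - f) hfi (by
      change (e - f) * (e - f) = _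
      rw [mul_sub, sub_mul, sub_mul, hee.eq, hef, hfe, hfi, sub_self, sub_zero])
    (by rw [mul_sub, hfe, hfi, sub_self]) (by rw [sub_mul, hef, hfi, sub_self])
    (add_sub_cancel _ _) with h | h
  · left
    refine ⟨n + 1, ?_⟩
    have h1 : φ (1 * Polynomial.X ^ (n + 1) * (b * q)) = 0 := hzero 1 b
    rwa [map_mul, ← hf1, h, sub_zero, mul_one, one_mul, map_pow, hφX] at h1
  · right
    exact ⟨_, hfu.symm.trans (sub_eq_zero.1 h).symm⟩

/-- `B e` is a local module. Write `e = a + b` with `a ∈ K` and `b ∈ L`: either `e a` has a left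
inverse in the corner and `a` generates `B e`, or `e a` is nilpotent, `1 - e a` is a unit, and `b`
generates. -/
theorem IsPrimitiveIdempotent.eq_top_or_eq_top (k : Type w) [Field k] [Algebra k B]
    [FiniteDimensional k B] {e : B}
    (he : IsPrimitiveIdempotent e) {K L : Submodule B (leftIdealOf e)} (h : K ⊔ L = ⊤) :
    K = ⊤ ∨ L = ⊤ := by
  let e' : leftIdealOf e := ⟨e, Submodule.mem_span_singleton_self e⟩
  have htop : ∀ N : Submodule B (leftIdealOf e), ∀ a ∈ N, ∀ c : B, c * (a : B) = e → N = ⊤ := by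
    intro N a ha c hc
    refine eq_top_iff.2 fun x _ => ?_
    have : x = ((x : B) * c) • a := Subtype.ext (by
      rw [Submodule.coe_smul, smul_eq_mul, mul_assoc, hc, (mem_leftIdealOf he.1).1 x.2])
    rw [this]
    exact N.smul_mem _ ha
  obtain ⟨a, ha, b, hb, hab⟩ := Submodule.mem_sup.1 (show e' ∈ K ⊔ L by rw [h]; trivial)
  have hab' : (a : B) + b = e := congrArg Subtype.val hab
  have hae := (mem_leftIdealOf he.1).1 a.2
  rcases he.isNilpotent_or_exists_mul_eq (k := k) (u := e * a)
    (by rw [← mul_assoc, he.1.eq]) (by rw [mul_assoc, hae]) with hn | ⟨c, hc⟩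
  · right
    obtain ⟨v, hv⟩ := hn.isUnit_one_sub
    refine htop L b hb (↑v⁻¹ * e) ?_
    have h1 : e * (b : B) = (1 - e * a) * e := by
      rw [sub_mul, one_mul, mul_assoc, hae, eq_sub_iff_add_eq, ← mul_add, add_comm, hab', he.1.eq]
    rw [mul_assoc, h1, ← hv, ← mul_assoc, Units.inv_mul, one_mul]
  · left
    exact htop K a ha (c * e) (by rw [mul_assoc, hc])

theorem IsPrimitiveIdempotent.le_jacobson (k : Type w) [Field k] [Algebra k B]
    [FiniteDimensional k B] {e : B} (he : IsPrimitiveIdempotent e)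
    {K : Submodule B (leftIdealOf e)} (hK : K ≠ ⊤) : K ≤ Module.jacobson B (leftIdealOf e) := by
  refine le_sInf fun L hL => ?_
  by_contra hKL
  have : K ⊔ L = ⊤ := hL.2 _ (lt_of_le_of_ne le_sup_right fun h => hKL (h ▸ le_sup_left))
  exact (he.eq_top_or_eq_top k this).elim hK hL.1

/-- The kernel of `B e → V`, `a ↦ a x`, is proper and so lies in the radical; the image modulo the
image of the radical is the simple top of `B e`. -/
theorem isCompositionFactor_of_smul_ne_zero (k : Type w) [Field k] [Algebra k B]
    [FiniteDimensional k B] {e : B} (he : IsPrimitiveIdempotent e) {V : Type u} [AddCommGroup V]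
    [Module B V] {x : V} (hx : e • x ≠ 0) :
    IsCompositionFactor B (leftIdealOf e ⧸ Module.jacobson B (leftIdealOf e)) V := by
  let φ : leftIdealOf e →ₗ[B] V := LinearMap.toSpanSingleton B V x ∘ₗ (leftIdealOf e).subtype
  set J := Module.jacobson B (leftIdealOf e)
  have hker : LinearMap.ker φ ≤ J := he.le_jacobson k fun h => hx (by
    have : (⟨e, Submodule.mem_span_singleton_self e⟩ : leftIdealOf e) ∈ LinearMap.ker φ := by
      rw [h]; trivial
    exact this)
  refine ⟨J.map φ, LinearMap.range φ, LinearMap.map_le_range, ⟨?_⟩⟩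
  let ψ := Submodule.mkQ ((J.map φ).submoduleOf (LinearMap.range φ)) ∘ₗ φ.rangeRestrict
  have hψ : Function.Surjective ψ :=
    (Submodule.mkQ_surjective _).comp φ.surjective_rangeRestrict
  have hψk : LinearMap.ker ψ = J := by
    ext p
    rw [LinearMap.mem_ker, LinearMap.comp_apply, Submodule.mkQ_apply, Submodule.Quotient.mk_eq_zero]
    change φ p ∈ J.map φ ↔ _
    constructor
    · rintro ⟨q, hq, hqp⟩
      have : p - q ∈ J := hker (by rw [LinearMap.mem_ker, map_sub, hqp, sub_self])
      simpa using add_mem this hq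
    · exact fun h => ⟨p, h, rfl⟩
  exact (Submodule.quotEquivOfEq _ _ hψk.symm).trans (ψ.quotKerEquivOfSurjective hψ)

/-- `e` acts as zero on every subquotient of `V`, but it fixes the class of `e` in the top of `B e`,
which is nonzero because a nonzero finitely generated module differs from its radical. -/
theorem not_isCompositionFactor_of_smul_eq_zero {e : B} (he : IsIdempotentElem e) (he0 : e ≠ 0)
    {V : Type u} [AddCommGroup V] [Module B V] (hV : ∀ x : V, e • x = 0) :
    ¬ IsCompositionFactor B (leftIdealOf e ⧸ Module.jacobson B (leftIdealOf e)) V := by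
  rintro ⟨N', N, -, ⟨f⟩⟩
  let e' : leftIdealOf e := ⟨e, Submodule.mem_span_singleton_self e⟩
  have : Module.Finite B (leftIdealOf e) := Module.Finite.span_singleton B e
  have : Nontrivial (leftIdealOf e) := ⟨e', 0, fun h => he0 (congrArg Subtype.val h)⟩
  have hJ := (Module.jacobson_lt_top B (leftIdealOf e)).ne
  refine hJ (eq_top_iff.2 fun x _ => ?_)
  have h1 : e • (Submodule.Quotient.mk e' : leftIdealOf e ⧸ Module.jacobson B (leftIdealOf e)) =
      Submodule.Quotient.mk e' := by
    rw [← Submodule.Quotient.mk_smul]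
    exact congrArg _ (Subtype.ext he.eq)
  have h2 : f (Submodule.Quotient.mk e') = 0 := by
    rw [← h1, map_smul]
    obtain ⟨y, hy⟩ := Submodule.Quotient.mk_surjective _ (f (Submodule.Quotient.mk e'))
    rw [← hy, ← Submodule.Quotient.mk_smul, show e • y = 0 from Subtype.ext (hV y),
      Submodule.Quotient.mk_zero]
  have h3 : e' ∈ Module.jacobson B (leftIdealOf e) :=
    (Submodule.Quotient.mk_eq_zero _).1 (f.injective (h2.trans (map_zero f).symm))
  have h4 : x = (x : B) • e' := Subtype.ext ((mem_leftIdealOf he).1 x.2).symm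
  rw [h4]
  exact Submodule.smul_mem _ _ h3

end PrimitiveIdempotent

/-! ## Filtrations -/

section Filtrations

variable {B : Type u} [Ring B]

theorem Module.Projective.of_exact {L M N : Type*} [AddCommGroup L] [AddCommGroup M]
    [AddCommGroup N] [Module B L] [Module B M] [Module B N] [Module.Projective B L]
    [Module.Projective B N] {f : L →ₗ[B] M} {g : M →ₗ[B] N} (hf : Function.Injective f)
    (hfg : Function.Exact f g) (hg : Function.Surjective g) : Module.Projective B M := by
  obtain ⟨σ, hσ⟩ := Module.projective_lifting_property g LinearMap.id hg
  have hσ' : ∀ x, g (σ x) = x := LinearMap.congr_fun hσ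
  refine Module.Projective.of_equiv (LinearEquiv.ofBijective (f.coprod σ) ⟨?_, fun m => ?_⟩)
  · rw [← LinearMap.ker_eq_bot, LinearMap.ker_eq_bot']
    rintro ⟨l, n⟩ h
    rw [LinearMap.coprod_apply] at h
    have hn : n = 0 := by
      have := congrArg g h
      rwa [map_add, hfg.apply_apply_eq_zero, zero_add, hσ', map_zero] at this
    subst hn
    rw [map_zero, add_zero] at h
    have hl : l = 0 := hf (h.trans (map_zero f).symm)
    rw [hl]
    rfl
  · obtain ⟨l, hl⟩ := (hfg (m - σ (g m))).1 (by rw [map_sub, hσ', sub_self])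
    exact ⟨(l, g m), by rw [LinearMap.coprod_apply, hl, sub_add_cancel]⟩

variable {ι : Type*} {Δ : ι → ModuleCat.{u} B} {p : ι → Prop} {M : Type u} [AddCommGroup M]
  [Module B M]

/-- The filtration of the kernel, viewed inside `M`, is continued by `M` itself as term `n + 1`. -/
theorem HasFiltrationBy.of_surjective {j : ι} (hj : p j) (f : M →ₗ[B] Δ j)
    (hf : Function.Surjective f) (h : HasFiltrationBy B Δ p (LinearMap.ker f)) :
    HasFiltrationBy B Δ p M := by
  obtain ⟨n, F, hF0, hFn, hF⟩ := h
  let G : ℕ → Submodule B M := fun i =>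
    if i ≤ n then (F i).map (LinearMap.ker f).subtype else ⊤
  have hG : ∀ i ≤ n, G i = (F i).map (LinearMap.ker f).subtype := fun i hi => if_pos hi
  have hG' : G (n + 1) = ⊤ := if_neg (by omega)
  refine ⟨n + 1, G, by rw [hG 0 (by omega), hF0, Submodule.map_bot], hG', fun i hi => ?_⟩
  rcases Nat.lt_succ_iff_lt_or_eq.1 hi with hi | rfl
  · obtain ⟨hle, j', hj', ⟨e⟩⟩ := hF i hi
    rw [hG i hi.le, hG (i + 1) hi]
    let a := Submodule.equivMapOfInjective (LinearMap.ker f).subtype Subtype.val_injective (F (i + 1))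
    refine ⟨Submodule.map_mono hle, j', hj',
      ⟨(Submodule.Quotient.equiv _ ((F i).submoduleOf (F (i + 1))) a.symm ?_).trans e⟩⟩
    ext x
    rw [Submodule.mem_map_equiv, LinearEquiv.symm_symm]
    change ((a x : _) : M) ∈ (F i).map (LinearMap.ker f).subtype ↔ (x : LinearMap.ker f) ∈ F i
    constructor
    · rintro ⟨y, hy, hyx⟩
      rwa [← (Subtype.ext hyx : y = (x : LinearMap.ker f))]
    · exact fun hx => ⟨_, hx, rfl⟩
  · rw [hG', hG i le_rfl, hFn, Submodule.map_top, Submodule.range_subtype]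
    refine ⟨le_top, j, hj, ⟨?_⟩⟩
    let g : (⊤ : Submodule B M) →ₗ[B] Δ j := f ∘ₗ (⊤ : Submodule B M).subtype
    have hg : Function.Surjective g := fun y => (hf y).imp' (fun x => ⟨x, trivial⟩) fun _ h => h
    exact g.quotKerEquivOfSurjective hg

theorem HasFiltrationBy.of_subsingleton [Subsingleton M] : HasFiltrationBy B Δ p M :=
  ⟨0, fun _ => ⊥, rfl, Subsingleton.elim _ _, fun _ h => absurd h (Nat.not_lt_zero _)⟩

theorem HasFiltrationBy.exists_exact {F : ℕ → Submodule B M} {i : ℕ} {j : ι}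
    (e : (F (i + 1) ⧸ (F i).submoduleOf (F (i + 1))) ≃ₗ[B] Δ j) :
    ∃ g : F (i + 1) →ₗ[B] Δ j, Function.Surjective g ∧ ∀ x, g x = 0 ↔ (x : M) ∈ F i :=
  ⟨e.toLinearMap ∘ₗ Submodule.mkQ _, e.surjective.comp (Submodule.mkQ_surjective _), fun x => by
    rw [LinearMap.comp_apply, LinearEquiv.coe_coe, LinearEquiv.map_eq_zero_iff,
      Submodule.mkQ_apply, Submodule.Quotient.mk_eq_zero]
    rfl⟩

/-- Multiplication by `c` lowers the filtration by one step, and idempotency allows `c` to be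
applied repeatedly. -/
theorem HasFiltrationBy.smul_eq_zero (h : HasFiltrationBy B Δ p M) {c : B}
    (hc : IsIdempotentElem c) (hΔ : ∀ j, p j → ∀ x : Δ j, c • x = 0) (x : M) : c • x = 0 := by
  obtain ⟨n, F, hF0, hFn, hF⟩ := h
  have key : ∀ i ≤ n, ∀ x ∈ F i, c • x = 0 := by
    intro i
    induction i with
    | zero =>
      intro _ x hx
      rw [hF0, Submodule.mem_bot] at hx
      rw [hx, smul_zero]
    | succ i ih =>
      intro hi x hx
      obtain ⟨-, j, hj, ⟨e⟩⟩ := hF i hi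
      obtain ⟨g, -, hg⟩ := HasFiltrationBy.exists_exact e
      have h1 : c • x ∈ F i := (hg (c • ⟨x, hx⟩)).1 (by rw [map_smul, hΔ j hj])
      rw [← ih (by omega) _ h1, smul_smul, hc.eq]
  exact key n le_rfl x (hFn ▸ trivial)

theorem HasFiltrationBy.projective {k : Type w} [Field k] [Algebra k B] (S : Subalgebra k B)
    (h : HasFiltrationBy B Δ p M) (hΔ : ∀ j, p j → Module.Projective S (Δ j)) :
    Module.Projective S M := by
  obtain ⟨n, F, hF0, hFn, hF⟩ := h
  have key : ∀ i ≤ n, Module.Projective S (F i) := by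
    intro i
    induction i with
    | zero =>
      intro _
      rw [hF0]
      infer_instance
    | succ i ih =>
      intro hi
      obtain ⟨hle, j, hj, ⟨e⟩⟩ := hF i hi
      obtain ⟨g, hgs, hg⟩ := HasFiltrationBy.exists_exact e
      have := ih (by omega)
      have := hΔ j hj
      refine Module.Projective.of_exact (f := (Submodule.inclusion hle).restrictScalars S)
        (g := g.restrictScalars S) (Submodule.inclusion_injective hle) (fun x => ?_) hgs
      refine (hg x).trans ⟨fun hx => ⟨⟨x, hx⟩, rfl⟩, ?_⟩
      rintro ⟨y, rfl⟩
      exact y.2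
  have := key n le_rfl
  rw [hFn] at this
  exact Module.Projective.of_equiv
    ((Submodule.topEquiv (R := B) (M := M)).restrictScalars S)

end Filtrations

/-! ## Products with morphisms in the associated algebra -/

namespace CatAlg

variable {C : Type u} [Category.{v} C] [Preadditive C]

@[simp] theorem single_apply_same (x y : C) (f : x ⟶ y) : single x y f x y = f := by
  simp [single]

theorem single_apply_ne {x y x' y' : C} (f : x ⟶ y) (h : ¬ (x' = x ∧ y = y')) :
    single x y f x' y' = 0 := dif_neg h

@[simp] theorem single_zero (x y : C) : single x y (0 : x ⟶ y) = 0 := by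
  ext x' y'
  simp [single]

theorem single_add (x y : C) (f g : x ⟶ y) :
    single x y (f + g) = single x y f + single x y g := by
  ext x' y'
  by_cases h : x' = x ∧ y = y' <;> simp [single, h]

theorem sum_apply {ι : Type*} (s : Finset ι) (f : ι → CatAlg C) (x y : C) :
    (∑ i ∈ s, f i) x y = ∑ i ∈ s, f i x y :=
  map_sum (AddMonoidHom.mk' (fun a : CatAlg C => a x y) fun _ _ => rfl) f s

theorem single_sum {ι : Type*} (s : Finset ι) (x y : C) (f : ι → (x ⟶ y)) :
    single x y (∑ i ∈ s, f i) = ∑ i ∈ s, single x y (f i) :=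
  map_sum (AddMonoidHom.mk' (single x y) (single_add x y)) f s

variable [Fintype C]

theorem single_mul_apply_same {y z : C} (g : y ⟶ z) (a : CatAlg C) (x : C) :
    (single y z g * a) x z = a x y ≫ g := by
  rw [mul_apply, Finset.sum_eq_single y, single_apply_same]
  · intro w _ hw
    rw [single_apply_ne _ fun h => hw h.1, Limits.comp_zero]
  · simp

theorem single_mul_apply_ne {y z : C} (g : y ⟶ z) (a : CatAlg C) (x : C) {z' : C} (h : z ≠ z') :
    (single y z g * a) x z' = 0 := by
  rw [mul_apply]
  refine Finset.sum_eq_zero fun w _ => ?_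
  rw [single_apply_ne _ fun h' => h h'.2, Limits.comp_zero]

theorem mul_single_apply_same {x y : C} (f : x ⟶ y) (a : CatAlg C) (z : C) :
    (a * single x y f) x z = f ≫ a y z := by
  rw [mul_apply, Finset.sum_eq_single y, single_apply_same]
  · intro w _ hw
    rw [single_apply_ne _ fun h => hw h.2.symm, Limits.zero_comp]
  · simp

theorem mul_single_apply_ne {x y : C} (f : x ⟶ y) (a : CatAlg C) (z : C) {x' : C} (h : x' ≠ x) :
    (a * single x y f) x' z = 0 := by
  rw [mul_apply]
  refine Finset.sum_eq_zero fun w _ => ?_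
  rw [single_apply_ne _ fun h' => h h'.1, Limits.zero_comp]

/-- Identifies the corners of the associated algebra with the morphism spaces. -/
theorem single_mul_mul_single {x x' y y' : C} (f : x ⟶ x') (g : y ⟶ y') (a : CatAlg C) :
    single y y' g * a * single x x' f = single x y' (f ≫ a x' y ≫ g) := by
  ext w z
  by_cases hw : w = x
  · subst hw
    rw [mul_single_apply_same]
    by_cases hz : y' = z
    · subst hz
      rw [single_mul_apply_same, single_apply_same]
    · rw [single_mul_apply_ne _ _ _ hz, Limits.comp_zero, single_apply_ne _ fun h => hz h.2]
  · rw [mul_single_apply_ne _ _ _ hw, single_apply_ne _ fun h => hw h.1]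

theorem single_mul_single (x : C) (f g : x ⟶ x) :
    single x x g * single x x f = single x x (f ≫ g) := by
  have h := single_mul_mul_single f g 1
  rwa [mul_one, one_apply_self, Category.id_comp] at h

/-- The idempotent of the associated algebra that belongs to an object. -/
noncomputable def obj (x : C) : CatAlg C := single x x (𝟙 x)

theorem isIdempotentElem_obj (x : C) : IsIdempotentElem (obj x) := by
  rw [IsIdempotentElem, obj, single_mul_single, Category.id_comp]

theorem sum_obj : ∑ x : C, obj x = 1 := by
  ext y z
  rw [sum_apply, Finset.sum_eq_single y]
  · by_cases h : y = z
    · subst h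
      rw [obj, single_apply_same, one_apply_self]
    · rw [obj, single_apply_ne _ fun h' => h h'.2, one_apply_ne h]
  · intro x _ hx
    exact single_apply_ne _ fun h => hx h.1.symm
  · simp

theorem obj_mul_single (x : C) (f : x ⟶ x) : obj x * single x x f = single x x f := by
  rw [obj, single_mul_single, Category.comp_id]

theorem single_mul_obj (x : C) (f : x ⟶ x) : single x x f * obj x = single x x f := by
  rw [obj, single_mul_single, Category.id_comp]

theorem eq_sum_obj_smul {V : Type*} [AddCommGroup V] [Module (CatAlg C) V] (v : V) :
    v = ∑ x : C, (obj x : CatAlg C) • v := by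
  rw [← Finset.sum_smul, sum_obj, one_smul]

end CatAlg

/-! ### Primitive idempotents inside the associated algebra. -/

namespace PrimitiveIdempotents

variable {C : Type u} [Category.{v} C] [Preadditive C] [Fintype C] (E : PrimitiveIdempotents C)

/-- The primitive idempotents as elements of the associated algebra. -/
noncomputable def elem (p : Σ x : C, Fin (E.card x)) : CatAlg C :=
  CatAlg.single p.1 p.1 (E.idem p.1 p.2)

theorem isIdempotentElem_elem (p : Σ x : C, Fin (E.card x)) : IsIdempotentElem (E.elem p) := by
  rw [IsIdempotentElem, elem, CatAlg.single_mul_single]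
  exact congrArg _ (E.primitive p.1 p.2).1

theorem elem_ne_zero (p : Σ x : C, Fin (E.card x)) : E.elem p ≠ 0 := fun h =>
  (E.primitive p.1 p.2).2.1 <| by
    rw [← CatAlg.single_apply_same p.1 p.1 (E.idem p.1 p.2)]
    exact congrArg (fun a : CatAlg C => a p.1 p.1) h

/-- Orthogonal idempotents with sum `e` lie in the corner at the object of `e`. This corner is the
endomorphism algebra, where `e` is primitive by assumption. -/
theorem primitive_elem (p : Σ x : C, Fin (E.card x)) : IsPrimitiveIdempotent (E.elem p) := by
  refine ⟨E.isIdempotentElem_elem p, E.elem_ne_zero p, fun f g hf hg hfg hgf h => ?_⟩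
  have corner : ∀ a b : CatAlg C, IsIdempotentElem a → a * b = 0 → b * a = 0 → a + b = E.elem p →
      a = CatAlg.single p.1 p.1 (a p.1 p.1) := by
    intro a b ha hab hba h
    have h1 : E.elem p * a = a := by rw [← h, add_mul, ha.eq, hba, add_zero]
    have h2 : a * E.elem p = a := by rw [← h, mul_add, ha.eq, hab, add_zero]
    have h3 : CatAlg.obj p.1 * a * CatAlg.obj p.1 = a := by
      rw [← h2, ← h1, ← mul_assoc, ← mul_assoc, elem, CatAlg.obj_mul_single, mul_assoc,
        CatAlg.single_mul_obj]
    rw [CatAlg.obj, CatAlg.single_mul_mul_single, Category.id_comp, Category.comp_id] at h3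
    exact h3.symm
  have hf' := corner f g hf hfg hgf h
  have hg' := corner g f hg hgf hfg (by rw [add_comm, h])
  have key : ∀ {a b c : CatAlg C}, a = CatAlg.single p.1 p.1 (a p.1 p.1) →
      b = CatAlg.single p.1 p.1 (b p.1 p.1) → a * b = c → b p.1 p.1 ≫ a p.1 p.1 = c p.1 p.1 := by
    intro a b c ha hb hab
    rw [← hab, ha, hb, CatAlg.single_mul_single]
    simp
  rcases (E.primitive p.1 p.2).2.2 (f p.1 p.1) (g p.1 p.1) (key hf' hf' hf.eq) (key hg' hg' hg.eq)
    (key hf' hg' hfg) (key hg' hf' hgf) (by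
      have := congrArg (fun a : CatAlg C => a p.1 p.1) h
      rwa [elem, CatAlg.single_apply_same] at this) with h | h
  · left
    rw [hf', h, CatAlg.single_zero]
  · right
    rw [hg', h, CatAlg.single_zero]

theorem sum_elem (x : C) : ∑ i, E.elem ⟨x, i⟩ = CatAlg.obj x := by
  rw [CatAlg.obj, ← show ∑ i, E.idem x i = 𝟙 x from (E.complete x).complete]
  exact (CatAlg.single_sum _ _ _ _).symm

theorem obj_mul_elem (p : Σ x : C, Fin (E.card x)) : CatAlg.obj p.1 * E.elem p = E.elem p :=
  CatAlg.obj_mul_single _ _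

theorem obj_smul_eq_zero {V : Type*} [AddCommGroup V] [Module (CatAlg C) V] {x : C} {v : V}
    (h : ∀ i, E.elem ⟨x, i⟩ • v = 0) : (CatAlg.obj x : CatAlg C) • v = 0 := by
  rw [← E.sum_elem, Finset.sum_smul]
  exact Finset.sum_eq_zero fun i _ => h i

theorem sum_sigma_elem : ∑ p : Σ x : C, Fin (E.card x), E.elem p = 1 := by
  rw [Fintype.sum_sigma, ← CatAlg.sum_obj]
  exact Finset.sum_congr rfl fun x _ => E.sum_elem x

end PrimitiveIdempotents

/-! ### Elements of degree `0` and the projection onto the diagonal. -/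

namespace GradedDirectedCategory

variable {k : Type w} [Field k] {C : Type u} [Category.{v} C] [Preadditive C] [Linear k C]
  [Fintype C] (𝒞 : GradedDirectedCategory k C)

theorem apply_eq_zero_of_mem_deg_zero {c : CatAlg C} (hc : c ∈ 𝒞.deg 0) {x y : C} (h : x ≠ y) :
    c x y = 0 := by
  have h0 := hc x y
  rwa [𝒞.hom_ne_zero h, Submodule.mem_bot] at h0

theorem mem_deg_zero_of_apply_eq_zero {c : CatAlg C} (hc : ∀ x y, x ≠ y → c x y = 0) :
    c ∈ 𝒞.deg 0 := fun x y => by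
  by_cases h : x = y
  · subst h
    rw [𝒞.hom_self_zero]
    trivial
  · rw [hc x y h]
    exact zero_mem _

theorem single_mem_deg_zero (x : C) (f : x ⟶ x) : CatAlg.single x x f ∈ 𝒞.deg 0 :=
  𝒞.mem_deg_zero_of_apply_eq_zero fun _ _ h => CatAlg.single_apply_ne _ fun h' => h (h'.1.trans h'.2)

theorem obj_mul_comm {c : CatAlg C} (hc : c ∈ 𝒞.deg 0) (x : C) :
    CatAlg.obj x * c = c * CatAlg.obj x := by
  ext y z
  by_cases hz : x = z
  · subst hz
    rw [CatAlg.obj, CatAlg.single_mul_apply_same, Category.comp_id]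
    by_cases hy : y = x
    · subst hy
      rw [CatAlg.mul_single_apply_same, Category.id_comp]
    · rw [CatAlg.mul_single_apply_ne _ _ _ hy, 𝒞.apply_eq_zero_of_mem_deg_zero hc hy]
  · rw [CatAlg.obj, CatAlg.single_mul_apply_ne _ _ _ hz]
    by_cases hy : y = x
    · subst hy
      rw [CatAlg.mul_single_apply_same, 𝒞.apply_eq_zero_of_mem_deg_zero hc hz, Limits.comp_zero]
    · rw [CatAlg.mul_single_apply_ne _ _ _ hy]

theorem obj_mul_mul_single_eq_zero {x y : C} (h : ¬ 𝒞.order.le x y) (a : CatAlg C) (f : x ⟶ x) :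
    CatAlg.obj y * a * CatAlg.single x x f = 0 := by
  rw [CatAlg.obj, CatAlg.single_mul_mul_single]
  have : f ≫ a x y ≫ 𝟙 y = 0 := by
    by_contra h'
    exact h (𝒞.directed _ h')
  rw [this, CatAlg.single_zero]

open Classical in
/-- The projection of the associated algebra onto the endomorphism algebras of the objects. -/
noncomputable def diagonalPart : CatAlg C →+* degZeroAlg 𝒞.deg where
  toFun a := ⟨fun x y => if x = y then a x y else 0,
    𝒞.mem_deg_zero_of_apply_eq_zero fun _ _ h => if_neg h⟩
  map_one' := Subtype.ext <| CatAlg.ext fun x y => by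
    change (if x = y then (1 : CatAlg C) x y else 0) = (1 : CatAlg C) x y
    split_ifs with h
    · rfl
    · exact (CatAlg.one_apply_ne h).symm
  map_zero' := Subtype.ext <| CatAlg.ext fun x y => ite_self _
  map_add' a b := Subtype.ext <| CatAlg.ext fun x y => by
    change (if x = y then (a + b) x y else 0) =
      (if x = y then a x y else 0) + (if x = y then b x y else 0)
    split_ifs <;> simp
  map_mul' b a := Subtype.ext <| CatAlg.ext fun x z => by
    change (if x = z then (b * a) x z else 0) =
      ∑ y, (if x = y then a x y else 0) ≫ (if y = z then b y z else 0)
    rw [Finset.sum_eq_single x (fun y _ hy => by rw [if_neg hy.symm, Limits.zero_comp]) (by simp)]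
    rw [if_pos rfl]
    by_cases h : x = z
    · subst h
      rw [if_pos rfl, if_pos rfl, CatAlg.mul_apply, Finset.sum_eq_single x]
      · intro y _ hy
        -- By directedness a composite `x → y → x` with `y ≠ x` vanishes; this is why taking
        -- diagonal entries is multiplicative.
        exact 𝒞.comp_eq_zero hy.symm _ _
      · simp
    · rw [if_neg h, if_neg h, Limits.comp_zero]

theorem diagonalPart_apply_self (a : CatAlg C) (x : C) :
    (𝒞.diagonalPart a : CatAlg C) x x = a x x := if_pos rfl

theorem diagonalPart_coe (c : degZeroAlg 𝒞.deg) : 𝒞.diagonalPart c = c :=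
  Subtype.ext <| CatAlg.ext fun x y => by
    by_cases h : x = y
    · subst h
      exact 𝒞.diagonalPart_apply_self _ _
    · exact (if_neg h).trans (𝒞.apply_eq_zero_of_mem_deg_zero c.2 h).symm

theorem obj_mul_mul_obj (a : CatAlg C) (x : C) :
    CatAlg.obj x * a * CatAlg.obj x = (𝒞.diagonalPart a : CatAlg C) * CatAlg.obj x := by
  rw [← (CatAlg.isIdempotentElem_obj x).eq, ← mul_assoc (𝒞.diagonalPart a : CatAlg C),
    ← 𝒞.obj_mul_comm (𝒞.diagonalPart a).2, (CatAlg.isIdempotentElem_obj x).eq, CatAlg.obj,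
    CatAlg.single_mul_mul_single, CatAlg.single_mul_mul_single, diagonalPart_apply_self]

end GradedDirectedCategory

namespace GradedDirectedCategory

variable {k : Type w} [Field k] {C : Type u} [Category.{v} C] [Preadditive C] [Linear k C]
  [Fintype C] (𝒞 : GradedDirectedCategory k C)

/-! ## Stratifications give projectivity -/

/-- A quotient of an indecomposable projective that is concentrated at one object. -/
theorem projective_of_concentrated {x : C} {ε : x ⟶ x}
    (hε : IsIdempotentElem (CatAlg.single x x ε)) {V : Type max u v} [AddCommGroup V]
    [Module (CatAlg C) V] (π : leftIdealOf (CatAlg.single x x ε) →ₗ[CatAlg C] V)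
    (hπ : Function.Surjective π) (hV : ∀ y, y ≠ x → ∀ v : V, (CatAlg.obj y : CatAlg C) • v = 0)
    (hker : ∀ p, π p = 0 → (CatAlg.obj x : CatAlg C) • p = 0) :
    Module.Projective (degZeroAlg 𝒞.deg) V := by
  have hpe : ∀ p : leftIdealOf (CatAlg.single x x ε),
      (p : CatAlg C) * CatAlg.single x x ε = p := fun p => (mem_leftIdealOf hε).1 p.2
  -- Left multiplication by `1_x` is linear over the degree `0` part and kills the kernel of `π`. It
  -- descends to a map `ι` from `V` to the degree `0` algebra, of which `1 ↦ π ε` is a retraction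
  -- because `V` lives at `x` only.
  let F : leftIdealOf (CatAlg.single x x ε) →ₗ[degZeroAlg 𝒞.deg] degZeroAlg 𝒞.deg :=
    { toFun := fun p => ⟨CatAlg.obj x * (p : CatAlg C), by
        rw [← hpe p, ← mul_assoc, CatAlg.obj, CatAlg.single_mul_mul_single]
        exact 𝒞.single_mem_deg_zero _ _⟩
      map_add' := fun p q => Subtype.ext (mul_add _ _ _)
      map_smul' := fun c p => Subtype.ext (by
        change CatAlg.obj x * ((c : CatAlg C) * (p : CatAlg C)) =
          (c : CatAlg C) * (CatAlg.obj x * (p : CatAlg C))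
        rw [← mul_assoc, 𝒞.obj_mul_comm c.2, mul_assoc]) }
  let π' : leftIdealOf (CatAlg.single x x ε) →ₗ[degZeroAlg 𝒞.deg] V :=
    π.restrictScalars (degZeroAlg 𝒞.deg)
  have hF : LinearMap.ker π' ≤ LinearMap.ker F := fun p hp =>
    Subtype.ext (congrArg (fun q : leftIdealOf (CatAlg.single x x ε) => (q : CatAlg C)) (hker p hp))
  let e' : leftIdealOf (CatAlg.single x x ε) := ⟨_, Submodule.mem_span_singleton_self _⟩
  let ι : V →ₗ[degZeroAlg 𝒞.deg] degZeroAlg 𝒞.deg :=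
    (LinearMap.ker π').liftQ F hF ∘ₗ (π'.quotKerEquivOfSurjective hπ).symm.toLinearMap
  have hι : ∀ p, ι (π p) = F p := by
    intro p
    have : (π'.quotKerEquivOfSurjective hπ).symm (π p) = Submodule.Quotient.mk p :=
      (LinearEquiv.symm_apply_eq _).2 rfl
    change (LinearMap.ker π').liftQ F hF ((π'.quotKerEquivOfSurjective hπ).symm (π p)) = _
    rw [this]
    rfl
  refine Module.Projective.of_split ι (LinearMap.toSpanSingleton _ V (π e'))
    (LinearMap.ext fun v => ?_)
  obtain ⟨p, rfl⟩ := hπ v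
  rw [LinearMap.comp_apply, hι, LinearMap.toSpanSingleton_apply, LinearMap.id_apply]
  change (CatAlg.obj x * (p : CatAlg C)) • π e' = π p
  have h1 : (p : CatAlg C) • e' = p := Subtype.ext (hpe p)
  rw [mul_smul, ← map_smul, h1]
  refine Eq.trans ?_ (CatAlg.eq_sum_obj_smul (C := C) (π p)).symm
  rw [Finset.sum_eq_single x (fun y _ hy => hV y hy _) (by simp)]

/-- Each `Δ p` is supported at the object of `p`: smaller objects are excluded since `Δ p` is a
quotient of `P p` and the category is directed, all others by the condition on composition factors.
Hence every `Δ p`, then by the filtrations every `P p`, and finally their sum, the algebra, is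
projective over the degree `0` part. -/
theorem projective_of_isStandardlyStratified {E : PrimitiveIdempotents C}
    (h : 𝒞.IsStandardlyStratified E) : Module.Projective (degZeroAlg 𝒞.deg) (CatAlg C) := by
  classical
  have := 𝒞.finiteDimensional_catAlg
  obtain ⟨Δ, hΔ, hP⟩ := h
  have hsupp : ∀ p y, y ≠ p.1 → ∀ v : Δ p, (CatAlg.obj y : CatAlg C) • v = 0 := by
    intro p y hy v
    by_cases hle : 𝒞.order.le y p.1
    · obtain ⟨π, hπ, -⟩ := hP p
      obtain ⟨q, rfl⟩ := hπ v
      have hle' : ¬ 𝒞.order.le p.1 y := fun h' => hy (𝒞.order.le_antisymm _ _ hle h')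
      have : (CatAlg.obj y : CatAlg C) • q = 0 := Subtype.ext (by
        rw [Submodule.coe_smul, smul_eq_mul,
          ← (mem_leftIdealOf (E.isIdempotentElem_elem p)).1 q.2, ← mul_assoc]
        exact 𝒞.obj_mul_mul_single_eq_zero hle' _ _)
      rw [← map_smul, this, map_zero]
    · refine E.obj_smul_eq_zero fun i => ?_
      by_contra hne
      exact hΔ p ⟨y, i⟩ hle (isCompositionFactor_of_smul_ne_zero k (E.primitive_elem ⟨y, i⟩) hne)
  have hproj : ∀ p, Module.Projective (degZeroAlg 𝒞.deg) (Δ p) := by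
    intro p
    obtain ⟨π, hπ, hK⟩ := hP p
    -- The factors of the kernel belong to objects strictly above `p.1`, so the kernel has no part
    -- at `p.1`.
    refine 𝒞.projective_of_concentrated (E.isIdempotentElem_elem p) π hπ (hsupp p) fun q hq => ?_
    have := hK.smul_eq_zero (CatAlg.isIdempotentElem_obj p.1)
      (fun j hj => hsupp j p.1 fun h' => hj.2 (by
        change 𝒞.order.le j.1 p.1
        rw [h']
        exact 𝒞.order.le_refl _)) ⟨q, hq⟩
    exact congrArg Subtype.val this
  have hproj' : ∀ p, Module.Projective (degZeroAlg 𝒞.deg) (leftIdealOf (E.elem p)) := by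
    intro p
    obtain ⟨π, hπ, hK⟩ := hP p
    have h1 := hK.projective (degZeroAlg 𝒞.deg) fun j _ => hproj j
    have h2 := hproj p
    exact Module.Projective.of_exact (f := (LinearMap.ker π).subtype.restrictScalars (degZeroAlg 𝒞.deg))
      (g := π.restrictScalars (degZeroAlg 𝒞.deg)) Subtype.val_injective
      (fun q => ⟨fun hq => ⟨⟨q, hq⟩, rfl⟩, by rintro ⟨q, rfl⟩; exact q.2⟩) hπ
  have : Module.Projective (degZeroAlg 𝒞.deg)
      (∀ p : Σ x : C, Fin (E.card x), leftIdealOf (E.elem p)) :=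
    Module.Projective.of_equiv (DirectSum.linearEquivFunOnFintype (degZeroAlg 𝒞.deg)
      (Σ x : C, Fin (E.card x)) fun p => leftIdealOf (E.elem p))
  refine Module.Projective.of_split
    (LinearMap.pi fun p => ((LinearMap.toSpanSingleton (CatAlg C) (CatAlg C) (E.elem p)).codRestrict
      (leftIdealOf (E.elem p)) fun a =>
        Submodule.mem_span_singleton.2 ⟨a, rfl⟩).restrictScalars (degZeroAlg 𝒞.deg))
    (∑ p, ((leftIdealOf (E.elem p)).subtype.restrictScalars (degZeroAlg 𝒞.deg)) ∘ₗ
      LinearMap.proj p) (LinearMap.ext fun a => ?_)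
  rw [LinearMap.comp_apply, LinearMap.sum_apply, LinearMap.id_apply]
  change ∑ p, a * E.elem p = a
  rw [← Finset.mul_sum, E.sum_sigma_elem, mul_one]

end GradedDirectedCategory

/-! ## Projectivity gives stratifications -/

/-- A projective module with a simple quotient on which a primitive idempotent `e` acts nontrivially
maps onto `B e`. -/
theorem IsPrimitiveIdempotent.exists_surjective (k : Type w) [Field k] {B : Type u} [Ring B]
    [Algebra k B] [FiniteDimensional k B] {e : B} (he : IsPrimitiveIdempotent e) {V : Type*}
    [AddCommGroup V] [Module B V] [Module.Projective B V] {W : Submodule B V} (hW : IsCoatom W)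
    {v : V} (hv : e • v ∉ W) : ∃ θ : V →ₗ[B] leftIdealOf e, Function.Surjective θ := by
  let φ : leftIdealOf e →ₗ[B] V ⧸ W :=
    W.mkQ ∘ₗ LinearMap.toSpanSingleton B V v ∘ₗ (leftIdealOf e).subtype
  let e' : leftIdealOf e := ⟨e, Submodule.mem_span_singleton_self e⟩
  have hφe : φ e' ≠ 0 := fun h => hv ((Submodule.Quotient.mk_eq_zero W).1 h)
  have hsimple : IsSimpleModule B (V ⧸ W) := isSimpleModule_iff_isCoatom.2 hW
  have hφ : Function.Surjective φ := by
    rw [← LinearMap.range_eq_top]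
    refine (eq_bot_or_eq_top (LinearMap.range φ)).resolve_left fun h => hφe ?_
    have : φ e' ∈ LinearMap.range φ := ⟨e', rfl⟩
    rwa [h, Submodule.mem_bot] at this
  -- `θ` lifts the quotient map through `φ`, so its range and the kernel of `φ` together span `B e`.
  -- As `B e` is local and this kernel is proper, `θ` is onto.
  obtain ⟨θ, hθ⟩ := Module.projective_lifting_property φ W.mkQ hφ
  refine ⟨θ, LinearMap.range_eq_top.1 ?_⟩
  refine (he.eq_top_or_eq_top k (K := LinearMap.range θ) (L := LinearMap.ker φ)
    (eq_top_iff.2 fun p _ => ?_)).resolve_right fun h => hφe ?_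
  · obtain ⟨v', hv'⟩ := W.mkQ_surjective (φ p)
    refine Submodule.mem_sup.2 ⟨θ v', ⟨v', rfl⟩, p - θ v', ?_, add_sub_cancel _ _⟩
    rw [LinearMap.mem_ker, map_sub, ← hv', ← hθ, LinearMap.comp_apply, sub_self]
  · have : e' ∈ LinearMap.ker φ := by
      rw [h]
      trivial
    exact this

namespace GradedDirectedCategory

variable {k : Type w} [Field k] {C : Type u} [Category.{v} C] [Preadditive C] [Linear k C]
  [Fintype C] (𝒞 : GradedDirectedCategory k C) (E : PrimitiveIdempotents C)

/-- The primitive idempotents as elements of the degree `0` subalgebra. -/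
noncomputable def degZeroElem (p : Σ x : C, Fin (E.card x)) : degZeroAlg 𝒞.deg :=
  ⟨E.elem p, 𝒞.single_mem_deg_zero _ _⟩

theorem primitive_degZeroElem (p : Σ x : C, Fin (E.card x)) :
    IsPrimitiveIdempotent (𝒞.degZeroElem E p) := by
  obtain ⟨h1, h2, h3⟩ := E.primitive_elem p
  refine ⟨Subtype.ext h1, fun h => h2 (congrArg Subtype.val h), fun f g hf hg hfg hgf h => ?_⟩
  exact (h3 f g (congrArg Subtype.val hf) (congrArg Subtype.val hg) (congrArg Subtype.val hfg)
    (congrArg Subtype.val hgf) (congrArg Subtype.val h)).imp (fun h => Subtype.ext h)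
    fun h => Subtype.ext h

/-- The standard modules: the indecomposable projective modules over the endomorphism algebras of
the objects, regarded as modules over the associated algebra. -/
noncomputable def standard (p : Σ x : C, Fin (E.card x)) : ModuleCat.{max u v} (CatAlg C) :=
  (ModuleCat.restrictScalars 𝒞.diagonalPart).obj
    (ModuleCat.of (degZeroAlg 𝒞.deg) (leftIdealOf (𝒞.degZeroElem E p)))

variable {E} in
-- The algebra acts through its diagonal part, and a diagonal element has no entry between distinct
-- objects.
theorem elem_smul_standard_eq_zero {p q : Σ x : C, Fin (E.card x)} (h : q.1 ≠ p.1)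
    (x : 𝒞.standard E p) : (E.elem q : CatAlg C) • x = 0 := by
  obtain ⟨y, hy⟩ : leftIdealOf (𝒞.degZeroElem E p) := x
  refine Subtype.ext (Subtype.ext ?_)
  change (𝒞.diagonalPart (E.elem q) * y : CatAlg C) = 0
  rw [← (mem_leftIdealOf (𝒞.primitive_degZeroElem E p).1).1 hy,
    show E.elem q = (𝒞.degZeroElem E q : CatAlg C) from rfl, diagonalPart_coe]
  change E.elem q * ((y : CatAlg C) * E.elem p) = 0
  rw [← mul_assoc, PrimitiveIdempotents.elem, PrimitiveIdempotents.elem,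
    CatAlg.single_mul_mul_single, 𝒞.apply_eq_zero_of_mem_deg_zero y.2 h.symm, Limits.zero_comp,
    Limits.comp_zero, CatAlg.single_zero]

/-- A nonzero module that is projective in degree `0` maps onto a standard module belonging to a
minimal object of its support. -/
theorem exists_surjective_standard {V : Type max u v} [AddCommGroup V] [Module (CatAlg C) V]
    [Module k V] [IsScalarTower k (CatAlg C) V] [FiniteDimensional k V] [Nontrivial V]
    [Module.Projective (degZeroAlg 𝒞.deg) V] :
    ∃ (p : Σ x : C, Fin (E.card x)) (v : V) (f : V →ₗ[CatAlg C] 𝒞.standard E p),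
      (CatAlg.obj p.1 : CatAlg C) • v ≠ 0 ∧ Function.Surjective f ∧
      Module.Projective (degZeroAlg 𝒞.deg) (LinearMap.ker f) := by
  classical
  have := 𝒞.finiteDimensional_catAlg
  let := 𝒞.order
  obtain ⟨x, ⟨v₀, hv₀⟩, hmin⟩ : ∃ x, (∃ v : V, (CatAlg.obj x : CatAlg C) • v ≠ 0) ∧
      ∀ y < x, ∀ v : V, (CatAlg.obj y : CatAlg C) • v = 0 := by
    obtain ⟨v, hv⟩ := exists_ne (0 : V)
    have hne : {x : C | ∃ v : V, (CatAlg.obj x : CatAlg C) • v ≠ 0}.Nonempty := by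
      by_contra h
      refine hv ((CatAlg.eq_sum_obj_smul (C := C) v).trans (Finset.sum_eq_zero fun x _ => ?_))
      by_contra h'
      exact h ⟨x, v, h'⟩
    obtain ⟨x, hx⟩ := (Set.toFinite _).exists_minimal hne
    refine ⟨x, hx.1, fun y hy v => ?_⟩
    by_contra h'
    exact hx.not_lt ⟨v, h'⟩ hy
  let o : V →ₗ[degZeroAlg 𝒞.deg] V :=
    { toFun := fun v => (CatAlg.obj x : CatAlg C) • v
      map_add' := smul_add _
      map_smul' := fun c v => by
        change (CatAlg.obj x : CatAlg C) • (c : CatAlg C) • v =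
          (c : CatAlg C) • (CatAlg.obj x : CatAlg C) • v
        rw [smul_smul, smul_smul, 𝒞.obj_mul_comm c.2] }
  have hoo : ∀ v, o (o v) = o v := fun v => by
    change (CatAlg.obj x : CatAlg C) • (CatAlg.obj x : CatAlg C) • v = _
    rw [smul_smul, CatAlg.isIdempotentElem_obj]
    rfl
  -- Minimality of `x` makes `1_x V` a quotient of `V` over the whole algebra, acting through the
  -- diagonal: for `y < x` one has `1_y V = 0`, and for `y` not below `x` directedness gives `1_x a
  -- 1_y = 0`.
  have hoa : ∀ (a : CatAlg C) v, o (a • v) = 𝒞.diagonalPart a • o v := by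
    intro a v
    change (CatAlg.obj x : CatAlg C) • a • v =
      (𝒞.diagonalPart a : CatAlg C) • (CatAlg.obj x : CatAlg C) • v
    conv_lhs => rw [CatAlg.eq_sum_obj_smul (C := C) v]
    rw [Finset.smul_sum, Finset.smul_sum, Finset.sum_eq_single x, smul_smul, smul_smul, smul_smul,
      𝒞.obj_mul_mul_obj]
    · intro y _ hy
      by_cases hle : y ≤ x
      · rw [hmin y (lt_of_le_of_ne hle hy), smul_zero, smul_zero]
      · rw [smul_smul, smul_smul, CatAlg.obj.eq_def y, 𝒞.obj_mul_mul_single_eq_zero hle, zero_smul]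
    · simp
  have hproj : Module.Projective (degZeroAlg 𝒞.deg) (LinearMap.range o) :=
    Module.Projective.of_split (LinearMap.range o).subtype o.rangeRestrict
      (LinearMap.ext fun v => Subtype.ext (by obtain ⟨-, v, rfl⟩ := v; exact hoo v))
  have hfin : Module.Finite (degZeroAlg 𝒞.deg) V :=
    Module.Finite.of_restrictScalars_finite k (degZeroAlg 𝒞.deg) V
  have hnt : Nontrivial (LinearMap.range o) :=
    ⟨⟨o v₀, ⟨v₀, rfl⟩⟩, 0, fun h => hv₀ (congrArg Subtype.val h)⟩
  have hfin' : Module.Finite (degZeroAlg 𝒞.deg) (LinearMap.range o) := inferInstance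
  obtain ⟨W, hW⟩ := IsCoatomic.exists_coatom
    (α := Submodule (degZeroAlg 𝒞.deg) (LinearMap.range o))
  obtain ⟨v, hv⟩ : ∃ v, v ∉ W := by
    by_contra! h
    exact hW.1 (eq_top_iff.2 fun v _ => h v)
  -- The idempotents at `x` sum to `1_x`, which is the identity on `1_x V`, so one of them acts
  -- nontrivially on the simple quotient by `W`.
  obtain ⟨i, hi⟩ : ∃ i, 𝒞.degZeroElem E ⟨x, i⟩ • v ∉ W := by
    by_contra! h
    refine hv ?_
    have : v = ∑ i, 𝒞.degZeroElem E ⟨x, i⟩ • v := Subtype.ext (by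
      rw [AddSubmonoidClass.coe_finsetSum]
      change (v : V) = ∑ i, E.elem ⟨x, i⟩ • (v : V)
      rw [← Finset.sum_smul, E.sum_elem]
      obtain ⟨-, v, rfl⟩ := v
      exact (hoo v).symm)
    rw [this]
    exact W.sum_mem fun i _ => h i
  obtain ⟨θ, hθ⟩ := (𝒞.primitive_degZeroElem E ⟨x, i⟩).exists_surjective k hW hi
  let g := θ ∘ₗ o.rangeRestrict
  have hg : Function.Surjective g := hθ.comp o.surjective_rangeRestrict
  let f : V →ₗ[CatAlg C] 𝒞.standard E ⟨x, i⟩ :=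
    { toFun := g
      map_add' := map_add g
      map_smul' := fun a v => by
        change θ (o.rangeRestrict (a • v)) = 𝒞.diagonalPart a • θ (o.rangeRestrict v)
        rw [← map_smul]
        exact congrArg θ (Subtype.ext (hoa a v)) }
  have := projective_leftIdealOf (𝒞.primitive_degZeroElem E ⟨x, i⟩).1
  have := Module.Projective.ker hg
  let e : LinearMap.ker g ≃ₗ[degZeroAlg 𝒞.deg] LinearMap.ker f :=
    { toFun := fun v => ⟨v.1, v.2⟩
      invFun := fun v => ⟨v.1, v.2⟩
      map_add' := fun _ _ => rfl
      map_smul' := fun _ _ => rfl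
      left_inv := fun _ => rfl
      right_inv := fun _ => rfl }
  exact ⟨⟨x, i⟩, v₀, f, hv₀, hg, Module.Projective.of_equiv e⟩

/-- A standard quotient at a minimal object is split off from the top. Its kernel is again
projective over the degree `0` part, has smaller dimension, and its support still satisfies `s`. -/
theorem hasFiltrationBy_standard (s : C → Prop) {V : Type max u v} [AddCommGroup V]
    [Module (CatAlg C) V] [Module k V] [IsScalarTower k (CatAlg C) V] [FiniteDimensional k V]
    [Module.Projective (degZeroAlg 𝒞.deg) V]
    (hV : ∀ x, ∀ v : V, (CatAlg.obj x : CatAlg C) • v ≠ 0 → s x) :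
    HasFiltrationBy (CatAlg C) (𝒞.standard E) (fun p => s p.1) V := by
  induction h : Module.finrank k V using Nat.strong_induction_on generalizing V with
  | _ n ih =>
    rcases subsingleton_or_nontrivial V with h' | h'
    · exact HasFiltrationBy.of_subsingleton
    · obtain ⟨p, v, f, hv, hf, hproj⟩ := 𝒞.exists_surjective_standard E (V := V)
      refine HasFiltrationBy.of_surjective (hV _ v hv) f hf ?_
      have : FiniteDimensional k (LinearMap.ker f) :=
        FiniteDimensional.of_injective ((LinearMap.ker f).subtype.restrictScalars k)
          Subtype.val_injective
      refine ih (Module.finrank k (LinearMap.ker f)) ?_ (fun x v hv => hV x v fun h0 =>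
        hv (Subtype.ext h0)) rfl
      have hlt : (LinearMap.ker f).restrictScalars k ≠ ⊤ := by
        intro htop
        obtain ⟨v', hv'⟩ := hf ⟨𝒞.degZeroElem E p, Submodule.mem_span_singleton_self _⟩
        have h0 : v' ∈ (LinearMap.ker f).restrictScalars k := by
          rw [htop]
          trivial
        refine (𝒞.primitive_degZeroElem E p).2.1 ?_
        exact congrArg Subtype.val (hv'.symm.trans h0)
      rw [← h]
      exact Submodule.finrank_lt hlt

/-- Taking diagonal entries maps `P p` onto the standard module. The kernel is projective over the
degree `0` part, since both modules are, and it is supported strictly above the object of `p`; the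
previous lemma filters it. -/
theorem isStandardlyStratified_of_projective
    (h : Module.Projective (degZeroAlg 𝒞.deg) (CatAlg C)) : 𝒞.IsStandardlyStratified E := by
  have := 𝒞.finiteDimensional_catAlg
  refine ⟨𝒞.standard E, fun p q hpq => ?_, fun p => ?_⟩
  · refine not_isCompositionFactor_of_smul_eq_zero (E.isIdempotentElem_elem q) (E.elem_ne_zero q)
      fun x => 𝒞.elem_smul_standard_eq_zero (fun hqp => hpq ?_) x
    change 𝒞.order.le q.1 p.1
    rw [hqp]
    exact 𝒞.order.le_refl _
  · have hmem : ∀ a : leftIdealOf (E.elem p), (a : CatAlg C) * E.elem p = a := fun a =>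
      (mem_leftIdealOf (E.isIdempotentElem_elem p)).1 a.2
    have hcoe : 𝒞.diagonalPart (E.elem p) = 𝒞.degZeroElem E p :=
      𝒞.diagonalPart_coe (𝒞.degZeroElem E p)
    have hid := (𝒞.primitive_degZeroElem E p).1
    let π₀ : leftIdealOf (E.elem p) → leftIdealOf (𝒞.degZeroElem E p) := fun a =>
      ⟨𝒞.diagonalPart a, (mem_leftIdealOf hid).2 (by rw [← hcoe, ← map_mul, hmem])⟩
    let π : leftIdealOf (E.elem p) →ₗ[CatAlg C] 𝒞.standard E p :=
      { toFun := π₀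
        map_add' := fun a b => Subtype.ext (map_add 𝒞.diagonalPart _ _)
        map_smul' := fun c a => Subtype.ext (map_mul 𝒞.diagonalPart _ _) }
    have hπ : Function.Surjective π := by
      intro y
      obtain ⟨c, hc⟩ : leftIdealOf (𝒞.degZeroElem E p) := y
      refine ⟨⟨(c : CatAlg C), (mem_leftIdealOf (E.isIdempotentElem_elem p)).2
        (congrArg Subtype.val ((mem_leftIdealOf hid).1 hc))⟩, Subtype.ext (𝒞.diagonalPart_coe c)⟩
    refine ⟨π, hπ, ?_⟩
    have : Module.Projective (degZeroAlg 𝒞.deg) (GrMod.self 𝒞.deg).carrier := h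
    have hP : Module.Projective (degZeroAlg 𝒞.deg) (leftIdealOf (E.elem p)) :=
      GrMod.projective_degZeroAlg_of_projective
        (projective_leftIdealOf (E.isIdempotentElem_elem p))
    have := projective_leftIdealOf hid
    let g : leftIdealOf (E.elem p) →ₗ[degZeroAlg 𝒞.deg] leftIdealOf (𝒞.degZeroElem E p) :=
      { toFun := π₀
        map_add' := fun a b => Subtype.ext (map_add 𝒞.diagonalPart _ _)
        map_smul' := fun c a => Subtype.ext ((map_mul 𝒞.diagonalPart _ _).trans (by
          rw [diagonalPart_coe]
          rfl)) }
    have := Module.Projective.ker (f := g) hπ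
    let e : LinearMap.ker g ≃ₗ[degZeroAlg 𝒞.deg] LinearMap.ker π :=
      { toFun := fun v => ⟨v.1, v.2⟩
        invFun := fun v => ⟨v.1, v.2⟩
        map_add' := fun _ _ => rfl
        map_smul' := fun _ _ => rfl
        left_inv := fun _ => rfl
        right_inv := fun _ => rfl }
    have := Module.Projective.of_equiv e
    have : FiniteDimensional k (leftIdealOf (E.elem p)) :=
      FiniteDimensional.of_injective ((leftIdealOf (E.elem p)).subtype.restrictScalars k)
        Subtype.val_injective
    have : FiniteDimensional k (LinearMap.ker π) :=
      FiniteDimensional.of_injective ((LinearMap.ker π).subtype.restrictScalars k)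
        Subtype.val_injective
    refine 𝒞.hasFiltrationBy_standard E (fun y => 𝒞.order.le p.1 y ∧ ¬ 𝒞.order.le y p.1)
      (V := LinearMap.ker π) fun y v hv => ?_
    obtain ⟨a, ha⟩ := v
    have hya : CatAlg.obj y * (a : CatAlg C) * E.elem p ≠ 0 := fun h0 => hv (Subtype.ext
      (Subtype.ext (by
        rw [mul_assoc, hmem] at h0
        exact h0)))
    have hle : 𝒞.order.le p.1 y := by
      by_contra hle
      exact hya (𝒞.obj_mul_mul_single_eq_zero hle _ _)
    refine ⟨hle, fun hle' => hya ?_⟩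
    obtain rfl := 𝒞.order.le_antisymm _ _ hle hle'
    -- At the object of `p` itself the entry of an element of `P p` is read off from its diagonal
    -- part, which vanishes on the kernel.
    have hzero : ∀ b : CatAlg C, 𝒞.diagonalPart b = 0 →
        CatAlg.obj p.1 * b * E.elem p = 0 := fun b hb => by
      rw [← E.obj_mul_elem, ← mul_assoc, 𝒞.obj_mul_mul_obj, hb]
      exact (congrArg (· * E.elem p) (zero_mul _)).trans (zero_mul _)
    exact hzero _ (congrArg Subtype.val ha)

theorem isStandardlyStratified_iff : 𝒞.IsStandardlyStratified E ↔
    Module.Projective (degZeroAlg 𝒞.deg) (CatAlg C) :=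
  ⟨𝒞.projective_of_isStandardlyStratified, 𝒞.isStandardlyStratified_of_projective E⟩

end GradedDirectedCategory

theorem theorem3p2p8 {k : Type w} [Field k] {C : Type u} [Category.{v} C] [Preadditive C]
    [Linear k C] [Fintype C] (𝒞 : GradedDirectedCategory k C)
    (hS : SplittingConditionS (degZeroAlg 𝒞.deg)) :
    (∀ E : PrimitiveIdempotents C,
      (𝒞.IsKoszul ↔ 𝒞.IsStandardlyStratified E ∧ 𝒞.SubIsClassicalKoszul)) ∧
    (𝒞.IsKoszul → ∀ M : GrMod k (CatAlg C) 𝒞.deg,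
      M.LocallyFinite → M.GeneratedInDegree 0 →
      (M.IsKoszul ↔
        (M.restrict 𝒞.diagonalSub).IsKoszul ∧
          Module.Projective (degZeroAlg 𝒞.deg) M.carrier)) := by
  refine ⟨fun E => ?_, fun h M hM hgen => 𝒞.isKoszul_module_iff hS.1 h hM hgen⟩
  rw [𝒞.isKoszul_iff_projective hS.1, 𝒞.isStandardlyStratified_iff E]
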